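/- For $T>0$ let $X$ be the space of all $u\in C([0,T],L^3(\mathbb R^3;\mathbb R^3))$ such that $\nabla\cdot u(t)=0$ in the sense of distributions for every $t\in[0,T]$, $$\|u\|_X=\sup_{t\in[0,T]}\|u(t)\|_{L^3}+\sup_{0<t\le T}\sqrt t\,\|u(t)\|_{L^\infty}<\infty\quad\text{and}\quad \lim_{t\to0^+}\sqrt t\,\|u(t)\|_{L^\infty}=0,$$ and let $Y$ be the space of all $\theta\in C([0,T],L^1(\mathbb R^3;\mathbb R))$ such that $$\|\theta\|_Y=\sup_{t\in[0,T]}\|\theta(t)\|_{L^1}+\sup_{0<t\le T}t^{3/2}\|\theta(t)\|_{L^\infty}<\infty\quad\text{and}\quad \lim_{t\to0^+}t^{3/2}\|\theta(t)\|_{L^\infty}=0.$$ Let $\mathbb P$ be the Leray projector, i.e. the Fourier multiplier with matrix symbol $\big(\delta_{kj}-\xi_k\xi_j/|\xi|^2\big)_{k,j}$, and let $e_3=(0,0,1)$. For $t>0$ the operators $e^{t\Delta}$, $e^{t\Delta}\nabla\cdot$, $e^{t\Delta}\mathbb P$ and $e^{t\Delta}\mathbb P\nabla\cdot$ are the convolution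 operators whose kernels are the inverse Fourier transforms of their symbols. A mild solution of the Boussinesq system on $[0,T]$ with initial data $(u_0,\theta_0)$ is a pair $(u,\theta)$ such that $u(0)=u_0$, $\theta(0)=\theta_0$ and, for every $t\in(0,T]$ and almost every $x\in\mathbb R^3$, $$\theta(t)=e^{t\Delta}\theta_0-\int_0^t e^{(t-s)\Delta}\nabla\cdot(\theta u)(s)\,ds,$$ $$u(t)=e^{t\Delta}u_0-\int_0^t e^{(t-s)\Delta}\mathbb P\nabla\cdot(u\otimes u)(s)\,ds+\int_0^t e^{(t-s)\Delta}\mathbb P\,\theta(s)e_3\,ds,$$ where the convolution integrals (for almost every $s\in(0,t)$) and the time integrals converge absolutely. **Proposition 1.1.** Let $u_0\in L^3(\mathbb R^3;\mathbb R^3)$ be a divergence-free vector field (in the sense of distributions) and let $\theta_0\in L^1(\mathbb R^3;\mathbb R)$. Then there exists $T>0$ such that the Boussinesq system has one and only one mild solution $(u,\theta)\in X\times Y$ on $[0,T]$ with initial data $(u_0,\theta_0)$. -/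

import Mathlib

open MeasureTheory Set Filter Topology
open scoped ENNReal FourierTransform

noncomputable section

namespace Boussinesq

/-- The physical space `ℝ³` with its Euclidean norm; also the space of values of the velocity. -/
abbrev E3 : Type := EuclideanSpace ℝ (Fin 3)

/-- The unit vertical vector `(0,0,1)`. -/
def e3 : E3 := EuclideanSpace.single 2 1

instance factOneLeThree : Fact ((1 : ℝ≥0∞) ≤ 3) := ⟨by norm_num⟩

/-- Vector fields in `L³(ℝ³)`, modulo equality almost everywhere. -/
abbrev VectorL3 : Type := Lp E3 3 (volume : Measure E3)

/-- Scalar functions in `L¹(ℝ³)`, modulo equality almost everywhere. -/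
abbrev ScalarL1 : Type := Lp ℝ 1 (volume : Measure E3)

/-- `∇ · f = 0` in the sense of distributions: `∫ f · ∇φ = 0` for every test function `φ`. -/
def IsDivergenceFree (f : E3 → E3) : Prop :=
  ∀ φ : E3 → ℝ, ContDiff ℝ (⊤ : ℕ∞) φ → HasCompactSupport φ → ∫ x, fderiv ℝ φ x (f x) = 0

/-! ### Fourier multipliers

The Fourier transform is `𝓕 f ξ = ∫ e^{-2πi x·ξ} f x dx`. -/

/-- The symbol of `e^{tΔ}`. -/
def heatSymbol (t : ℝ) (ξ : E3) : ℂ := (Real.exp (-(4 * Real.pi ^ 2 * t * ‖ξ‖ ^ 2)) : ℝ)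

/-- The symbol of the partial derivative `∂_l`. -/
def derivSymbol (l : Fin 3) (ξ : E3) : ℂ := 2 * Real.pi * Complex.I * (ξ l : ℝ)

/-- The `(k, j)` entry `δ_{kj} - ξ_k ξ_j / |ξ|²` of the symbol of the Leray projector
(its value at the single point `ξ = 0` is immaterial). -/
def leraySymbol (k j : Fin 3) (ξ : E3) : ℂ :=
  (((if k = j then 1 else 0) - ξ k * ξ j / ‖ξ‖ ^ 2 : ℝ) : ℂ)

/-- The convolution kernel of the operator with symbol `m`. All symbols used below are
integrable and satisfy `m (-ξ) = conj (m ξ)`, so that their inverse Fourier transform is a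
real-valued continuous function. -/
def kernel (m : E3 → ℂ) (x : E3) : ℝ := (𝓕⁻ m x).re

/-- The operator with symbol `m`, `f ↦ (𝓕⁻ m) * f`, on functions with values in `V`. -/
def multiplierOp {V : Type} [NormedAddCommGroup V] [NormedSpace ℝ V]
    (m : E3 → ℂ) (f : E3 → V) (x : E3) : V :=
  ∫ y, kernel m (x - y) • f y

/-- The convolution integral `((𝓕⁻ m) * f)(x)` converges absolutely. -/
def MultiplierConverges (m : E3 → ℂ) (f : E3 → ℝ) (x : E3) : Prop :=
  Integrable (fun y => kernel m (x - y) * f y)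

/-- The symbol of `e^{tΔ} ∂_l`. -/
def heatDivSymbol (t : ℝ) (l : Fin 3) (ξ : E3) : ℂ := heatSymbol t ξ * derivSymbol l ξ

/-- The symbol of the `(k, j)` entry of `e^{tΔ} ℙ`. -/
def heatLeraySymbol (t : ℝ) (k j : Fin 3) (ξ : E3) : ℂ := heatSymbol t ξ * leraySymbol k j ξ

/-- The symbol of the `(k, j)` entry of `e^{tΔ} ℙ ∂_l`. -/
def heatLerayDivSymbol (t : ℝ) (k j l : Fin 3) (ξ : E3) : ℂ :=
  heatSymbol t ξ * leraySymbol k j ξ * derivSymbol l ξ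

/-- `e^{tΔ} f` for `t > 0`. -/
def heat {V : Type} [NormedAddCommGroup V] [NormedSpace ℝ V]
    (t : ℝ) (f : E3 → V) (x : E3) : V :=
  multiplierOp (heatSymbol t) f x

/-- `e^{tΔ} ∇ · F` for a vector field `F` and `t > 0`. -/
def heatDiv (t : ℝ) (F : E3 → E3) (x : E3) : ℝ :=
  ∑ l, multiplierOp (heatDivSymbol t l) (fun y => F y l) x

/-- `e^{tΔ} ℙ F` for a vector field `F` and `t > 0`. -/
def heatLeray (t : ℝ) (F : E3 → E3) (x : E3) : E3 :=
  WithLp.toLp 2 fun k => ∑ j, multiplierOp (heatLeraySymbol t k j) (fun y => F y j) x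

/-- `e^{tΔ} ℙ ∇ · M` for a matrix field `M` and `t > 0`, with `(∇ · M)_j = ∑_l ∂_l M_{lj}`. -/
def heatLerayDiv (t : ℝ) (M : E3 → Matrix (Fin 3) (Fin 3) ℝ) (x : E3) : E3 :=
  WithLp.toLp 2 fun k =>
    ∑ j, ∑ l, multiplierOp (heatLerayDivSymbol t k j l) (fun y => M y l j) x

/-- The matrix field `u ⊗ v`. -/
def tensor (u v : E3 → E3) (x : E3) : Matrix (Fin 3) (Fin 3) ℝ :=
  Matrix.of fun l j => u x l * v x j

/-! ### The spaces `X` and `Y`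

A path on `[0,T]` is the restriction to `[0,T]` of a function of a real variable; the values
outside `[0,T]` play no role. -/

/-- `sup_{[0,T]} ‖u(t)‖₃ + sup_{(0,T]} √t ‖u(t)‖_∞`, a value in `[0,∞]`. -/
def normX (T : ℝ) (u : ℝ → VectorL3) : ℝ≥0∞ :=
  (⨆ t ∈ Icc 0 T, eLpNorm (u t) 3 volume) +
    ⨆ t ∈ Ioc 0 T, ENNReal.ofReal (√t) * eLpNorm (u t) ⊤ volume

/-- `sup_{[0,T]} ‖θ(t)‖₁ + sup_{(0,T]} t^{3/2} ‖θ(t)‖_∞`, a value in `[0,∞]`. -/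
def normY (T : ℝ) (θ : ℝ → ScalarL1) : ℝ≥0∞ :=
  (⨆ t ∈ Icc 0 T, eLpNorm (θ t) 1 volume) +
    ⨆ t ∈ Ioc 0 T, ENNReal.ofReal (t ^ (3 / 2 : ℝ)) * eLpNorm (θ t) ⊤ volume

/-- The space `X` of velocities. -/
structure MemX (T : ℝ) (u : ℝ → VectorL3) : Prop where
  continuousOn : ContinuousOn u (Icc 0 T)
  divergenceFree : ∀ t ∈ Icc 0 T, IsDivergenceFree (u t)
  norm_lt_top : normX T u < ⊤
  tendsto_zero :
    Tendsto (fun t : ℝ => ENNReal.ofReal (√t) * eLpNorm (u t) ⊤ volume) (𝓝[>] 0) (𝓝 0)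

/-- The space `Y` of temperatures. -/
structure MemY (T : ℝ) (θ : ℝ → ScalarL1) : Prop where
  continuousOn : ContinuousOn θ (Icc 0 T)
  norm_lt_top : normY T θ < ⊤
  tendsto_zero :
    Tendsto (fun t : ℝ => ENNReal.ofReal (t ^ (3 / 2 : ℝ)) * eLpNorm (θ t) ⊤ volume)
      (𝓝[>] 0) (𝓝 0)

/-! ### Mild solutions -/

/-- `(u, θ)` satisfies the integral form of the Boussinesq system on `[0,T]` with initial data
`(u₀, θ₀)`. At `t = 0` the equations read `u(0) = u₀`, `θ(0) = θ₀`; at every `t ∈ (0,T]` they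
are identities in `L³` and `L¹`, i.e. for almost every `x`, and all the integrals in
space and time that occur in them are required to converge absolutely. -/
structure IsMildSolution (T : ℝ) (u₀ : VectorL3) (θ₀ : ScalarL1)
    (u : ℝ → VectorL3) (θ : ℝ → ScalarL1) : Prop where
  initial_velocity : u 0 = u₀
  initial_temperature : θ 0 = θ₀
  space_integrals : ∀ t ∈ Ioc 0 T, ∀ᵐ x : E3, ∀ᵐ s : ℝ, s ∈ Ioo 0 t →
    (∀ l, MultiplierConverges (heatDivSymbol (t - s) l) (fun y => θ s y * u s y l) x) ∧
    (∀ k j l, MultiplierConverges (heatLerayDivSymbol (t - s) k j l)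
      (fun y => u s y l * u s y j) x) ∧
    (∀ k j, MultiplierConverges (heatLeraySymbol (t - s) k j) (fun y => θ s y * e3 j) x)
  time_integrals : ∀ t ∈ Ioc 0 T, ∀ᵐ x : E3,
    IntervalIntegrable (fun s => heatDiv (t - s) (fun y => θ s y • u s y) x) volume 0 t ∧
    IntervalIntegrable (fun s => heatLerayDiv (t - s) (tensor (u s) (u s)) x) volume 0 t ∧
    IntervalIntegrable (fun s => heatLeray (t - s) (fun y => θ s y • e3) x) volume 0 t
  temperature : ∀ t ∈ Ioc 0 T, ∀ᵐ x : E3,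
    θ t x = heat t θ₀ x - ∫ s in (0 : ℝ)..t, heatDiv (t - s) (fun y => θ s y • u s y) x
  velocity : ∀ t ∈ Ioc 0 T, ∀ᵐ x : E3,
    u t x = heat t u₀ x - (∫ s in (0 : ℝ)..t, heatLerayDiv (t - s) (tensor (u s) (u s)) x)
      + ∫ s in (0 : ℝ)..t, heatLeray (t - s) (fun y => θ s y • e3) x

end Boussinesq

end

noncomputable section

namespace Boussinesq

/-! ### Young's convolution inequality for operator-valued kernels -/

/-! The spaces X and Y are critical for the scaling of the system, so no positive power of T is
available to make the Duhamel terms small. Smallness comes from the data instead: the weighted norms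
of `e^{tΔ} u₀` and `e^{tΔ} θ₀` tend to zero as t → 0, by density of compactly supported functions
(`tendsto_heat_weighted`).

The fixed point is sought not in X × Y but in an auxiliary class of Kato type: u in L⁴ with weight
t^{1/8}, θ in L^{4/3} with weight t^{3/8}, both weighted norms vanishing at t = 0. There u ⊗ u lies
in L² and θu in L¹. By Young's inequality `e^{τΔ}ℙ∇·` : L² → L⁴, `e^{τΔ}ℙ` : L^{4/3} → L⁴ and
`e^{τΔ}∇·` : L¹ → L^{4/3} have norms of order τ^{-7/8}, τ^{-3/4}, τ^{-7/8}. These singularities are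
integrable, and the Beta integrals return exactly the weights one started with. The buoyancy term is
linear in θ and carries no small factor, but the temperature equation is homogeneous in θ apart from
its data. Measuring θ in units of a small constant `lam` therefore makes buoyancy small and leaves
the transport estimate unchanged (`DuhamelSystem.picard_contract`). The rescaled data still vanish
at t = 0, so T is chosen last. Uniqueness needs no smallness of the competitor: it vanishes at t =
0, hence is small at first, and a first time at which it becomes large is excluded by the
contraction (`PicardMap.unique`).

Only scaling and decay of the kernels matter. Those without ℙ are Schwartz at τ = 1. For the others,
|ξ|^{-2} e^{-4π²|ξ|²} is 4π² times the integral of e^{-4π²σ|ξ|²} over σ > 1. The kernel is thus a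
superposition of dilated Schwartz functions, decaying like (1+|x|)^{-3}, or (1+|x|)^{-4} with one
derivative (`superposition_eq`, `decayingSymbol_superposition`).

The return to X × Y has two halves. For existence, the bounds A t^{-1/2} and B t^{-3/2} in L^∞ are
imposed as closed constraints during the iteration (`exists_top_bound`, `exists_small_parameters`).
The same Duhamel formulas are then read in L³ and L¹, where they are continuous up to t = 0. Bochner
integrals in different L^p spaces are compared through their pointwise values
(`ae_integral_Lp_apply`). Divergence-freeness holds because ξ is orthogonal to the range of the
Leray symbol. For uniqueness, X × Y embeds in the Kato class by interpolation with L^∞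
(`katoPath_of_mem`), and a mild solution there solves the Bochner equations
(`IsMildSolution.katoSolution`). -/

/-- The exponents of Young's inequality `‖k * f‖_p ≤ ‖k‖_r ‖f‖_q`, all of them finite. -/
structure YoungTriple (r q p : ℝ≥0∞) : Prop where
  one_le_r : 1 ≤ r
  one_le_q : 1 ≤ q
  one_le_p : 1 ≤ p
  r_ne_top : r ≠ ⊤
  q_ne_top : q ≠ ⊤
  p_ne_top : p ≠ ⊤
  inv_add_inv : 1 / r.toReal + 1 / q.toReal = 1 / p.toReal + 1

/-- Write f g = (f^r g^q)^{1/p} (f^r)^{1/r - 1/p} (g^q)^{1/q - 1/p} and apply Hölder with three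
factors, whose exponents sum to 1. Translation invariance makes the last two integrals independent
of x, and Tonelli integrates the first. -/
lemma lintegral_young {f g : E3 → ℝ≥0∞} (hf : Measurable f) (hg : AEMeasurable g volume)
    {r q p : ℝ} (hr : 1 ≤ r) (hq : 1 ≤ q) (hp : 1 ≤ p) (h : 1 / r + 1 / q = 1 / p + 1) :
    (∫⁻ x, (∫⁻ y, f (x - y) * g y) ^ p) ^ (1 / p)
      ≤ (∫⁻ x, f x ^ r) ^ (1 / r) * (∫⁻ x, g x ^ q) ^ (1 / q) := by
  have hp0 : 0 < p := by linarith
  have hr0 : 0 < r := by linarith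
  have hq0 : 0 < q := by linarith
  have hr1 : 1 / r ≤ 1 := by rw [div_le_one hr0]; exact hr
  have hq1 : 1 / q ≤ 1 := by rw [div_le_one hq0]; exact hq
  have hp1 : 0 < 1 / p := by positivity
  set A := ∫⁻ x, f x ^ r with hA
  set B := ∫⁻ x, g x ^ q with hB
  have hfx : ∀ x : E3, ∫⁻ y, f (x - y) ^ r = A := fun x =>
    lintegral_sub_left_eq_self (μ := volume) (fun y => f y ^ r) x
  have key : ∀ x, ∫⁻ y, f (x - y) * g y ≤
      (∫⁻ y, f (x - y) ^ r * g y ^ q) ^ (1 / p) * (A ^ (1 / r - 1 / p) * B ^ (1 / q - 1 / p)) := by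
    intro x
    have hm : AEMeasurable (fun y => f (x - y) ^ r) volume := by fun_prop
    have := ENNReal.lintegral_prod_norm_pow_le (μ := volume) (Finset.univ : Finset (Fin 3))
      (f := ![fun y => f (x - y) ^ r * g y ^ q, fun y => f (x - y) ^ r, fun y => g y ^ q])
      (p := ![1 / p, 1 / r - 1 / p, 1 / q - 1 / p])
      (by
        intro i _
        fin_cases i
        · exact hm.mul (hg.pow_const _)
        · exact hm
        · exact hg.pow_const _)
      (by simp [Fin.sum_univ_three]; simp at h; linarith)
      (by
        intro i _
        fin_cases i
        · exact hp1.le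
        · simp at *; linarith
        · simp at *; linarith)
    simp only [Fin.prod_univ_three, Matrix.cons_val_zero, Matrix.cons_val_one,
      Matrix.cons_val_two, Matrix.head_cons, Matrix.tail_cons] at this
    rw [hfx x, mul_assoc] at this
    refine le_trans (le_of_eq (lintegral_congr fun y => ?_)) this
    rw [ENNReal.mul_rpow_of_nonneg _ _ hp1.le, ← ENNReal.rpow_mul, ← ENNReal.rpow_mul,
      ← ENNReal.rpow_mul, ← ENNReal.rpow_mul]
    rw [show ∀ a b c d : ℝ≥0∞, a * b * c * d = (a * c) * (b * d) by intros; ring,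
      ← ENNReal.rpow_add_of_nonneg _ _ (by positivity)
        (mul_nonneg hr0.le (by linarith)), ← ENNReal.rpow_add_of_nonneg _ _ (by positivity)
        (mul_nonneg hq0.le (by linarith))]
    have e1 : r * (1 / p) + r * (1 / r - 1 / p) = 1 := by field_simp; ring
    have e2 : q * (1 / p) + q * (1 / q - 1 / p) = 1 := by field_simp; ring
    rw [e1, e2, ENNReal.rpow_one, ENNReal.rpow_one]
  have hmeas : AEMeasurable (fun z : E3 × E3 => f (z.1 - z.2) ^ r * g z.2 ^ q)
      (volume.prod volume) := by
    have h1 : Measurable (fun z : E3 × E3 => f (z.1 - z.2) ^ r) := by fun_prop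
    exact h1.aemeasurable.mul ((hg.comp_snd).pow_const _)
  have hswap : ∫⁻ x, ∫⁻ y, f (x - y) ^ r * g y ^ q = A * B := by
    rw [lintegral_lintegral_swap hmeas]
    have : ∀ y : E3, ∫⁻ x, f (x - y) ^ r * g y ^ q = A * g y ^ q := by
      intro y
      rw [lintegral_mul_const _ (by fun_prop)]
      congr 1
      exact lintegral_sub_right_eq_self (μ := volume) (fun x => f x ^ r) y
    simp_rw [this]
    rw [lintegral_const_mul'' _ (hg.pow_const _)]
  calc (∫⁻ x, (∫⁻ y, f (x - y) * g y) ^ p) ^ (1 / p)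
      ≤ (∫⁻ x, (∫⁻ y, f (x - y) ^ r * g y ^ q) *
          (A ^ (1 / r - 1 / p) * B ^ (1 / q - 1 / p)) ^ p) ^ (1 / p) := by
        gcongr with x
        refine (ENNReal.rpow_le_rpow (key x) hp0.le).trans (le_of_eq ?_)
        rw [ENNReal.mul_rpow_of_nonneg _ _ hp0.le, ← ENNReal.rpow_mul, one_div_mul_cancel hp0.ne',
          ENNReal.rpow_one]
    _ = (A * B * (A ^ (1 / r - 1 / p) * B ^ (1 / q - 1 / p)) ^ p) ^ (1 / p) := by
        rw [lintegral_mul_const'' _ hmeas.lintegral_prod_right', hswap]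
    _ = A ^ (1 / r) * B ^ (1 / q) := by
        rw [ENNReal.mul_rpow_of_nonneg _ _ hp1.le, ← ENNReal.rpow_mul, mul_one_div_cancel hp0.ne',
          ENNReal.rpow_one, ENNReal.mul_rpow_of_nonneg _ _ hp1.le,
          show ∀ a b c d : ℝ≥0∞, a * b * (c * d) = (a * c) * (b * d) by intros; ring,
          ← ENNReal.rpow_add_of_nonneg _ _ hp1.le (by linarith),
          ← ENNReal.rpow_add_of_nonneg _ _ hp1.le (by linarith)]
        congr 2 <;> ring

variable {V W : Type*} [NormedAddCommGroup V] [NormedSpace ℝ V]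
  [NormedAddCommGroup W] [NormedSpace ℝ W]

/-- Convolution `∫ k(x - y) f(y) dy` of a function with an operator-valued kernel. -/
def kconv (k : E3 → V →L[ℝ] W) (f : E3 → V) (x : E3) : W := ∫ y, k (x - y) (f y)

lemma ae_sub_left {P : E3 → Prop} (h : ∀ᵐ y, P y) (x : E3) : ∀ᵐ y : E3, P (x - y) :=
  ((Measure.measurePreserving_sub_left (volume : Measure E3) x).quasiMeasurePreserving).ae h

lemma kconv_congr {k k' : E3 → V →L[ℝ] W} {f f' : E3 → V} (hk : k =ᵐ[volume] k')
    (hf : f =ᵐ[volume] f') : kconv k f = kconv k' f' := by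
  funext x
  refine integral_congr_ae ?_
  filter_upwards [ae_sub_left hk x, hf] with y h1 h2
  rw [h1, h2]

lemma aestronglyMeasurable_comp_sub_left {F : Type*} [NormedAddCommGroup F] {k : E3 → F}
    (hk : AEStronglyMeasurable k volume)
    (x : E3) : AEStronglyMeasurable (fun y => k (x - y)) volume :=
  hk.comp_quasiMeasurePreserving
    (Measure.measurePreserving_sub_left (volume : Measure E3) x).quasiMeasurePreserving

lemma eLpNorm_comp_sub_left {F : Type*} [NormedAddCommGroup F] {k : E3 → F}
    (hk : AEStronglyMeasurable k volume) (r : ℝ≥0∞)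
    (x : E3) : eLpNorm (fun y => k (x - y)) r volume = eLpNorm k r volume :=
  eLpNorm_comp_measurePreserving hk (Measure.measurePreserving_sub_left (volume : Measure E3) x)

lemma aestronglyMeasurable_kconv_integrand {k : E3 → V →L[ℝ] W} {f : E3 → V}
    (hk : AEStronglyMeasurable k volume) (hf : AEStronglyMeasurable f volume) (x : E3) :
    AEStronglyMeasurable (fun y => k (x - y) (f y)) volume :=
  isBoundedBilinearMap_apply.continuous.comp_aestronglyMeasurable
    ((aestronglyMeasurable_comp_sub_left hk x).prodMk hf)

lemma aestronglyMeasurable_kconv {k : E3 → V →L[ℝ] W} {f : E3 → V}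
    (hk : AEStronglyMeasurable k volume) (hf : AEStronglyMeasurable f volume) :
    AEStronglyMeasurable (kconv k f) volume := by
  rw [kconv_congr hk.ae_eq_mk hf.ae_eq_mk]
  have : StronglyMeasurable (fun z : E3 × E3 => hk.mk k (z.1 - z.2) (hf.mk f z.2)) :=
    isBoundedBilinearMap_apply.continuous.comp_stronglyMeasurable
      ((hk.stronglyMeasurable_mk.comp_measurable (measurable_fst.sub measurable_snd)).prodMk
        (hf.stronglyMeasurable_mk.comp_measurable measurable_snd))
  exact this.integral_prod_right.aestronglyMeasurable

lemma enorm_kconv_le (k : E3 → V →L[ℝ] W) (f : E3 → V) (x : E3) :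
    ‖kconv k f x‖ₑ ≤ ∫⁻ y, ‖k (x - y)‖ₑ * ‖f y‖ₑ :=
  (enorm_integral_le_lintegral_enorm _).trans
    (lintegral_mono fun y => (k (x - y)).le_opENorm (f y))

/-- The absolute majorant is estimated, rather than the convolution itself: the same inequality then
yields both the norm bound and convergence of the integral at almost every point. -/
lemma lintegral_kconv_le {k : E3 → V →L[ℝ] W} {f : E3 → V}
    (hk : AEStronglyMeasurable k volume) (hf : AEStronglyMeasurable f volume)
    {r q p : ℝ≥0∞} (h : YoungTriple r q p) :
    (∫⁻ x, (∫⁻ y, ‖k (x - y)‖ₑ * ‖f y‖ₑ) ^ p.toReal) ^ (1 / p.toReal)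
      ≤ eLpNorm k r volume * eLpNorm f q volume := by
  have pos : ∀ {s : ℝ≥0∞}, 1 ≤ s → s ≠ 0 := fun hs => (zero_lt_one.trans_le hs).ne'
  have tr : ∀ {s : ℝ≥0∞}, 1 ≤ s → s ≠ ⊤ → 1 ≤ s.toReal := fun h1 h2 => by
    rw [← ENNReal.toReal_one]; exact ENNReal.toReal_mono h2 h1
  -- `lintegral_young` needs genuine measurability of the kernel; null sets pull back to null sets
  -- under y ↦ x - y, so a strongly measurable representative may be used for every x.
  have hcongr : ∀ x, ∫⁻ y, ‖k (x - y)‖ₑ * ‖f y‖ₑ = ∫⁻ y, ‖hk.mk k (x - y)‖ₑ * ‖f y‖ₑ := by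
    intro x
    refine lintegral_congr_ae ?_
    filter_upwards [ae_sub_left hk.ae_eq_mk x] with y h1
    rw [h1]
  simp_rw [hcongr]
  rw [eLpNorm_congr_ae hk.ae_eq_mk, eLpNorm_eq_lintegral_rpow_enorm_toReal (pos h.one_le_r) h.r_ne_top,
    eLpNorm_eq_lintegral_rpow_enorm_toReal (pos h.one_le_q) h.q_ne_top]
  exact lintegral_young hk.stronglyMeasurable_mk.enorm hf.enorm
    (tr h.one_le_r h.r_ne_top) (tr h.one_le_q h.q_ne_top) (tr h.one_le_p h.p_ne_top) h.inv_add_inv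

/-- **Young's inequality**. -/
lemma eLpNorm_kconv_le {k : E3 → V →L[ℝ] W} {f : E3 → V}
    (hk : AEStronglyMeasurable k volume) (hf : AEStronglyMeasurable f volume)
    {r q p : ℝ≥0∞} (h : YoungTriple r q p) :
    eLpNorm (kconv k f) p volume ≤ eLpNorm k r volume * eLpNorm f q volume := by
  refine le_trans ?_ (lintegral_kconv_le hk hf h)
  rw [eLpNorm_eq_lintegral_rpow_enorm_toReal (zero_lt_one.trans_le h.one_le_p).ne' h.p_ne_top]
  gcongr with x
  exact enorm_kconv_le k f x

/-- The majorant has a finite L^p norm, so it is finite almost everywhere. -/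
lemma ae_integrable_kconv {k : E3 → V →L[ℝ] W} {f : E3 → V} {r q p : ℝ≥0∞}
    (h : YoungTriple r q p) (hk : MemLp k r volume) (hf : MemLp f q volume) :
    ∀ᵐ x : E3, Integrable (fun y => k (x - y) (f y)) := by
  have hp : 0 < p.toReal := ENNReal.toReal_pos (zero_lt_one.trans_le h.one_le_p).ne' h.p_ne_top
  have hlt : (∫⁻ x, (∫⁻ y, ‖k (x - y)‖ₑ * ‖f y‖ₑ) ^ p.toReal) ≠ ⊤ := by
    have := (lintegral_kconv_le hk.1 hf.1 h).trans_lt (ENNReal.mul_lt_top hk.2 hf.2)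
    rw [ENNReal.rpow_lt_top_iff_of_pos (by positivity)] at this
    exact this.ne
  have hm : AEMeasurable (fun x => (∫⁻ y, ‖k (x - y)‖ₑ * ‖f y‖ₑ) ^ p.toReal) volume := by
    refine AEMeasurable.pow_const (AEMeasurable.lintegral_prod_right' (f := fun z : E3 × E3 =>
      ‖k (z.1 - z.2)‖ₑ * ‖f z.2‖ₑ) ?_) _
    have h1 : AEStronglyMeasurable (fun z : E3 × E3 => k (z.1 - z.2)) (volume.prod volume) :=
      hk.1.comp_quasiMeasurePreserving (quasiMeasurePreserving_sub _ _)
    exact h1.enorm.mul hf.1.enorm.comp_snd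
  filter_upwards [ae_lt_top' hm hlt] with x hx
  refine ⟨aestronglyMeasurable_kconv_integrand hk.1 hf.1 x, ?_⟩
  rw [ENNReal.rpow_lt_top_iff_of_pos hp] at hx
  exact (lintegral_mono fun y => (k (x - y)).le_opENorm (f y)).trans_lt hx

/-- The endpoint p = ∞ of Young's inequality. It holds at every x, which is what later allows
pointwise statements without exceptional sets depending on time. -/
lemma lintegral_kconv_le_of_holder {k : E3 → V →L[ℝ] W} {f : E3 → V}
    (hk : AEStronglyMeasurable k volume) (hf : AEStronglyMeasurable f volume)
    (r q : ℝ≥0∞) [r.HolderConjugate q] (x : E3) :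
    ∫⁻ y, ‖k (x - y)‖ₑ * ‖f y‖ₑ ≤ eLpNorm k r volume * eLpNorm f q volume := by
  have := eLpNorm_smul_le_mul_eLpNorm (p := r) (q := q) (r := 1) (μ := (volume : Measure E3))
    (φ := fun y => ‖k (x - y)‖) (f := fun y => ‖f y‖)
    hf.norm (aestronglyMeasurable_comp_sub_left hk x).norm
  rw [eLpNorm_norm, eLpNorm_norm, eLpNorm_comp_sub_left hk, eLpNorm_one_eq_lintegral_enorm] at this
  refine le_trans (le_of_eq ?_) this
  refine lintegral_congr fun y => ?_
  simp [enorm_mul]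

lemma enorm_kconv_le_of_holder {k : E3 → V →L[ℝ] W} {f : E3 → V}
    (hk : AEStronglyMeasurable k volume) (hf : AEStronglyMeasurable f volume)
    (r q : ℝ≥0∞) [r.HolderConjugate q] (x : E3) :
    ‖kconv k f x‖ₑ ≤ eLpNorm k r volume * eLpNorm f q volume :=
  (enorm_kconv_le k f x).trans (lintegral_kconv_le_of_holder hk hf r q x)

lemma integrable_kconv_of_holder {k : E3 → V →L[ℝ] W} {f : E3 → V} {r q : ℝ≥0∞}
    [r.HolderConjugate q] (hk : MemLp k r volume) (hf : MemLp f q volume) (x : E3) :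
    Integrable (fun y => k (x - y) (f y)) :=
  ⟨aestronglyMeasurable_kconv_integrand hk.1 hf.1 x,
    (lintegral_mono fun y => (k (x - y)).le_opENorm (f y)).trans_lt
      ((lintegral_kconv_le_of_holder hk.1 hf.1 r q x).trans_lt (ENNReal.mul_lt_top hk.2 hf.2))⟩

lemma memLp_kconv {k : E3 → V →L[ℝ] W} {f : E3 → V} {r q p : ℝ≥0∞}
    (h : YoungTriple r q p) (hk : MemLp k r volume) (hf : MemLp f q volume) :
    MemLp (kconv k f) p volume :=
  ⟨aestronglyMeasurable_kconv hk.1 hf.1,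
    (eLpNorm_kconv_le hk.1 hf.1 h).trans_lt (ENNReal.mul_lt_top hk.2 hf.2)⟩

/-- Convolution as a bounded bilinear map `L^r × L^q → L^p`. -/
def youngL {r q p : ℝ≥0∞} [Fact (1 ≤ r)] [Fact (1 ≤ q)] [Fact (1 ≤ p)] (h : YoungTriple r q p) :
    Lp (V →L[ℝ] W) r (volume : Measure E3) →L[ℝ] Lp V q (volume : Measure E3) →L[ℝ]
      Lp W p (volume : Measure E3) :=
  LinearMap.mkContinuous₂
    (LinearMap.mk₂ ℝ
      (fun k f => (memLp_kconv h (Lp.memLp k) (Lp.memLp f)).toLp (kconv k f))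
      (by
        intro k k' f
        rw [← MemLp.toLp_add, MemLp.toLp_eq_toLp_iff, kconv_congr (Lp.coeFn_add k k') ae_eq_rfl]
        filter_upwards [ae_integrable_kconv h (Lp.memLp k) (Lp.memLp f),
          ae_integrable_kconv h (Lp.memLp k') (Lp.memLp f)] with x h1 h2
        simpa [kconv] using integral_add h1 h2)
      (by
        intro c k f
        rw [← MemLp.toLp_const_smul, MemLp.toLp_eq_toLp_iff,
          kconv_congr (Lp.coeFn_smul c k) ae_eq_rfl]
        refine Eventually.of_forall fun x => ?_
        simpa [kconv] using integral_smul c _)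
      (by
        intro k f f'
        rw [← MemLp.toLp_add, MemLp.toLp_eq_toLp_iff, kconv_congr ae_eq_rfl (Lp.coeFn_add f f')]
        filter_upwards [ae_integrable_kconv h (Lp.memLp k) (Lp.memLp f),
          ae_integrable_kconv h (Lp.memLp k) (Lp.memLp f')] with x h1 h2
        simpa [kconv] using integral_add h1 h2)
      (by
        intro c k f
        rw [← MemLp.toLp_const_smul, MemLp.toLp_eq_toLp_iff,
          kconv_congr ae_eq_rfl (Lp.coeFn_smul c f)]
        refine Eventually.of_forall fun x => ?_
        simpa [kconv] using integral_smul c _))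
    1 (by
      intro k f
      simp only [LinearMap.mk₂_apply, one_mul]
      rw [Lp.norm_toLp, Lp.norm_def, Lp.norm_def, ← ENNReal.toReal_mul]
      exact ENNReal.toReal_mono (ENNReal.mul_ne_top (Lp.eLpNorm_ne_top _) (Lp.eLpNorm_ne_top _))
        (eLpNorm_kconv_le (Lp.aestronglyMeasurable k) (Lp.aestronglyMeasurable f) h))

lemma youngL_ae_eq {r q p : ℝ≥0∞} [Fact (1 ≤ r)] [Fact (1 ≤ q)] [Fact (1 ≤ p)]
    (h : YoungTriple r q p) (k : Lp (V →L[ℝ] W) r (volume : Measure E3))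
    (f : Lp V q (volume : Measure E3)) : youngL h k f =ᵐ[volume] kconv k f :=
  MemLp.coeFn_toLp (memLp_kconv h (Lp.memLp k) (Lp.memLp f))

lemma norm_youngL_le {r q p : ℝ≥0∞} [Fact (1 ≤ r)] [Fact (1 ≤ q)] [Fact (1 ≤ p)]
    (h : YoungTriple r q p) (k : Lp (V →L[ℝ] W) r (volume : Measure E3)) :
    ‖youngL h k‖ ≤ ‖k‖ := by
  refine (youngL h k).opNorm_le_bound (norm_nonneg k) fun f => ?_
  rw [Lp.norm_def, eLpNorm_congr_ae (youngL_ae_eq h k f), Lp.norm_def, Lp.norm_def,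
    ← ENNReal.toReal_mul]
  exact ENNReal.toReal_mono (ENNReal.mul_ne_top (Lp.eLpNorm_ne_top _) (Lp.eLpNorm_ne_top _))
    (eLpNorm_kconv_le (Lp.aestronglyMeasurable k) (Lp.aestronglyMeasurable f) h)

/-! ### Parabolically scaled families of kernels -/

section KernelFamily

variable {V W : Type*} [NormedAddCommGroup V] [NormedSpace ℝ V]
  [NormedAddCommGroup W] [NormedSpace ℝ W]

/-- A family of continuous kernels `K_τ(x) = τ^{-a} K_1(x/√τ)` with `|K_1(x)| ≲ (1+|x|)^{-N}`. -/
structure KernelFamily (a N : ℝ) (K : ℝ → E3 → V →L[ℝ] W) : Prop where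
  continuous_one : Continuous (K 1)
  scaling : ∀ τ : ℝ, 0 < τ → ∀ x, K τ x = τ ^ (-a) • K 1 ((√τ)⁻¹ • x)
  decay : ∃ C, ∀ x, ‖K 1 x‖ ≤ C * (1 + ‖x‖) ^ (-N)
  exponent_nonneg : 0 ≤ N

/-- A function of size `(1+|x|)^{-N}` on `ℝ³` is in `L^r`. -/
def DecayExponent (N : ℝ) (r : ℝ≥0∞) : Prop := 1 ≤ r ∧ (r = ⊤ ∨ 3 < N * r.toReal)

lemma memLp_one_add_norm {N : ℝ} (hN : 0 ≤ N) {r : ℝ≥0∞} (h : DecayExponent N r) (M : ℝ) :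
    MemLp (fun x : E3 => M * (1 + ‖x‖) ^ (-N)) r volume := by
  refine MemLp.const_mul ?_ M
  have hm : AEStronglyMeasurable (fun x : E3 => (1 + ‖x‖) ^ (-N)) volume :=
    Measurable.aestronglyMeasurable (by fun_prop)
  rcases eq_or_ne r ⊤ with rfl | htop
  · refine memLp_top_of_bound hm 1 (Eventually.of_forall fun x => ?_)
    have h1 : (1 : ℝ) ≤ 1 + ‖x‖ := by linarith [norm_nonneg x]
    rw [Real.norm_of_nonneg (by positivity)]
    exact Real.rpow_le_one_of_one_le_of_nonpos h1 (by linarith)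
  · have h3 : 3 < N * r.toReal := h.2.resolve_left htop
    have h0 : r ≠ 0 := (zero_lt_one.trans_le h.1).ne'
    rw [← integrable_norm_rpow_iff hm h0 htop]
    have := integrable_one_add_norm (E := E3) (μ := volume) (r := N * r.toReal) (by simpa using h3)
    refine this.congr (Eventually.of_forall fun x => ?_)
    have h1 : (0 : ℝ) ≤ 1 + ‖x‖ := by positivity
    simp only
    rw [Real.norm_of_nonneg (by positivity), ← Real.rpow_mul h1]
    ring_nf

/-- For r = ⊤ the convention `r.toReal = 0` gives exponent `3 / 0 = 0`, the correct value, so no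
case distinction is needed. -/
lemma eLpNorm_comp_inv_smul {F : Type*} [NormedAddCommGroup F] {f : E3 → F} (hf : Continuous f)
    {R : ℝ} (hR : 0 < R) (r : ℝ≥0∞) :
    eLpNorm (fun x => f (R⁻¹ • x)) r volume
      = ENNReal.ofReal (R ^ (3 / r.toReal)) * eLpNorm f r volume := by
  have h1 : eLpNorm (fun x => f (R⁻¹ • x)) r volume
      = eLpNorm f r (Measure.map (R⁻¹ • · : E3 → E3) volume) :=
    (eLpNorm_map_measure hf.aestronglyMeasurable (by fun_prop)).symm
  rw [h1, Measure.map_addHaar_smul volume (inv_ne_zero hR.ne'),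
    eLpNorm_smul_measure_of_ne_zero (by simp; positivity), smul_eq_mul]
  congr 1
  rw [ENNReal.ofReal_rpow_of_nonneg (by positivity) (by positivity)]
  congr 1
  rw [abs_of_pos (by simp; positivity)]
  simp only [finrank_euclideanSpace, Fintype.card_fin, inv_pow, inv_inv, one_div, ENNReal.toReal_inv]
  rw [← Real.rpow_natCast, ← Real.rpow_mul hR.le]
  norm_num [div_eq_mul_inv]

namespace KernelFamily

variable {a N : ℝ} {K : ℝ → E3 → V →L[ℝ] W}

lemma continuous (hK : KernelFamily a N K) {τ : ℝ} (hτ : 0 < τ) : Continuous (K τ) := by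
  have : K τ = fun x => τ ^ (-a) • K 1 ((√τ)⁻¹ • x) := funext (hK.scaling τ hτ)
  rw [this]
  have := hK.continuous_one
  fun_prop

lemma continuousOn_time (hK : KernelFamily a N K) (x : E3) :
    ContinuousOn (fun τ => K τ x) (Ioi 0) := by
  have : ContinuousOn (fun τ : ℝ => τ ^ (-a) • K 1 ((√τ)⁻¹ • x)) (Ioi 0) := by
    have h1 : ContinuousOn (fun τ : ℝ => (√τ)⁻¹ • x) (Ioi 0) :=
      (ContinuousOn.inv₀ (by fun_prop) fun τ hτ => (Real.sqrt_pos.2 hτ).ne').smul continuousOn_const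
    exact (continuousOn_id.rpow_const fun τ hτ => Or.inl (ne_of_gt hτ)).smul
      (hK.continuous_one.comp_continuousOn h1)
  exact this.congr fun τ hτ => hK.scaling τ hτ x

/-- A majorant uniform over a compact range of times away from 0, used for dominated convergence in
τ. -/
lemma exists_bound (hK : KernelFamily a N K) {b c : ℝ} (hb : 0 < b) :
    ∃ M, ∀ τ ∈ Icc b c, ∀ x, ‖K τ x‖ ≤ M * (1 + ‖x‖) ^ (-N) := by
  obtain ⟨C, hC⟩ := hK.decay
  have hC0 : 0 ≤ C := by
    have := (norm_nonneg _).trans (hC 0)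
    simpa using this
  rcases lt_or_ge c b with hbc | hbc
  · exact ⟨0, fun τ hτ => absurd (hτ.1.trans hτ.2) (not_le.2 hbc)⟩
  -- With this d one has 1 + |x|/√τ ≥ d (1 + |x|) for all τ ≤ c, so rescaling costs only the
  -- constant d^{-N}.
  set d := min 1 (√c)⁻¹ with hd
  have hc : 0 < √c := Real.sqrt_pos.2 (hb.trans_le hbc)
  have hd0 : 0 < d := lt_min one_pos (inv_pos.2 hc)
  obtain ⟨D, hD⟩ : ∃ D, ∀ τ ∈ Icc b c, τ ^ (-a) ≤ D := by
    have hcont : ContinuousOn (fun τ : ℝ => τ ^ (-a)) (Icc b c) :=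
      continuousOn_id.rpow_const fun τ hτ => Or.inl (hb.trans_le hτ.1).ne'
    obtain ⟨D, hD⟩ := isCompact_Icc.bddAbove_image hcont
    exact ⟨D, fun τ hτ => hD ⟨τ, hτ, rfl⟩⟩
  refine ⟨D * (C * d ^ (-N)), fun τ hτ x => ?_⟩
  have hτ0 : 0 < τ := hb.trans_le hτ.1
  have hpos : 0 ≤ τ ^ (-a) := by positivity
  rw [hK.scaling τ hτ0, norm_smul, Real.norm_of_nonneg hpos]
  have h1 : ‖K 1 ((√τ)⁻¹ • x)‖ ≤ C * (d ^ (-N) * (1 + ‖x‖) ^ (-N)) := by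
    refine (hC _).trans (mul_le_mul_of_nonneg_left ?_ hC0)
    rw [← Real.mul_rpow hd0.le (by positivity)]
    refine Real.rpow_le_rpow_of_nonpos (by positivity) ?_ (by linarith [hK.exponent_nonneg])
    rw [norm_smul, Real.norm_of_nonneg (by positivity), mul_add, mul_one]
    have h2 : (√c)⁻¹ ≤ (√τ)⁻¹ :=
      inv_anti₀ (Real.sqrt_pos.2 hτ0) (Real.sqrt_le_sqrt hτ.2)
    exact add_le_add (min_le_left _ _)
      (mul_le_mul_of_nonneg_right ((min_le_right _ _).trans h2) (norm_nonneg _))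
  calc τ ^ (-a) * ‖K 1 ((√τ)⁻¹ • x)‖ ≤ D * (C * (d ^ (-N) * (1 + ‖x‖) ^ (-N))) :=
        mul_le_mul (hD τ hτ) h1 (norm_nonneg _) (hpos.trans (hD τ hτ))
    _ = _ := by ring

lemma memLp (hK : KernelFamily a N K) {r : ℝ≥0∞} (hr : DecayExponent N r) {τ : ℝ} (hτ : 0 < τ) :
    MemLp (K τ) r volume := by
  obtain ⟨M, hM⟩ := hK.exists_bound (c := τ) hτ
  exact (memLp_one_add_norm hK.exponent_nonneg hr M).mono
    (hK.continuous hτ).aestronglyMeasurable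
    (Eventually.of_forall fun x => (hM τ ⟨le_rfl, le_rfl⟩ x).trans (le_abs_self _))

lemma eLpNorm_eq (hK : KernelFamily a N K) (r : ℝ≥0∞) {τ : ℝ} (hτ : 0 < τ) :
    eLpNorm (K τ) r volume
      = ENNReal.ofReal (τ ^ (-a + 3 / (2 * r.toReal))) * eLpNorm (K 1) r volume := by
  have h0 : K τ = τ ^ (-a) • fun x => K 1 ((√τ)⁻¹ • x) := funext (hK.scaling τ hτ)
  have hpos : 0 ≤ τ ^ (-a) := by positivity
  rw [h0, eLpNorm_const_smul (τ ^ (-a)) (fun x : E3 => K 1 ((√τ)⁻¹ • x)) r volume,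
    eLpNorm_comp_inv_smul hK.continuous_one (Real.sqrt_pos.2 hτ),
    ← mul_assoc, Real.enorm_eq_ofReal hpos, ← ENNReal.ofReal_mul hpos]
  congr 2
  rw [Real.sqrt_eq_rpow, ← Real.rpow_mul hτ.le, ← Real.rpow_add hτ]
  congr 2
  rcases eq_or_ne r.toReal 0 with h | h
  · simp [h]
  · field_simp

/-- Dominated convergence, the majorant being the uniform decay on the window [τ₀/2, 2τ₀]. Through
Young's inequality it gives continuity in operator norm of the convolution operators. -/
lemma tendsto_eLpNorm_sub (hK : KernelFamily a N K) {r : ℝ≥0∞} (hr : DecayExponent N r)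
    (hr' : r ≠ ⊤) {τ₀ : ℝ} (hτ₀ : 0 < τ₀) :
    Tendsto (fun τ => eLpNorm (K τ - K τ₀) r volume) (𝓝 τ₀) (𝓝 0) := by
  have h0 : r ≠ 0 := (zero_lt_one.trans_le hr.1).ne'
  have hpos : 0 < r.toReal := ENNReal.toReal_pos h0 hr'
  obtain ⟨M, hM⟩ := hK.exists_bound (b := τ₀ / 2) (c := 2 * τ₀) (by positivity)
  have hnhds : Icc (τ₀ / 2) (2 * τ₀) ∈ 𝓝 τ₀ := Icc_mem_nhds (by linarith) (by linarith)
  have hlim : Tendsto (fun τ => ∫⁻ x, ‖K τ x - K τ₀ x‖ₑ ^ r.toReal) (𝓝 τ₀)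
      (𝓝 (∫⁻ _ : E3, 0)) := by
    refine tendsto_lintegral_filter_of_dominated_convergence
      (fun x => ‖2 * M * (1 + ‖x‖) ^ (-N)‖ₑ ^ r.toReal) ?_ ?_ ?_ ?_
    · filter_upwards [lt_mem_nhds hτ₀] with τ hτ
      have h1 := hK.continuous hτ
      have h2 := hK.continuous hτ₀
      have h3 : Continuous (fun x => K τ x - K τ₀ x) := h1.sub h2
      exact (h3.enorm.measurable).pow_const _
    · filter_upwards [hnhds] with τ hτ
      refine Eventually.of_forall fun x => ENNReal.rpow_le_rpow ?_ hpos.le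
      rw [enorm_le_iff_norm_le]
      refine (norm_sub_le _ _).trans ((add_le_add (hM τ hτ x)
        (hM τ₀ (mem_of_mem_nhds hnhds) x)).trans (le_trans (le_of_eq ?_) (le_abs_self _)))
      ring
    · have := (memLp_one_add_norm hK.exponent_nonneg hr (2 * M)).2
      rw [eLpNorm_eq_lintegral_rpow_enorm_toReal h0 hr',
        ENNReal.rpow_lt_top_iff_of_pos (by positivity)] at this
      exact this.ne
    · refine Eventually.of_forall fun x => ?_
      have h1 : Tendsto (fun τ => K τ x - K τ₀ x) (𝓝 τ₀) (𝓝 0) := by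
        have := ((hK.continuousOn_time x).continuousAt (Ioi_mem_nhds hτ₀)).tendsto.sub_const (K τ₀ x)
        simpa using this
      have h2 := (tendsto_zero_iff_enorm_tendsto_zero.1 h1).ennrpow_const r.toReal
      rwa [ENNReal.zero_rpow_of_pos hpos] at h2
  have h3 := hlim.ennrpow_const (1 / r.toReal)
  simp only [lintegral_zero] at h3
  rw [ENNReal.zero_rpow_of_pos (by positivity)] at h3
  refine h3.congr fun τ => ?_
  rw [eLpNorm_eq_lintegral_rpow_enorm_toReal h0 hr']
  rfl

end KernelFamily

open Classical in
/-- The kernel at time `τ` as an element of `L^r`. -/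
def kernelLp (K : ℝ → E3 → V →L[ℝ] W) (r : ℝ≥0∞) (τ : ℝ) :
    Lp (V →L[ℝ] W) r (volume : Measure E3) :=
  if h : MemLp (K τ) r volume then h.toLp else 0

namespace KernelFamily

variable {a N : ℝ} {K : ℝ → E3 → V →L[ℝ] W} {r q p : ℝ≥0∞}

lemma kernelLp_eq (hK : KernelFamily a N K) (hr : DecayExponent N r) {τ : ℝ} (hτ : 0 < τ) :
    kernelLp K r τ = (hK.memLp hr hτ).toLp := dif_pos _

lemma norm_kernelLp (hK : KernelFamily a N K) (hr : DecayExponent N r) {τ : ℝ} (hτ : 0 < τ) :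
    ‖kernelLp K r τ‖ = τ ^ (-a + 3 / (2 * r.toReal)) * (eLpNorm (K 1) r volume).toReal := by
  rw [hK.kernelLp_eq hr hτ, Lp.norm_toLp, hK.eLpNorm_eq r hτ, ENNReal.toReal_mul,
    ENNReal.toReal_ofReal (by positivity)]

lemma continuousOn_kernelLp (hK : KernelFamily a N K) (hr : DecayExponent N r) (hr' : r ≠ ⊤)
    [Fact (1 ≤ r)] : ContinuousOn (kernelLp K r) (Ioi 0) := by
  intro τ₀ hτ₀
  refine ContinuousAt.continuousWithinAt ?_
  have : Tendsto (kernelLp K r) (𝓝 τ₀) (𝓝 ((hK.memLp hr hτ₀).toLp)) := by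
    refine (Lp.tendsto_Lp_iff_tendsto_eLpNorm _ (K τ₀) (hK.memLp hr hτ₀)).2 ?_
    refine (hK.tendsto_eLpNorm_sub hr hr' hτ₀).congr' ?_
    filter_upwards [lt_mem_nhds hτ₀] with τ hτ
    rw [hK.kernelLp_eq hr hτ]
    exact eLpNorm_congr_ae ((MemLp.coeFn_toLp _).symm.sub ae_eq_rfl)
  rw [← hK.kernelLp_eq hr hτ₀] at this
  exact this

end KernelFamily

variable {r q p : ℝ≥0∞} [Fact (1 ≤ r)] [Fact (1 ≤ q)] [Fact (1 ≤ p)]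

/-- Convolution with `K_τ` as an operator `L^q → L^p`. -/
def convOp (K : ℝ → E3 → V →L[ℝ] W) (h : YoungTriple r q p) (τ : ℝ) :
    Lp V q (volume : Measure E3) →L[ℝ] Lp W p (volume : Measure E3) :=
  youngL h (kernelLp K r τ)

namespace KernelFamily

variable {a N : ℝ} {K : ℝ → E3 → V →L[ℝ] W}

lemma convOp_ae_eq (hK : KernelFamily a N K) (hr : DecayExponent N r) (h : YoungTriple r q p)
    {τ : ℝ} (hτ : 0 < τ) (f : Lp V q (volume : Measure E3)) :
    convOp K h τ f =ᵐ[volume] kconv (K τ) f := by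
  refine (youngL_ae_eq h _ f).trans ?_
  rw [hK.kernelLp_eq hr hτ, kconv_congr (MemLp.coeFn_toLp (hK.memLp hr hτ)) ae_eq_rfl]

lemma norm_convOp_le (hK : KernelFamily a N K) (hr : DecayExponent N r) (h : YoungTriple r q p)
    {τ : ℝ} (hτ : 0 < τ) :
    ‖convOp K h τ‖ ≤ (eLpNorm (K 1) r volume).toReal * τ ^ (-a + 3 / (2 * r.toReal)) := by
  refine (norm_youngL_le h _).trans ?_
  rw [hK.norm_kernelLp hr hτ, mul_comm]

lemma continuousOn_convOp (hK : KernelFamily a N K) (hr : DecayExponent N r)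
    (h : YoungTriple r q p) : ContinuousOn (convOp K h) (Ioi 0) :=
  (youngL h).continuous.comp_continuousOn (hK.continuousOn_kernelLp hr h.r_ne_top)

end KernelFamily

end KernelFamily

/-! ### Continuity in time of pointwise convolutions -/

section

variable {V W : Type*} [NormedAddCommGroup V] [NormedSpace ℝ V]
  [NormedAddCommGroup W] [NormedSpace ℝ W] {r q : ℝ≥0∞} [Fact (1 ≤ q)]

/-- The pointwise convolution is continuous in time. -/
lemma KernelFamily.continuousOn_kconv {a N : ℝ} {K : ℝ → E3 → V →L[ℝ] W}
    (hK : KernelFamily a N K) (hr : DecayExponent N r) [r.HolderConjugate q]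
    {S : Set ℝ} {g : ℝ → ℝ} (hg : ContinuousOn g S) (hg0 : ∀ s ∈ S, 0 < g s)
    {F : ℝ → Lp V q (volume : Measure E3)} (hF : ContinuousOn F S) (x : E3) :
    ContinuousOn (fun s => kconv (K (g s)) (F s) x) S := by
  intro s₀ hs₀
  have hgs : Tendsto g (𝓝[S] s₀) (𝓝 (g s₀)) := hg s₀ hs₀
  have hpos := hg0 s₀ hs₀
  -- The variation is split in two: here the kernel moves and the field is frozen at s₀, by
  -- dominated convergence; below, the increment F s - F s₀ meets the moving kernel and is
  -- controlled by Hölder, uniformly in x.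
  have h1 : Tendsto (fun s => kconv (K (g s)) (F s₀) x) (𝓝[S] s₀)
      (𝓝 (kconv (K (g s₀)) (F s₀) x)) := by
    have : ContinuousAt (fun τ => kconv (K τ) (F s₀) x) (g s₀) := by
      obtain ⟨M, hM⟩ := hK.exists_bound (b := g s₀ / 2) (c := 2 * g s₀) (by positivity)
      have hnhds : Icc (g s₀ / 2) (2 * g s₀) ∈ 𝓝 (g s₀) :=
        Icc_mem_nhds (by linarith) (by linarith)
      refine continuousAt_of_dominated
        (bound := fun y => ‖M * (1 + ‖x - y‖) ^ (-N)‖ * ‖F s₀ y‖) ?_ ?_ ?_ ?_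
      · filter_upwards [lt_mem_nhds hpos] with τ hτ
        exact aestronglyMeasurable_kconv_integrand (hK.continuous hτ).aestronglyMeasurable
          (Lp.aestronglyMeasurable _) x
      · filter_upwards [hnhds] with τ hτ
        refine Eventually.of_forall fun y => ((K τ (x - y)).le_opNorm _).trans ?_
        exact mul_le_mul_of_nonneg_right ((hM τ hτ _).trans (le_abs_self _)) (norm_nonneg _)
      · have hmaj := (memLp_one_add_norm hK.exponent_nonneg hr M).norm
        have h2 := hmaj.comp_measurePreserving (Measure.measurePreserving_sub_left (volume : Measure E3) x)
        have := (Lp.memLp (F s₀)).norm.mul h2 (r := 1)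
        exact memLp_one_iff_integrable.1 this
      · refine Eventually.of_forall fun y => ?_
        have := (hK.continuousOn_time (x - y)).continuousAt (Ioi_mem_nhds hpos)
        exact this.clm_apply continuousAt_const
    exact this.tendsto.comp hgs
  obtain ⟨G, hG⟩ : ∃ G : ℝ → Lp V q (volume : Measure E3), G = fun s => F s - F s₀ := ⟨_, rfl⟩
  have h2 : Tendsto (fun s => kconv (K (g s)) (G s) x) (𝓝[S] s₀) (𝓝 0) := by
    have hb : Tendsto (fun s => eLpNorm (K (g s)) r volume * ‖G s‖ₑ) (𝓝[S] s₀) (𝓝 0) := by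
      have hF0 : Tendsto (fun s => ‖G s‖ₑ) (𝓝[S] s₀) (𝓝 0) := by
        have := ((hF s₀ hs₀).sub_const (F s₀)).enorm
        simpa [hG] using this
      have hA : Tendsto (fun s => ENNReal.ofReal (g s ^ (-a + 3 / (2 * r.toReal))) *
          eLpNorm (K 1) r volume) (𝓝[S] s₀) (𝓝 (ENNReal.ofReal (g s₀ ^ (-a + 3 / (2 * r.toReal))) *
          eLpNorm (K 1) r volume)) := by
        refine ENNReal.Tendsto.mul_const (ENNReal.tendsto_ofReal
          (hgs.rpow_const (Or.inl hpos.ne'))) (Or.inr (hK.memLp hr one_pos).2.ne)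
      have := ENNReal.Tendsto.mul hA (Or.inr ENNReal.zero_ne_top) hF0
        (Or.inr (ENNReal.mul_ne_top ENNReal.ofReal_ne_top (hK.memLp hr one_pos).2.ne))
      rw [mul_zero] at this
      refine this.congr' ?_
      filter_upwards [self_mem_nhdsWithin] with s hs
      rw [hK.eLpNorm_eq r (hg0 s hs)]
    rw [tendsto_zero_iff_enorm_tendsto_zero]
    refine tendsto_of_tendsto_of_tendsto_of_le_of_le' tendsto_const_nhds hb
      (Eventually.of_forall fun _ => zero_le) ?_
    filter_upwards [self_mem_nhdsWithin] with s hs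
    have := enorm_kconv_le_of_holder (hK.continuous (hg0 s hs)).aestronglyMeasurable
      (Lp.aestronglyMeasurable (G s)) r q x
    rwa [← Lp.enorm_def] at this
  have h3 := h1.add h2
  rw [add_zero] at h3
  refine h3.congr' ?_
  filter_upwards [self_mem_nhdsWithin] with s hs
  have e : F s =ᵐ[volume] fun y => F s₀ y + G s y := by
    rw [hG]
    filter_upwards [Lp.coeFn_sub (F s) (F s₀)] with y hy
    rw [hy, Pi.sub_apply, add_sub_cancel]
  rw [kconv_congr (k := K (g s)) ae_eq_rfl e]
  have hi := hK.memLp hr (hg0 s hs)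
  have := integral_add (integrable_kconv_of_holder hi (Lp.memLp (F s₀)) x)
    (integrable_kconv_of_holder hi (Lp.memLp (G s)) x)
  simpa [kconv] using this.symm

end

/-! ### Duhamel integrals -/

/-- The constant `∫₀¹ (1-σ)^{-α} σ^{-β} dσ`. -/
def betaConst (α β : ℝ) : ℝ := ∫ σ in (0 : ℝ)..1, (1 - σ) ^ (-α) * σ ^ (-β)

lemma betaConst_nonneg (α β : ℝ) : 0 ≤ betaConst α β := by
  refine intervalIntegral.integral_nonneg zero_le_one fun σ hσ => ?_
  have h1 : 0 ≤ 1 - σ := by linarith [hσ.2]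
  have h2 := hσ.1
  positivity

lemma intervalIntegrable_beta {α β : ℝ} (hα : α < 1) (hβ : β < 1) :
    IntervalIntegrable (fun σ : ℝ => (1 - σ) ^ (-α) * σ ^ (-β)) volume 0 1 := by
  -- On (0, 1/2) only the singularity at 0 matters. The other half is the reflection σ ↦ 1 - σ of
  -- this one with the exponents exchanged.
  have left : ∀ {γ δ : ℝ}, γ < 1 →
      IntervalIntegrable (fun σ : ℝ => (1 - σ) ^ (-δ) * σ ^ (-γ)) volume 0 (1 / 2) := by
    intro γ δ hγ
    have h1 : IntervalIntegrable (fun σ : ℝ => σ ^ (-γ)) volume 0 (1 / 2) :=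
      intervalIntegral.intervalIntegrable_rpow' (by linarith)
    refine h1.continuousOn_mul ?_
    refine ContinuousOn.rpow_const (by fun_prop) fun σ hσ => Or.inl ?_
    rw [uIcc_of_le (by norm_num)] at hσ
    linarith [hσ.2]
  refine (left hβ).trans (b := 1 / 2) ?_
  have := (left (γ := α) (δ := β) hα).comp_sub_left 1
  norm_num at this
  refine (this.symm).congr ?_
  intro x _
  simp only
  ring_nf

lemma beta_subst {t : ℝ} (ht : 0 < t) (α β : ℝ) {σ : ℝ} (hσ : σ ∈ Icc (0 : ℝ) 1) :
    t * ((t - t * σ) ^ (-α) * (t * σ) ^ (-β)) =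
      t ^ (1 - α - β) * ((1 - σ) ^ (-α) * σ ^ (-β)) := by
  have h1 : 0 ≤ 1 - σ := by linarith [hσ.2]
  rw [show t - t * σ = t * (1 - σ) by ring, Real.mul_rpow ht.le h1, Real.mul_rpow ht.le hσ.1,
    show (1 - α - β) = 1 + -α + -β by ring, Real.rpow_add ht, Real.rpow_add ht, Real.rpow_one]
  ring

lemma intervalIntegrable_beta_scaled {α β : ℝ} (hα : α < 1) (hβ : β < 1) {t : ℝ} (ht : 0 < t) :
    IntervalIntegrable (fun s : ℝ => (t - s) ^ (-α) * s ^ (-β)) volume 0 t := by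
  have h := (intervalIntegrable_beta hα hβ).const_mul (t ^ (1 - α - β))
  have h2 : IntervalIntegrable (fun σ => t * ((t - t * σ) ^ (-α) * (t * σ) ^ (-β)))
      volume 0 1 := by
    refine h.congr fun σ hσ => ?_
    rw [uIoc_of_le zero_le_one] at hσ
    exact (beta_subst ht α β ⟨hσ.1.le, hσ.2⟩).symm
  have h3 := h2.const_mul t⁻¹
  have h4 : IntervalIntegrable (fun σ => (fun s : ℝ => (t - s) ^ (-α) * s ^ (-β)) (t * σ))
      volume 0 1 := by
    refine h3.congr fun σ _ => ?_
    simp only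
    field_simp
  rw [← IntervalIntegrable.comp_mul_left_iff ht.ne']
  simpa [ht.ne'] using h4

lemma integral_beta_scaled {α β : ℝ} {t : ℝ} (ht : 0 < t) :
    ∫ s in (0 : ℝ)..t, (t - s) ^ (-α) * s ^ (-β) = t ^ (1 - α - β) * betaConst α β := by
  have h := intervalIntegral.mul_integral_comp_mul_left (a := 0) (b := 1)
    (f := fun s : ℝ => (t - s) ^ (-α) * s ^ (-β)) t
  rw [mul_zero, mul_one] at h
  rw [← h, betaConst, ← intervalIntegral.integral_const_mul, ← intervalIntegral.integral_const_mul]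
  refine intervalIntegral.integral_congr fun σ hσ => ?_
  rw [uIcc_of_le zero_le_one] at hσ
  exact beta_subst ht α β hσ

section Abstract

variable {X Y : Type*} [NormedAddCommGroup X] [NormedSpace ℝ X] [NormedAddCommGroup Y]
  [NormedSpace ℝ Y]

/-- The integral `∫₀ᵗ S(t-s) F(s) ds`. -/
def duhamel (S : ℝ → X →L[ℝ] Y) (F : ℝ → X) (t : ℝ) : Y := ∫ s in (0 : ℝ)..t, S (t - s) (F s)

/-- A strongly continuous family of operators on `(0,∞)` of size `C τ^{-α}`, `α < 1`. -/
structure SingularFamily (C α : ℝ) (S : ℝ → X →L[ℝ] Y) : Prop where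
  continuousOn : ContinuousOn S (Ioi 0)
  norm_le : ∀ τ : ℝ, 0 < τ → ‖S τ‖ ≤ C * τ ^ (-α)
  lt_one : α < 1

lemma SingularFamily.const_nonneg {C α : ℝ} {S : ℝ → X →L[ℝ] Y} (hS : SingularFamily C α S) :
    0 ≤ C := by
  have := (norm_nonneg _).trans (hS.norm_le 1 one_pos)
  simpa using this

variable {C α β M t : ℝ} {S : ℝ → X →L[ℝ] Y} {F : ℝ → X}

lemma SingularFamily.norm_apply_le (hS : SingularFamily C α S) {s : ℝ} (hs : s ∈ Ioo 0 t)
    (hF : ‖F s‖ ≤ M * s ^ (-β)) :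
    ‖S (t - s) (F s)‖ ≤ C * M * ((t - s) ^ (-α) * s ^ (-β)) := by
  have h0 : 0 < t - s := sub_pos.2 hs.2
  have hC := hS.const_nonneg
  calc ‖S (t - s) (F s)‖ ≤ ‖S (t - s)‖ * ‖F s‖ := (S (t - s)).le_opNorm _
    _ ≤ (C * (t - s) ^ (-α)) * (M * s ^ (-β)) :=
      mul_le_mul (hS.norm_le _ h0) hF (norm_nonneg _) (by positivity)
    _ = _ := by ring

lemma SingularFamily.continuousOn_integrand (hS : SingularFamily C α S)
    (hF : ContinuousOn F (Ioo 0 t)) : ContinuousOn (fun s => S (t - s) (F s)) (Ioo 0 t) := by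
  have h1 : ContinuousOn (fun s => S (t - s)) (Ioo 0 t) :=
    hS.continuousOn.comp (by fun_prop) fun s hs => sub_pos.2 hs.2
  exact h1.clm_apply hF

lemma SingularFamily.intervalIntegrable (hS : SingularFamily C α S) (hβ : β < 1) (ht : 0 < t)
    (hF : ContinuousOn F (Ioo 0 t)) (hM : ∀ s ∈ Ioo 0 t, ‖F s‖ ≤ M * s ^ (-β)) :
    IntervalIntegrable (fun s => S (t - s) (F s)) volume 0 t := by
  have h2 := (intervalIntegrable_beta_scaled hS.lt_one hβ ht).const_mul (C * M)
  rw [intervalIntegrable_iff_integrableOn_Ioo_of_le ht.le] at h2 ⊢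
  refine h2.mono' ((hS.continuousOn_integrand hF).aestronglyMeasurable measurableSet_Ioo) ?_
  exact (ae_restrict_mem measurableSet_Ioo).mono fun s hs => hS.norm_apply_le hs (hM s hs)

/-- The substitution s = tσ extracts t^{1-α-β}. In the critical cases below this power is the weight
of the target space, or 1 when α + β = 1. Only the majorant has to be integrable. -/
lemma SingularFamily.norm_duhamel_le (hS : SingularFamily C α S) (hβ : β < 1) (ht : 0 < t)
    (hM : ∀ s ∈ Ioo 0 t, ‖F s‖ ≤ M * s ^ (-β)) :
    ‖duhamel S F t‖ ≤ C * M * (t ^ (1 - α - β) * betaConst α β) := by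
  rw [← integral_beta_scaled ht, ← intervalIntegral.integral_const_mul]
  refine intervalIntegral.norm_integral_le_of_norm_le ht.le ?_
    ((intervalIntegrable_beta_scaled hS.lt_one hβ ht).const_mul (C * M))
  have : ∀ᵐ s : ℝ, s ≠ t := by simp [ae_iff]
  filter_upwards [this] with s h1 h2
  have hs : s ∈ Ioo 0 t := ⟨h2.1, lt_of_le_of_ne h2.2 h1⟩
  exact hS.norm_apply_le hs (hM s hs)

lemma duhamel_eq_integral_unit (S : ℝ → X →L[ℝ] Y) (F : ℝ → X) (t : ℝ) :
    duhamel S F t = ∫ σ in (0 : ℝ)..1, t • S (t - t * σ) (F (t * σ)) := by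
  have h := intervalIntegral.smul_integral_comp_mul_left (a := 0) (b := 1)
    (f := fun s : ℝ => S (t - s) (F s)) t
  rw [mul_zero, mul_one] at h
  rw [duhamel, ← h, ← intervalIntegral.integral_smul]

/-- After s = tσ the interval of integration and the singular endpoints no longer depend on t, and
dominated convergence in σ applies with a Beta density as majorant. -/
lemma SingularFamily.continuousOn_duhamel (hS : SingularFamily C α S) (hβ : β < 1) {T : ℝ}
    (hF : ContinuousOn F (Ioc 0 T)) (hM : ∀ s ∈ Ioc 0 T, ‖F s‖ ≤ M * s ^ (-β)) :
    ContinuousOn (duhamel S F) (Ioc 0 T) := by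
  intro t₀ ht₀
  have hfun : duhamel S F = fun t => ∫ σ in (0 : ℝ)..1, t • S (t - t * σ) (F (t * σ)) :=
    funext (duhamel_eq_integral_unit S F)
  rw [hfun]
  have h01 : ∀ᵐ σ : ℝ, σ ∈ uIoc (0 : ℝ) 1 → σ ∈ Ioo (0 : ℝ) 1 := by
    have : ∀ᵐ s : ℝ, s ≠ 1 := by simp [ae_iff]
    filter_upwards [this] with s h1 h2
    rw [uIoc_of_le zero_le_one] at h2
    exact ⟨h2.1, lt_of_le_of_ne h2.2 h1⟩
  have hmaps : ∀ t ∈ Ioc 0 T, ∀ σ ∈ Ioo (0 : ℝ) 1, t * σ ∈ Ioc 0 T ∧ t * σ ∈ Ioo 0 t := by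
    intro t ht σ hσ
    have h1 : 0 < t * σ := mul_pos ht.1 hσ.1
    have h2 : t * σ < t := by nlinarith [ht.1, hσ.2]
    exact ⟨⟨h1, h2.le.trans ht.2⟩, h1, h2⟩
  refine intervalIntegral.continuousWithinAt_of_dominated_interval
    (bound := fun σ => C * M * ((t₀ ^ (1 - α - β) + 1) * ((1 - σ) ^ (-α) * σ ^ (-β)))) ?_ ?_ ?_ ?_
  · filter_upwards [self_mem_nhdsWithin] with t ht
    have hcont : ContinuousOn (fun σ => t • S (t - t * σ) (F (t * σ))) (Ioo 0 1) := by
      have h1 := hS.continuousOn_integrand (t := t) (hF.mono fun s hs => ⟨hs.1, hs.2.le.trans ht.2⟩)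
      have h2 : ContinuousOn (fun σ : ℝ => t * σ) (Ioo 0 1) := by fun_prop
      exact (h1.comp h2 fun σ hσ => (hmaps t ht σ hσ).2).const_smul t
    rw [uIoc_of_le zero_le_one, ← restrict_Ioo_eq_restrict_Ioc]
    exact hcont.aestronglyMeasurable measurableSet_Ioo
  · have hev : ∀ᶠ t : ℝ in 𝓝[Ioc 0 T] t₀, t ^ (1 - α - β) < t₀ ^ (1 - α - β) + 1 := by
      have : ContinuousAt (fun t : ℝ => t ^ (1 - α - β)) t₀ :=
        Real.continuousAt_rpow_const _ _ (Or.inl ht₀.1.ne')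
      exact (this.eventually_lt_const (by simp)).filter_mono nhdsWithin_le_nhds
    filter_upwards [self_mem_nhdsWithin, hev] with t ht hlt
    filter_upwards [h01] with σ hσ hσ'
    have hσ := hσ hσ'
    obtain ⟨h1, h2⟩ := hmaps t ht σ hσ
    rw [norm_smul, Real.norm_of_nonneg ht.1.le]
    have hCM : 0 ≤ C * M := by
      have h3 := (norm_nonneg _).trans (hS.norm_apply_le h2 (hM _ h1))
      have h4 : 0 < (t - t * σ) ^ (-α) * (t * σ) ^ (-β) :=
        mul_pos (Real.rpow_pos_of_pos (sub_pos.2 h2.2) _) (Real.rpow_pos_of_pos h2.1 _)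
      exact nonneg_of_mul_nonneg_left h3 h4
    calc t * ‖S (t - t * σ) (F (t * σ))‖
        ≤ t * (C * M * ((t - t * σ) ^ (-α) * (t * σ) ^ (-β))) :=
          mul_le_mul_of_nonneg_left (hS.norm_apply_le h2 (hM _ h1)) ht.1.le
      _ = C * M * (t ^ (1 - α - β) * ((1 - σ) ^ (-α) * σ ^ (-β))) := by
          rw [← beta_subst ht.1 α β ⟨hσ.1.le, hσ.2.le⟩]; ring
      _ ≤ _ := by
          refine mul_le_mul_of_nonneg_left (mul_le_mul_of_nonneg_right hlt.le ?_) hCM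
          have h5 : 0 ≤ 1 - σ := by linarith [hσ.2]
          have h6 := hσ.1.le
          positivity
  · exact ((intervalIntegrable_beta hS.lt_one hβ).const_mul _).const_mul _
  · filter_upwards [h01] with σ hσ hσ'
    have hσ := hσ hσ'
    have h1 : ContinuousOn (fun t => S (t - t * σ)) (Ioc 0 T) :=
      hS.continuousOn.comp (by fun_prop) fun t ht => sub_pos.2 (hmaps t ht σ hσ).2.2
    have h2 : ContinuousOn (fun t => F (t * σ)) (Ioc 0 T) :=
      hF.comp (by fun_prop) fun t ht => (hmaps t ht σ hσ).1
    exact (continuousOn_id.smul (h1.clm_apply h2)) t₀ ht₀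

end Abstract

/-! ### Pointwise values of Bochner integrals in `L^p` -/

section Pointwise

variable {V W : Type*} [NormedAddCommGroup V] [NormedSpace ℝ V]
  [NormedAddCommGroup W] [NormedSpace ℝ W] {p : ℝ≥0∞} [hp : Fact (1 ≤ p)]

lemma norm_setIntegral_Lp_le {W : Type*} [NormedAddCommGroup W] {A : Set E3}
    (hA : volume A ≠ ⊤) (f : Lp W p (volume : Measure E3)) :
    IntegrableOn f A volume ∧
    ∫ x in A, ‖f x‖ ≤ (volume A ^ (1 - 1 / p.toReal)).toReal * ‖f‖ := by
  have : IsFiniteMeasure (volume.restrict A) := ⟨by simpa using hA.lt_top⟩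
  have hm : MemLp f p (volume.restrict A) := (Lp.memLp f).mono_measure Measure.restrict_le_self
  have hi : IntegrableOn f A volume := hm.integrable hp.out
  refine ⟨hi, ?_⟩
  rw [integral_norm_eq_lintegral_enorm hi.1, ← eLpNorm_one_eq_lintegral_enorm]
  have h1 := eLpNorm_le_eLpNorm_mul_rpow_measure_univ hp.out hm.1
  have h2 : eLpNorm f p (volume.restrict A) ≤ eLpNorm f p volume :=
    eLpNorm_mono_measure _ Measure.restrict_le_self
  have h3 : 1 / p.toReal ≤ 1 := by
    rcases eq_or_ne p ⊤ with rfl | htop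
    · simp
    · rw [div_le_one (ENNReal.toReal_pos (zero_lt_one.trans_le hp.out).ne' htop),
        ← ENNReal.toReal_one]
      exact ENNReal.toReal_mono htop hp.out
  rw [Lp.norm_def, ← ENNReal.toReal_mul]
  refine ENNReal.toReal_mono (ENNReal.mul_ne_top ?_ (Lp.eLpNorm_ne_top f)) ?_
  · exact ENNReal.rpow_ne_top_of_nonneg (by linarith) hA
  · rw [mul_comm]
    refine h1.trans ?_
    rw [Measure.restrict_apply_univ, ENNReal.toReal_one, one_div_one]
    gcongr

/-- Integration over a set of finite measure, as a functional on `L^p`. -/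
def setIntegralCLM {A : Set E3} (hA : volume A ≠ ⊤) : Lp W p (volume : Measure E3) →L[ℝ] W :=
  LinearMap.mkContinuous
    { toFun := fun f => ∫ x in A, f x
      map_add' := fun f g => by
        rw [← integral_add (norm_setIntegral_Lp_le hA f).1 (norm_setIntegral_Lp_le hA g).1]
        exact integral_congr_ae (ae_restrict_of_ae (Lp.coeFn_add f g))
      map_smul' := fun c f => by
        rw [RingHom.id_apply, ← integral_smul]
        exact integral_congr_ae (ae_restrict_of_ae (Lp.coeFn_smul c f)) }
    _ fun f => (norm_integral_le_integral_norm _).trans (norm_setIntegral_Lp_le hA f).2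

/-- On a ball L^p embeds in L¹, so Fubini applies there. The Bochner integral and the pointwise
integral have the same integrals over all measurable subsets, because integration over such a subset
is a continuous functional on L^p. Balls exhaust the space. -/
lemma ae_integral_Lp_apply [CompleteSpace W] {Ω : Type*} [MeasurableSpace Ω] {ν : Measure Ω}
    [SFinite ν] {f : Ω → Lp W p (volume : Measure E3)} {g : Ω → E3 → W} (hf : Integrable f ν)
    (hfg : ∀ᵐ s ∂ν, f s =ᵐ[volume] g s)
    (hg : AEStronglyMeasurable (Function.uncurry g) (ν.prod volume)) :
    ∀ᵐ x : E3, Integrable (fun s => g s x) ν ∧ (∫ s, f s ∂ν) x = ∫ s, g s x ∂ν := by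
  have key : ∀ n : ℕ, ∀ᵐ x ∂(volume.restrict (Metric.ball (0 : E3) n)),
      Integrable (fun s => g s x) ν ∧ (∫ s, f s ∂ν) x = ∫ s, g s x ∂ν := by
    intro n
    set B := Metric.ball (0 : E3) n
    have hB : volume B ≠ ⊤ := measure_ball_lt_top.ne
    have hgB : AEStronglyMeasurable (Function.uncurry g) (ν.prod (volume.restrict B)) :=
      hg.mono_ac (Measure.AbsolutelyContinuous.rfl.prod Measure.restrict_le_self.absolutelyContinuous)
    have hint : Integrable (Function.uncurry g) (ν.prod (volume.restrict B)) := by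
      rw [integrable_prod_iff hgB]
      refine ⟨?_, ?_⟩
      · filter_upwards [hfg] with s hs
        exact (norm_setIntegral_Lp_le hB (f s)).1.congr (ae_restrict_of_ae hs)
      · refine (hf.norm.const_mul ((volume B ^ (1 - 1 / p.toReal)).toReal)).mono'
          hgB.norm.integral_prod_right' ?_
        filter_upwards [hfg] with s hs
        rw [Real.norm_of_nonneg (integral_nonneg fun _ => norm_nonneg _)]
        refine le_trans (le_of_eq ?_) (norm_setIntegral_Lp_le hB (f s)).2
        refine integral_congr_ae (ae_restrict_of_ae ?_)
        filter_upwards [hs] with x hx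
        simp [hx]
    have h1 := hint.prod_left_ae
    have h2 : (∫ s, f s ∂ν : Lp W p volume) =ᵐ[volume.restrict B] fun x => ∫ s, g s x ∂ν := by
      refine Integrable.ae_eq_of_forall_setIntegral_eq _ _ (norm_setIntegral_Lp_le hB _).1
        hint.integral_prod_right ?_
      intro A hA _
      rw [Measure.restrict_restrict hA]
      have hAB : volume (A ∩ B) ≠ ⊤ := measure_ne_top_of_subset inter_subset_right hB
      calc ∫ x in A ∩ B, (∫ s, f s ∂ν : Lp W p volume) x
          = setIntegralCLM hAB (∫ s, f s ∂ν) := rfl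
        _ = ∫ s, setIntegralCLM hAB (f s) ∂ν :=
            ((setIntegralCLM hAB).integral_comp_comm hf).symm
        _ = ∫ s, (∫ x in A ∩ B, g s x) ∂ν := by
            refine integral_congr_ae ?_
            filter_upwards [hfg] with s hs
            exact integral_congr_ae (ae_restrict_of_ae hs)
        _ = ∫ x in A ∩ B, (∫ s, g s x ∂ν) := by
            refine integral_integral_swap (f := g) (hint.mono_measure ?_)
            exact Measure.prod_mono le_rfl (Measure.restrict_mono inter_subset_right le_rfl)
    filter_upwards [h1, h2] with x hx1 hx2
    exact ⟨hx1, hx2⟩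
  have := ae_restrict_iUnion_iff (μ := (volume : Measure E3)) (fun n : ℕ => Metric.ball (0 : E3) n)
    (fun x => Integrable (fun s => g s x) ν ∧ (∫ s, f s ∂ν) x = ∫ s, g s x ∂ν)
  rw [Metric.iUnion_ball_nat, Measure.restrict_univ] at this
  exact this.2 key

/-- A Carathéodory function, continuous in one variable and measurable in the other, is jointly
measurable. The argument runs on the subtype S and extends the function outside. -/
lemma aestronglyMeasurable_uncurry_of_continuousOn {W : Type*} [NormedAddCommGroup W]
    {g : ℝ → E3 → W} {S : Set ℝ}
    (hS : MeasurableSet S) (hc : ∀ x, ContinuousOn (fun s => g s x) S)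
    (hm : ∀ s ∈ S, StronglyMeasurable (g s)) :
    AEStronglyMeasurable (Function.uncurry g) ((volume.restrict S).prod (volume : Measure E3)) := by
  have h1 : StronglyMeasurable (Function.uncurry fun (s : S) (x : E3) => g s x) :=
    stronglyMeasurable_uncurry_of_continuous_of_stronglyMeasurable
      (fun x => continuousOn_iff_continuous_domRestrict.1 (hc x)) fun s => hm s s.2
  have hemb : MeasurableEmbedding (fun z : S × E3 => ((z.1 : ℝ), z.2)) :=
    (MeasurableEmbedding.subtype_coe hS).prodMap MeasurableEmbedding.id
  obtain ⟨g', hg', hgg'⟩ := hemb.exists_stronglyMeasurable_extend h1 (fun _ => ⟨0⟩)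
  refine ⟨g', hg', ?_⟩
  have h2 : ∀ᵐ z ∂((volume.restrict S).prod (volume : Measure E3)), z.1 ∈ S :=
    Measure.quasiMeasurePreserving_fst.ae (ae_restrict_mem hS)
  filter_upwards [h2] with z hz
  exact (congrFun hgg' (⟨z.1, hz⟩, z.2)).symm

end Pointwise

/-! ### Duhamel integrals of convolution operators -/

section

variable {V W : Type*} [NormedAddCommGroup V] [NormedSpace ℝ V]
  [NormedAddCommGroup W] [NormedSpace ℝ W]

lemma stronglyMeasurable_kconv {k : E3 → V →L[ℝ] W} {f : E3 → V}
    (hk : StronglyMeasurable k) (hf : StronglyMeasurable f) : StronglyMeasurable (kconv k f) := by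
  have : StronglyMeasurable (fun z : E3 × E3 => k (z.1 - z.2) (f z.2)) :=
    isBoundedBilinearMap_apply.continuous.comp_stronglyMeasurable
      ((hk.comp_measurable (measurable_fst.sub measurable_snd)).prodMk
        (hf.comp_measurable measurable_snd))
  exact this.integral_prod_right

variable {a N : ℝ} {K : ℝ → E3 → V →L[ℝ] W} {r r' q p : ℝ≥0∞} [Fact (1 ≤ r)] [Fact (1 ≤ q)]
  [Fact (1 ≤ p)]

lemma KernelFamily.singularFamily (hK : KernelFamily a N K) (hr : DecayExponent N r)
    (h : YoungTriple r q p) {α : ℝ} (hα : α = a - 3 / (2 * r.toReal)) (hα1 : α < 1) :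
    SingularFamily (eLpNorm (K 1) r volume).toReal α (convOp K h) where
  continuousOn := hK.continuousOn_convOp hr h
  norm_le := fun τ hτ => by
    rw [hα, show -(a - 3 / (2 * r.toReal)) = -a + 3 / (2 * r.toReal) by ring]
    exact hK.norm_convOp_le hr h hτ
  lt_one := hα1

/-- Pointwise values of the Duhamel integral of a family of convolution operators. -/
lemma KernelFamily.duhamel_ae_eq [CompleteSpace W] (hK : KernelFamily a N K)
    (hr : DecayExponent N r)
    (h : YoungTriple r q p) {α β M t : ℝ} (hα : α = a - 3 / (2 * r.toReal)) (hα1 : α < 1)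
    (hr' : DecayExponent N r') [r'.HolderConjugate q] (hβ : β < 1) (ht : 0 < t)
    {F : ℝ → Lp V q (volume : Measure E3)} (hF : ContinuousOn F (Ioo 0 t))
    (hM : ∀ s ∈ Ioo 0 t, ‖F s‖ ≤ M * s ^ (-β)) :
    ∀ᵐ x : E3, IntervalIntegrable (fun s => kconv (K (t - s)) (F s) x) volume 0 t ∧
      duhamel (convOp K h) F t x = ∫ s in (0 : ℝ)..t, kconv (K (t - s)) (F s) x := by
  have hS := hK.singularFamily hr h hα hα1
  have hint := hS.intervalIntegrable hβ ht hF hM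
  rw [intervalIntegrable_iff_integrableOn_Ioo_of_le ht.le] at hint
  -- The second exponent r', conjugate to q, serves here only: it makes the convolution converge at
  -- every x and continuous in s, hence jointly measurable. The exponent r governs the bound from
  -- L^q to L^p.
  have hmeas : AEStronglyMeasurable (Function.uncurry fun s x => kconv (K (t - s)) (F s) x)
      ((volume.restrict (Ioo 0 t)).prod (volume : Measure E3)) := by
    refine aestronglyMeasurable_uncurry_of_continuousOn measurableSet_Ioo (fun x => ?_)
      fun s hs => ?_
    · exact hK.continuousOn_kconv hr' (g := fun s => t - s) (by fun_prop)
        (fun s hs => sub_pos.2 hs.2) hF x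
    · exact stronglyMeasurable_kconv (hK.continuous (sub_pos.2 hs.2)).stronglyMeasurable
        (Lp.stronglyMeasurable _)
  have hae : ∀ᵐ s ∂(volume.restrict (Ioo 0 t)),
      convOp K h (t - s) (F s) =ᵐ[volume] fun x => kconv (K (t - s)) (F s) x :=
    (ae_restrict_mem measurableSet_Ioo).mono fun s hs =>
      hK.convOp_ae_eq hr h (sub_pos.2 hs.2) (F s)
  filter_upwards [ae_integral_Lp_apply hint hae hmeas] with x hx
  rw [intervalIntegrable_iff_integrableOn_Ioo_of_le ht.le]
  refine ⟨hx.1, ?_⟩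
  rw [intervalIntegral.integral_of_le ht.le, integral_Ioc_eq_integral_Ioo, ← hx.2, duhamel,
    intervalIntegral.integral_of_le ht.le, integral_Ioc_eq_integral_Ioo]

end

/-! ### Fourier multipliers with decaying kernels -/

open scoped SchwartzMap

lemma pow_one_add_mul_exp_bounded {c : ℝ} (hc : 0 < c) (n : ℕ) :
    ∃ C, ∀ r : ℝ, 0 ≤ r → (1 + r) ^ n * Real.exp (-(c * r ^ 2)) ≤ C := by
  -- One has (1+r)^n ≤ n! e^{1+r}, and completing the square bounds 1 + r - c r² by 1 + 1/(4c).
  refine ⟨n.factorial * Real.exp (1 + 1 / (4 * c)), fun r hr => ?_⟩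
  have h1 : (1 + r) ^ n ≤ n.factorial * Real.exp (1 + r) := by
    have := Real.pow_div_factorial_le_exp (1 + r) (by linarith) n
    rwa [div_le_iff₀ (by positivity), mul_comm] at this
  calc (1 + r) ^ n * Real.exp (-(c * r ^ 2))
      ≤ n.factorial * Real.exp (1 + r) * Real.exp (-(c * r ^ 2)) := by gcongr
    _ = n.factorial * Real.exp (1 + r - c * r ^ 2) := by
        rw [mul_assoc, ← Real.exp_add]; ring_nf
    _ ≤ _ := by
        gcongr
        have : c * r ^ 2 - r + 1 / (4 * c) = c * (r - 1 / (2 * c)) ^ 2 := by field_simp; ring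
        nlinarith [mul_nonneg hc.le (sq_nonneg (r - 1 / (2 * c)))]

/-- The Gaussian `e^{-c|ξ|²}` as a Schwartz function. -/
def gaussianReal {c : ℝ} (hc : 0 < c) : 𝓢(E3, ℝ) where
  toFun ξ := Real.exp (-(c * ‖ξ‖ ^ 2))
  smooth' := Real.contDiff_exp.comp (contDiff_const.mul (contDiff_norm_sq ℝ)).neg
  decay' := by
    intro k n
    have htg : (fun ξ : E3 => -(c * ‖ξ‖ ^ 2)).HasTemperateGrowth :=
      ((Function.HasTemperateGrowth.const c).mul
        (Function.hasTemperateGrowth_norm_sq E3)).neg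
    obtain ⟨m, C, hC, hbound⟩ := htg.norm_iteratedFDeriv_le_uniform n
    obtain ⟨D, hD⟩ := pow_one_add_mul_exp_bounded hc (k + m * n)
    refine ⟨n.factorial * (C + 1) ^ n * D, fun x => ?_⟩
    have hx := norm_nonneg x
    have h1 : ‖iteratedFDeriv ℝ n (Real.exp ∘ fun ξ : E3 => -(c * ‖ξ‖ ^ 2)) x‖ ≤
        n.factorial * Real.exp (-(c * ‖x‖ ^ 2)) * ((C + 1) * (1 + ‖x‖) ^ m) ^ n := by
      refine norm_iteratedFDeriv_comp_le (N := n) Real.contDiff_exp (htg.1.of_le (by exact_mod_cast le_top)) le_rfl x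
        (fun i _ => ?_) (fun i hi hin => ?_)
      · rw [norm_iteratedFDeriv_eq_norm_iteratedDeriv, iteratedDeriv_eq_iterate, Real.iter_deriv_exp,
          Real.norm_of_nonneg (Real.exp_pos _).le]
      -- The composition estimate wants the i-th derivative of the exponent bounded by the i-th
      -- power of one number, for 1 ≤ i ≤ n. Replacing C by C + 1 makes that number at least 1, so
      -- its first power already suffices.
      · have h2 : 1 ≤ (C + 1) * (1 + ‖x‖) ^ m :=
          one_le_mul_of_one_le_of_one_le (by linarith) (one_le_pow₀ (by linarith))
        calc _ ≤ C * (1 + ‖x‖) ^ m := hbound i hin x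
          _ ≤ (C + 1) * (1 + ‖x‖) ^ m := by gcongr; linarith
          _ ≤ _ := le_self_pow₀ h2 (by omega)
    calc ‖x‖ ^ k * ‖iteratedFDeriv ℝ n (fun ξ : E3 => Real.exp (-(c * ‖ξ‖ ^ 2))) x‖
        ≤ (1 + ‖x‖) ^ k *
          (n.factorial * Real.exp (-(c * ‖x‖ ^ 2)) * ((C + 1) * (1 + ‖x‖) ^ m) ^ n) := by
          gcongr
          · linarith
          · exact h1
      _ = n.factorial * (C + 1) ^ n * ((1 + ‖x‖) ^ (k + m * n) * Real.exp (-(c * ‖x‖ ^ 2))) := by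
          rw [mul_pow, ← pow_mul, pow_add]; ring
      _ ≤ _ := by gcongr; exact hD _ hx

/-- The symbol `e^{-4π²|ξ|²}` of `e^Δ` as a Schwartz function. -/
def heatSchwartz : 𝓢(E3, ℂ) :=
  SchwartzMap.postcompCLM Complex.ofRealCLM (gaussianReal (c := 4 * Real.pi ^ 2) (by positivity))

lemma heatSchwartz_apply (ξ : E3) : heatSchwartz ξ = heatSymbol 1 ξ := by
  simp only [heatSchwartz, SchwartzMap.postcompCLM_apply, heatSymbol, mul_one]
  rfl

/-- Multiplication by a coordinate. -/
def coordMul (k : Fin 3) (Q : 𝓢(E3, ℂ)) : 𝓢(E3, ℂ) :=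
  SchwartzMap.smulLeftCLM ℂ (fun ξ : E3 => ((ξ k : ℝ) : ℂ)) Q

lemma coordMul_apply (k : Fin 3) (Q : 𝓢(E3, ℂ)) (ξ : E3) :
    coordMul k Q ξ = ((ξ k : ℝ) : ℂ) * Q ξ := by
  have h : (fun ξ : E3 => ((ξ k : ℝ) : ℂ)).HasTemperateGrowth :=
    (Complex.ofRealCLM.comp (EuclideanSpace.proj k : E3 →L[ℝ] ℝ)).hasTemperateGrowth
  exact SchwartzMap.smulLeftCLM_apply_apply h Q ξ

/-- An integrable symbol whose kernel decays like `(1+|x|)^{-N}`. -/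
structure DecayingSymbol (N : ℝ) (m : E3 → ℂ) : Prop where
  integrable : Integrable m
  decay : ∃ C, ∀ x, ‖𝓕⁻ m x‖ ≤ C * (1 + ‖x‖) ^ (-N)

lemma integrable_fourierInv_integrand {m : E3 → ℂ} (hm : Integrable m) (x : E3) :
    Integrable fun ξ : E3 => Complex.exp (↑(2 * Real.pi * inner ℝ ξ x) * Complex.I) • m ξ := by
  refine hm.bdd_smul (C := 1) (Continuous.aestronglyMeasurable (f := fun ξ : E3 =>
    Complex.exp (↑(2 * Real.pi * inner ℝ ξ x) * Complex.I)) (by fun_prop)) ?_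
  exact Eventually.of_forall fun ξ => (Complex.norm_exp_ofReal_mul_I _).le

lemma fourierInv_sub {m m' : E3 → ℂ} (hm : Integrable m) (hm' : Integrable m') (x : E3) :
    𝓕⁻ (fun ξ => m ξ - m' ξ) x = 𝓕⁻ m x - 𝓕⁻ m' x := by
  simp only [Real.fourierInv_eq', smul_sub]
  exact integral_sub (integrable_fourierInv_integrand hm x) (integrable_fourierInv_integrand hm' x)

lemma fourierInv_const_mul (c : ℂ) (m : E3 → ℂ) (x : E3) :
    𝓕⁻ (fun ξ => c * m ξ) x = c * 𝓕⁻ m x := by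
  simp only [Real.fourierInv_eq', smul_eq_mul]
  rw [← integral_const_mul]
  congr 1
  funext ξ
  ring

lemma continuous_fourierInv {m : E3 → ℂ} (hm : Integrable m) : Continuous (𝓕⁻ m) := by
  have : 𝓕⁻ m = fun x => 𝓕 m (-x) := funext fun x => Real.fourierInv_eq_fourier_neg m x
  rw [this]
  have h : Continuous (𝓕 m) :=
    VectorFourier.fourierIntegral_continuous Real.continuous_fourierChar
      (by exact continuous_inner) hm
  exact h.comp continuous_neg

lemma DecayingSymbol.sub {N : ℝ} {m m' : E3 → ℂ} (hm : DecayingSymbol N m)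
    (hm' : DecayingSymbol N m') : DecayingSymbol N (fun ξ => m ξ - m' ξ) where
  integrable := hm.integrable.sub hm'.integrable
  decay := by
    obtain ⟨C, hC⟩ := hm.decay
    obtain ⟨C', hC'⟩ := hm'.decay
    refine ⟨C + C', fun x => ?_⟩
    rw [fourierInv_sub hm.integrable hm'.integrable, add_mul]
    exact (norm_sub_le _ _).trans (add_le_add (hC x) (hC' x))

lemma DecayingSymbol.const_mul {N : ℝ} {m : E3 → ℂ} (hm : DecayingSymbol N m) (c : ℂ) :
    DecayingSymbol N (fun ξ => c * m ξ) where
  integrable := hm.integrable.const_mul c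
  decay := by
    obtain ⟨C, hC⟩ := hm.decay
    refine ⟨‖c‖ * C, fun x => ?_⟩
    rw [fourierInv_const_mul, norm_mul, mul_assoc]
    exact mul_le_mul_of_nonneg_left (hC x) (norm_nonneg c)

/-- Almost everywhere equality is enough, which matters because the formula for the Leray symbol is
established only off the origin. -/
lemma DecayingSymbol.congr {N : ℝ} {m m' : E3 → ℂ} (hm : DecayingSymbol N m)
    (h : m =ᵐ[volume] m') : DecayingSymbol N m' where
  integrable := hm.integrable.congr h
  decay := by
    obtain ⟨C, hC⟩ := hm.decay
    exact ⟨C, fun x => by rw [← Real.fourierInv_congr_ae h]; exact hC x⟩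

lemma schwartz_decay (Q : 𝓢(E3, ℂ)) (n : ℕ) :
    ∃ C, 0 ≤ C ∧ ∀ x, ‖Q x‖ ≤ C * (1 + ‖x‖) ^ (-(n : ℝ)) := by
  refine ⟨2 ^ n * ((Finset.Iic (n, 0)).sup fun m => SchwartzMap.seminorm ℝ m.1 m.2) Q,
    mul_nonneg (by positivity) (apply_nonneg _ _), fun x => ?_⟩
  have h := SchwartzMap.one_add_le_sup_seminorm_apply (𝕜 := ℝ) (m := (n, 0)) (k := n) (n := 0)
    le_rfl le_rfl Q x
  rw [norm_iteratedFDeriv_zero] at h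
  have hpos : (0 : ℝ) < 1 + ‖x‖ := by positivity
  rw [Real.rpow_neg hpos.le, Real.rpow_natCast, ← div_eq_mul_inv, le_div_iff₀ (by positivity),
    mul_comm]
  exact h

lemma decayingSymbol_schwartz (Q : 𝓢(E3, ℂ)) (n : ℕ) : DecayingSymbol n Q where
  integrable := Q.integrable
  decay := by
    obtain ⟨C, _, hC⟩ := schwartz_decay (𝓕⁻ Q) n
    exact ⟨C, fun x => by rw [← SchwartzMap.fourierInv_coe]; exact hC x⟩

lemma fourierInv_comp_smul (m : E3 → ℂ) {R : ℝ} (hR : 0 < R) (x : E3) :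
    𝓕⁻ (fun ξ => m (R • ξ)) x = ((R ^ (-3 : ℝ) : ℝ) : ℂ) * 𝓕⁻ m (R⁻¹ • x) := by
  simp only [Real.fourierInv_eq']
  have h := Measure.integral_comp_smul (volume : Measure E3)
    (fun ξ : E3 => Complex.exp (↑(2 * Real.pi * inner ℝ ξ (R⁻¹ • x)) * Complex.I) • m ξ) R
  have h2 : ∀ ξ : E3, inner ℝ (R • ξ) (R⁻¹ • x) = (inner ℝ ξ x : ℝ) := fun ξ => by
    rw [inner_smul_left, inner_smul_right]
    simp only [conj_trivial]
    field_simp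
  simp only [h2] at h
  rw [h, abs_of_pos (by positivity), Complex.real_smul]
  congr 2
  simp [Real.rpow_neg hR.le]

/-! ### Superpositions of dilated Schwartz functions -/

/-- The superposition `∫₁^∞ σ^{-d/2} Q(√σ ξ) dσ`. -/
def superposition (d : ℕ) (Q : 𝓢(E3, ℂ)) (ξ : E3) : ℂ :=
  ∫ σ in Ioi (1 : ℝ), ((σ ^ (-(d : ℝ) / 2) : ℝ) : ℂ) * Q (√σ • ξ)

/-- The L¹ norm of ξ ↦ Q(√σ ξ) is σ^{-3/2} times that of Q, so the total density is σ^{-(d+3)/2},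
integrable at infinity. -/
lemma integrable_superposition_integrand (d : ℕ) (Q : 𝓢(E3, ℂ)) :
    Integrable (Function.uncurry fun (σ : ℝ) (ξ : E3) =>
      ((σ ^ (-(d : ℝ) / 2) : ℝ) : ℂ) * Q (√σ • ξ))
      ((volume.restrict (Ioi (1 : ℝ))).prod volume) := by
  have hm : AEStronglyMeasurable (Function.uncurry fun (σ : ℝ) (ξ : E3) =>
      ((σ ^ (-(d : ℝ) / 2) : ℝ) : ℂ) * Q (√σ • ξ))
      ((volume.restrict (Ioi (1 : ℝ))).prod volume) := by
    have h1 : Measurable (fun z : ℝ × E3 => ((z.1 ^ (-(d : ℝ) / 2) : ℝ) : ℂ)) := by fun_prop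
    have h2 : Continuous (fun z : ℝ × E3 => Q (√z.1 • z.2)) := Q.continuous.comp (by fun_prop)
    exact (h1.aestronglyMeasurable.mul h2.aestronglyMeasurable)
  rw [integrable_prod_iff hm]
  constructor
  · filter_upwards [ae_restrict_mem measurableSet_Ioi] with σ hσ
    have h0 : √σ ≠ 0 := (Real.sqrt_pos.2 (zero_lt_one.trans hσ)).ne'
    exact ((integrable_comp_smul_iff volume (Q : E3 → ℂ) h0).2 Q.integrable).const_mul
      ((σ ^ (-(d : ℝ) / 2) : ℝ) : ℂ)
  · have h1 : IntegrableOn (fun σ : ℝ => σ ^ (-((d : ℝ) + 3) / 2) * ∫ ξ, ‖Q ξ‖) (Ioi 1) :=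
      (integrableOn_Ioi_rpow_of_lt (by
        have : (0 : ℝ) ≤ d := by positivity
        linarith) one_pos).mul_const _
    refine h1.congr ?_
    filter_upwards [ae_restrict_mem measurableSet_Ioi] with σ hσ
    have h0 : 0 < σ := zero_lt_one.trans hσ
    simp only [Function.uncurry, norm_mul, Complex.norm_real]
    rw [integral_const_mul, Measure.integral_comp_smul volume (fun ξ => ‖Q ξ‖) √σ,
      Real.norm_of_nonneg (by positivity), smul_eq_mul, ← mul_assoc]
    congr 1
    rw [abs_of_nonneg (by positivity)]
    simp only [finrank_euclideanSpace, Fintype.card_fin]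
    rw [← Real.rpow_natCast, Real.sqrt_eq_rpow, ← Real.rpow_mul h0.le, ← Real.rpow_neg h0.le,
      ← Real.rpow_add h0]
    congr 1
    push_cast
    ring

lemma integrable_superposition (d : ℕ) (Q : 𝓢(E3, ℂ)) : Integrable (superposition d Q) :=
  (integrable_superposition_integrand d Q).integral_prod_right

lemma fourierInv_superposition (d : ℕ) (Q : 𝓢(E3, ℂ)) (x : E3) :
    𝓕⁻ (superposition d Q) x =
      ∫ σ in Ioi (1 : ℝ), ((σ ^ (-((d : ℝ) + 3) / 2) : ℝ) : ℂ) * (𝓕⁻ Q) ((√σ)⁻¹ • x) := by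
  have hint : Integrable (Function.uncurry fun (σ : ℝ) (ξ : E3) =>
      Complex.exp (↑(2 * Real.pi * inner ℝ ξ x) * Complex.I) •
        (((σ ^ (-(d : ℝ) / 2) : ℝ) : ℂ) * Q (√σ • ξ)))
      ((volume.restrict (Ioi (1 : ℝ))).prod volume) := by
    refine (integrable_superposition_integrand d Q).bdd_smul (C := 1)
      (Continuous.aestronglyMeasurable (f := fun z : ℝ × E3 =>
        Complex.exp (↑(2 * Real.pi * inner ℝ z.2 x) * Complex.I)) (by fun_prop)) ?_
    exact Eventually.of_forall fun z => (Complex.norm_exp_ofReal_mul_I _).le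
  calc 𝓕⁻ (superposition d Q) x
      = ∫ ξ : E3, ∫ σ in Ioi (1 : ℝ), Complex.exp (↑(2 * Real.pi * inner ℝ ξ x) * Complex.I) •
        (((σ ^ (-(d : ℝ) / 2) : ℝ) : ℂ) * Q (√σ • ξ)) := by
        rw [Real.fourierInv_eq']
        congr 1
        funext ξ
        rw [superposition, ← integral_smul]
    _ = ∫ σ in Ioi (1 : ℝ), ∫ ξ : E3, Complex.exp (↑(2 * Real.pi * inner ℝ ξ x) * Complex.I) •
        (((σ ^ (-(d : ℝ) / 2) : ℝ) : ℂ) * Q (√σ • ξ)) := (integral_integral_swap hint).symm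
    _ = _ := by
        refine setIntegral_congr_fun measurableSet_Ioi fun σ hσ => ?_
        have h0 : 0 < σ := zero_lt_one.trans hσ
        rw [← Real.fourierInv_eq', fourierInv_const_mul,
          fourierInv_comp_smul Q (Real.sqrt_pos.2 h0), ← mul_assoc, ← Complex.ofReal_mul,
          SchwartzMap.fourierInv_coe]
        congr 3
        rw [Real.sqrt_eq_rpow, ← Real.rpow_mul h0.le, ← Real.rpow_add h0]
        congr 1
        ring

/-- The kernel is the integral over σ > 1 of σ^{-(d+3)/2} times the inverse transform of Q at x/√σ.
Split at σ = R² with R = 1 + |x|. Below it the Schwartz decay gives R^{-(d+3)} on an interval of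
length at most R²; above it the tail of σ^{-(d+3)/2} gives a multiple of R^{-(d+1)}. -/
lemma decayingSymbol_superposition (d : ℕ) (hd : 0 < d) (Q : 𝓢(E3, ℂ)) :
    DecayingSymbol ((d : ℝ) + 1) (superposition d Q) where
  integrable := integrable_superposition d Q
  decay := by
    -- Decay of order d + 3 is chosen so that (R/√σ)^{-(d+3)} cancels the factor σ^{-(d+3)/2}
    -- exactly, leaving a bound independent of σ on the near part.
    obtain ⟨C, hC0, hC⟩ := schwartz_decay (𝓕⁻ Q) (d + 3)
    have hd0 : (0 : ℝ) < d := by exact_mod_cast hd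
    set e : ℝ := -((d : ℝ) + 3) / 2 with he
    have he1 : e < -1 := by rw [he]; linarith
    refine ⟨C + C * (-1 / (e + 1)), fun x => ?_⟩
    set R := 1 + ‖x‖ with hR
    have hR1 : 1 ≤ R := by rw [hR]; linarith [norm_nonneg x]
    have hR0 : 0 < R := by linarith
    have hR2 : 1 ≤ R ^ 2 := one_le_pow₀ hR1
    set f : ℝ → ℂ := fun σ => ((σ ^ e : ℝ) : ℂ) * (𝓕⁻ Q) ((√σ)⁻¹ • x) with hf
    have near : ∀ σ ∈ Ioc 1 (R ^ 2), ‖f σ‖ ≤ C * R ^ (-((d : ℝ) + 3)) := by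
      intro σ hσ
      have h0 : 0 < σ := zero_lt_one.trans hσ.1
      have hs : 0 < √σ := Real.sqrt_pos.2 h0
      have hs1 : 1 ≤ √σ := by rw [← Real.sqrt_one]; exact Real.sqrt_le_sqrt hσ.1.le
      simp only [hf, norm_mul, Complex.norm_real]
      rw [Real.norm_of_nonneg (by positivity)]
      have h1 : R / √σ ≤ 1 + ‖(√σ)⁻¹ • x‖ := by
        rw [norm_smul, Real.norm_of_nonneg (by positivity), div_eq_inv_mul, hR, mul_add, mul_one]
        gcongr
        exact inv_le_one_of_one_le₀ hs1
      have h2 : ‖(𝓕⁻ Q) ((√σ)⁻¹ • x)‖ ≤ C * (R / √σ) ^ (-((d : ℝ) + 3)) := by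
        refine (hC _).trans ?_
        push_cast
        exact mul_le_mul_of_nonneg_left
          (Real.rpow_le_rpow_of_nonpos (by positivity) h1 (by linarith)) hC0
      calc σ ^ e * ‖(𝓕⁻ Q) ((√σ)⁻¹ • x)‖ ≤ σ ^ e * (C * (R / √σ) ^ (-((d : ℝ) + 3))) := by gcongr
        _ = C * R ^ (-((d : ℝ) + 3)) := by
            rw [Real.div_rpow hR0.le hs.le, Real.sqrt_eq_rpow, ← Real.rpow_mul h0.le]
            rw [show (1 / 2 * -((d : ℝ) + 3)) = e by rw [he]; ring]
            have : σ ^ e ≠ 0 := (Real.rpow_pos_of_pos h0 _).ne'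
            field_simp
    have far : ∀ σ ∈ Ioi (R ^ 2), ‖f σ‖ ≤ C * σ ^ e := by
      intro σ hσ
      have h0 : 0 < σ := lt_of_lt_of_le (by positivity) (le_of_lt hσ)
      simp only [hf, norm_mul, Complex.norm_real]
      rw [Real.norm_of_nonneg (by positivity), mul_comm]
      refine mul_le_mul_of_nonneg_right ((hC _).trans ?_) (by positivity)
      refine mul_le_of_le_one_right hC0 ?_
      exact Real.rpow_le_one_of_one_le_of_nonpos (by linarith [norm_nonneg ((√σ)⁻¹ • x)])
        (by push_cast; linarith)
    have hint : IntegrableOn (fun σ : ℝ => C * σ ^ e) (Ioi (R ^ 2)) :=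
      (integrableOn_Ioi_rpow_of_lt he1 (by positivity)).const_mul C
    have hfm : ContinuousOn f (Ioi 0) := by
      have h1 : ContinuousOn (fun σ : ℝ => (√σ)⁻¹ • x) (Ioi 0) :=
        (ContinuousOn.inv₀ (by fun_prop) fun τ hτ => (Real.sqrt_pos.2 hτ).ne').smul
          continuousOn_const
      exact (Complex.continuous_ofReal.comp_continuousOn
        (continuousOn_id.rpow_const fun τ hτ => Or.inl (ne_of_gt hτ))).mul
        ((𝓕⁻ Q).continuous.comp_continuousOn h1)
    have hf1 : IntegrableOn f (Ioc 1 (R ^ 2)) := by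
      refine (integrableOn_const (C := C * R ^ (-((d : ℝ) + 3))) measure_Ioc_lt_top.ne).mono'
        ((hfm.mono fun σ hσ => zero_lt_one.trans hσ.1).aestronglyMeasurable measurableSet_Ioc)
        ((ae_restrict_mem measurableSet_Ioc).mono near)
    have hf2 : IntegrableOn f (Ioi (R ^ 2)) :=
      hint.mono' ((hfm.mono fun σ hσ => lt_of_lt_of_le (by positivity)
        (le_of_lt hσ)).aestronglyMeasurable measurableSet_Ioi)
        ((ae_restrict_mem measurableSet_Ioi).mono far)
    rw [fourierInv_superposition, ← Ioc_union_Ioi_eq_Ioi hR2,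
      setIntegral_union (Ioc_disjoint_Ioi le_rfl) measurableSet_Ioi hf1 hf2, add_mul]
    refine (norm_add_le _ _).trans (add_le_add ?_ ?_)
    · refine (norm_setIntegral_le_of_norm_le_const measure_Ioc_lt_top near).trans ?_
      rw [measureReal_def, Real.volume_Ioc, ENNReal.toReal_ofReal (by linarith)]
      calc C * R ^ (-((d : ℝ) + 3)) * (R ^ 2 - 1) ≤ C * R ^ (-((d : ℝ) + 3)) * R ^ (2 : ℝ) := by
            gcongr
            rw [Real.rpow_two]; linarith
        _ = C * R ^ (-((d : ℝ) + 1)) := by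
            rw [mul_assoc, ← Real.rpow_add hR0]; congr 2; ring
    · refine (norm_integral_le_of_norm_le hint ((ae_restrict_mem measurableSet_Ioi).mono far)).trans
        (le_of_eq ?_)
      rw [integral_const_mul, integral_Ioi_rpow_of_lt he1 (by positivity), ← Real.rpow_two,
        ← Real.rpow_mul hR0.le, show 2 * (e + 1) = -((d : ℝ) + 1) by rw [he]; ring]
      ring

/-! ### Parabolic scaling of kernels -/

/-- A scalar family of parabolically scaled kernels. -/
structure ScalarFamily (a N : ℝ) (κ : ℝ → E3 → ℝ) : Prop where
  continuous_one : Continuous (κ 1)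
  scaling : ∀ τ : ℝ, 0 < τ → ∀ x, κ τ x = τ ^ (-a) * κ 1 ((√τ)⁻¹ • x)
  decay : ∃ C, ∀ x, ‖κ 1 x‖ ≤ C * (1 + ‖x‖) ^ (-N)
  exponent_nonneg : 0 ≤ N

/-- Dilating frequencies by √τ contributes τ^{-3/2} to the kernel, and the homogeneous factor of
degree e in the symbol contributes τ^{-e/2}. Below, e is the number of derivatives. -/
lemma DecayingSymbol.scalarFamily {N e a : ℝ} (hN : 0 ≤ N) {m : ℝ → E3 → ℂ}
    (hm : DecayingSymbol N (m 1)) (ha : a = (e + 3) / 2)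
    (hs : ∀ τ : ℝ, 0 < τ → ∀ ξ, m τ ξ = ((τ ^ (-e / 2) : ℝ) : ℂ) * m 1 (√τ • ξ)) :
    ScalarFamily a N (fun τ => kernel (m τ)) where
  continuous_one := Complex.continuous_re.comp (continuous_fourierInv hm.integrable)
  scaling := fun τ hτ x => by
    have h1 : m τ = fun ξ => ((τ ^ (-e / 2) : ℝ) : ℂ) * m 1 (√τ • ξ) := funext (hs τ hτ)
    simp only [kernel]
    rw [h1, fourierInv_const_mul, fourierInv_comp_smul _ (Real.sqrt_pos.2 hτ), ← mul_assoc,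
      ← Complex.ofReal_mul, Complex.re_ofReal_mul]
    congr 1
    rw [Real.sqrt_eq_rpow, ← Real.rpow_mul hτ.le, ← Real.rpow_add hτ]
    congr 1
    rw [ha]; ring
  decay := by
    obtain ⟨C, hC⟩ := hm.decay
    exact ⟨C, fun x => (Complex.abs_re_le_norm _).trans (hC x)⟩
  exponent_nonneg := hN

/-! ### The kernels of the heat, divergence and Leray operators -/

/-- When Q is a monomial of degree d times the Gaussian, the powers of σ cancel and the remaining
exponential integral over σ > 1 is e^{-4π²|ξ|²} / (4π²|ξ|²). This produces the singular factor
|ξ|^{-2} of the Leray symbol out of Schwartz functions. -/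
lemma superposition_eq {d : ℕ} {Q : 𝓢(E3, ℂ)} {ξ : E3} (hξ : ξ ≠ 0) {c : ℂ}
    (hQ : ∀ σ : ℝ, 0 < σ →
      Q (√σ • ξ) = ((√σ ^ d : ℝ) : ℂ) * c * (Real.exp (-(4 * Real.pi ^ 2 * ‖ξ‖ ^ 2) * σ) : ℝ)) :
    superposition d Q ξ = c * heatSymbol 1 ξ / ((4 * Real.pi ^ 2 * ‖ξ‖ ^ 2 : ℝ) : ℂ) := by
  have hpos : 0 < 4 * Real.pi ^ 2 * ‖ξ‖ ^ 2 := by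
    have := norm_pos_iff.2 hξ
    positivity
  have h1 : superposition d Q ξ = ∫ σ in Ioi (1 : ℝ),
      c * ((Real.exp (-(4 * Real.pi ^ 2 * ‖ξ‖ ^ 2) * σ) : ℝ) : ℂ) := by
    refine setIntegral_congr_fun measurableSet_Ioi fun σ hσ => ?_
    have h0 : 0 < σ := zero_lt_one.trans hσ
    have h2 : σ ^ (-(d : ℝ) / 2) * √σ ^ d = 1 := by
      rw [Real.sqrt_eq_rpow, ← Real.rpow_natCast, ← Real.rpow_mul h0.le, ← Real.rpow_add h0,
        show -(d : ℝ) / 2 + 1 / 2 * d = 0 by ring, Real.rpow_zero]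
    rw [hQ σ h0, ← mul_assoc, ← mul_assoc, ← Complex.ofReal_mul, h2, Complex.ofReal_one, one_mul]
  rw [h1, integral_const_mul, integral_complex_ofReal, integral_exp_mul_Ioi (by linarith)]
  simp only [heatSymbol, mul_one]
  push_cast
  have : ((4 * Real.pi ^ 2 * ‖ξ‖ ^ 2 : ℝ) : ℂ) ≠ 0 := by exact_mod_cast hpos.ne'
  push_cast at this
  field_simp

lemma heatSymbol_one_sqrt_smul {τ : ℝ} (hτ : 0 < τ) (ξ : E3) :
    heatSymbol 1 (√τ • ξ) = heatSymbol τ ξ := by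
  simp only [heatSymbol, norm_smul, mul_pow, Real.norm_of_nonneg (Real.sqrt_nonneg τ),
    Real.sq_sqrt hτ.le, mul_one, mul_assoc]

lemma leraySymbol_smul {R : ℝ} (hR : 0 < R) (k j : Fin 3) (ξ : E3) :
    leraySymbol k j (R • ξ) = leraySymbol k j ξ := by
  simp only [leraySymbol, PiLp.smul_apply, smul_eq_mul, norm_smul, Real.norm_of_nonneg hR.le]
  rcases eq_or_ne ξ 0 with rfl | hξ
  · simp
  · have := norm_pos_iff.2 hξ
    congr 2
    field_simp

lemma derivSymbol_smul (R : ℝ) (l : Fin 3) (ξ : E3) :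
    derivSymbol l (R • ξ) = (R : ℂ) * derivSymbol l ξ := by
  simp only [derivSymbol, PiLp.smul_apply, smul_eq_mul]
  push_cast
  ring

lemma heat_eq_exp {σ : ℝ} (hσ : 0 < σ) (ξ : E3) :
    heatSchwartz (√σ • ξ) = (Real.exp (-(4 * Real.pi ^ 2 * ‖ξ‖ ^ 2) * σ) : ℝ) := by
  rw [heatSchwartz_apply, heatSymbol_one_sqrt_smul hσ, heatSymbol]
  congr 2
  ring

lemma decayingSymbol_heat (n : ℕ) : DecayingSymbol n (heatSymbol 1) := by
  have : heatSymbol 1 = heatSchwartz := funext fun ξ => (heatSchwartz_apply ξ).symm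
  rw [this]
  exact decayingSymbol_schwartz _ n

lemma decayingSymbol_heatDiv (l : Fin 3) : DecayingSymbol 4 (heatDivSymbol 1 l) := by
  refine ((decayingSymbol_schwartz (coordMul l heatSchwartz) 4).const_mul
    (2 * Real.pi * Complex.I)).congr (Eventually.of_forall fun ξ => ?_)
  simp only [coordMul_apply, heatSchwartz_apply, heatDivSymbol, derivSymbol]
  ring

lemma ae_ne_zero : ∀ᵐ ξ : E3, ξ ≠ 0 := by simp [ae_iff]

/-- The numerator ξ_k ξ_j has degree 2, hence decay of order 3. This does not put the kernel in L¹,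
so buoyancy is always estimated with a kernel exponent larger than 1. -/
lemma decayingSymbol_heatLeray (k j : Fin 3) : DecayingSymbol 3 (heatLeraySymbol 1 k j) := by
  have h1 := (decayingSymbol_schwartz heatSchwartz 3).const_mul (if k = j then 1 else 0)
  -- The factor 4π² undoes the one produced in the denominator by the integral over σ.
  have h2 := (decayingSymbol_superposition 2 (by norm_num)
    (coordMul k (coordMul j heatSchwartz))).const_mul (4 * Real.pi ^ 2)
  norm_num at h1 h2
  refine (h1.sub h2).congr (ae_ne_zero.mono fun ξ hξ => ?_)
  have h3 := superposition_eq (d := 2) (Q := coordMul k (coordMul j heatSchwartz)) hξ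
    (c := (ξ k : ℝ) * (ξ j : ℝ)) (fun σ hσ => by
      rw [coordMul_apply, coordMul_apply, heat_eq_exp hσ]
      simp only [PiLp.smul_apply, smul_eq_mul]
      push_cast
      ring)
  beta_reduce
  rw [h3, heatSchwartz_apply]
  simp only [heatLeraySymbol, leraySymbol]
  have h4 : ((‖ξ‖ : ℝ) : ℂ) ≠ 0 := by exact_mod_cast (norm_pos_iff.2 hξ).ne'
  have h5 : (Real.pi : ℂ) ≠ 0 := by exact_mod_cast Real.pi_ne_zero
  split_ifs <;> (push_cast; field_simp; try ring)

/-- The extra derivative raises the degree of the monomial to 3 and the decay to 4, which makes the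
kernel integrable. -/
lemma decayingSymbol_heatLerayDiv (k j l : Fin 3) :
    DecayingSymbol 4 (heatLerayDivSymbol 1 k j l) := by
  have h1 := (decayingSymbol_schwartz (coordMul l heatSchwartz) 4).const_mul (if k = j then 1 else 0)
  have h2 := (decayingSymbol_superposition 3 (by norm_num)
    (coordMul k (coordMul j (coordMul l heatSchwartz)))).const_mul (4 * Real.pi ^ 2)
  norm_num at h1 h2
  refine ((h1.sub h2).const_mul (2 * Real.pi * Complex.I)).congr (ae_ne_zero.mono fun ξ hξ => ?_)
  have h3 := superposition_eq (d := 3) (Q := coordMul k (coordMul j (coordMul l heatSchwartz))) hξ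
    (c := (ξ k : ℝ) * (ξ j : ℝ) * (ξ l : ℝ)) (fun σ hσ => by
      rw [coordMul_apply, coordMul_apply, coordMul_apply, heat_eq_exp hσ]
      simp only [PiLp.smul_apply, smul_eq_mul]
      push_cast
      ring)
  beta_reduce
  rw [h3, coordMul_apply, heatSchwartz_apply]
  simp only [heatLerayDivSymbol, leraySymbol, derivSymbol]
  have h4 : ((‖ξ‖ : ℝ) : ℂ) ≠ 0 := by exact_mod_cast (norm_pos_iff.2 hξ).ne'
  have h5 : (Real.pi : ℂ) ≠ 0 := by exact_mod_cast Real.pi_ne_zero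
  split_ifs <;> (push_cast; field_simp; try ring)

lemma scalarFamily_heat (n : ℕ) :
    ScalarFamily (3 / 2) n (fun τ => kernel (heatSymbol τ)) :=
  (decayingSymbol_heat n).scalarFamily (e := 0) n.cast_nonneg (by norm_num) fun τ hτ ξ => by
    rw [heatSymbol_one_sqrt_smul hτ]; simp

lemma sqrt_cancel {τ : ℝ} (hτ : 0 < τ) : (((τ ^ (-(1 : ℝ) / 2) : ℝ) : ℂ)) * ((√τ : ℝ) : ℂ) = 1 := by
  rw [← Complex.ofReal_mul, Real.sqrt_eq_rpow, ← Real.rpow_add hτ]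
  norm_num

lemma scalarFamily_heatDiv (l : Fin 3) :
    ScalarFamily 2 4 (fun τ => kernel (heatDivSymbol τ l)) :=
  (decayingSymbol_heatDiv l).scalarFamily (e := 1) (by norm_num) (by norm_num) fun τ hτ ξ => by
    simp only [heatDivSymbol, heatSymbol_one_sqrt_smul hτ, derivSymbol_smul]
    linear_combination (-(heatSymbol τ ξ * derivSymbol l ξ)) * sqrt_cancel hτ

lemma scalarFamily_heatLeray (k j : Fin 3) :
    ScalarFamily (3 / 2) 3 (fun τ => kernel (heatLeraySymbol τ k j)) :=
  (decayingSymbol_heatLeray k j).scalarFamily (e := 0) (by norm_num) (by norm_num) fun τ hτ ξ => by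
    simp [heatLeraySymbol, heatSymbol_one_sqrt_smul hτ, leraySymbol_smul (Real.sqrt_pos.2 hτ)]

lemma scalarFamily_heatLerayDiv (k j l : Fin 3) :
    ScalarFamily 2 4 (fun τ => kernel (heatLerayDivSymbol τ k j l)) :=
  (decayingSymbol_heatLerayDiv k j l).scalarFamily (e := 1) (by norm_num) (by norm_num)
    fun τ hτ ξ => by
      simp only [heatLerayDivSymbol, heatSymbol_one_sqrt_smul hτ, derivSymbol_smul,
        leraySymbol_smul (Real.sqrt_pos.2 hτ)]
      linear_combination
        (-(heatSymbol τ ξ * leraySymbol k j ξ * derivSymbol l ξ)) * sqrt_cancel hτ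

/-! ### Operator-valued kernels -/

section Assembly

variable {V W : Type*} [NormedAddCommGroup V] [NormedSpace ℝ V]
  [NormedAddCommGroup W] [NormedSpace ℝ W] {a N : ℝ}

lemma ScalarFamily.smul_const {κ : ℝ → E3 → ℝ} (h : ScalarFamily a N κ) (L : V →L[ℝ] W) :
    KernelFamily a N (fun τ x => κ τ x • L) where
  continuous_one := h.continuous_one.smul continuous_const
  scaling := fun τ hτ x => by rw [h.scaling τ hτ, mul_smul]
  decay := by
    obtain ⟨C, hC⟩ := h.decay
    refine ⟨C * ‖L‖, fun x => ?_⟩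
    rw [norm_smul, mul_right_comm]
    exact mul_le_mul_of_nonneg_right (hC x) (norm_nonneg L)
  exponent_nonneg := h.exponent_nonneg

lemma KernelFamily.sum {ι : Type*} [Fintype ι] (hN : 0 ≤ N) {K : ι → ℝ → E3 → V →L[ℝ] W}
    (h : ∀ i, KernelFamily a N (K i)) : KernelFamily a N (fun τ x => ∑ i, K i τ x) where
  continuous_one := continuous_finsetSum _ fun i _ => (h i).continuous_one
  scaling := fun τ hτ x => by
    rw [Finset.smul_sum]
    exact Finset.sum_congr rfl fun i _ => (h i).scaling τ hτ x
  decay := by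
    choose C hC using fun i => (h i).decay
    refine ⟨∑ i, C i, fun x => ?_⟩
    rw [Finset.sum_mul]
    exact (norm_sum_le _ _).trans (Finset.sum_le_sum fun i _ => hC i x)
  exponent_nonneg := hN

end Assembly

/-- The `k`-th standard basis vector. -/
abbrev basisVec (k : Fin 3) : E3 := EuclideanSpace.single k 1

/-- The `k`-th coordinate functional. -/
abbrev coord (k : Fin 3) : E3 →L[ℝ] ℝ := EuclideanSpace.proj k

/-- The space of values of `u ⊗ u`. -/
abbrev Mat : Type := Fin 3 → Fin 3 → ℝ

/-- The operator-valued kernel of `e^{τΔ}`. -/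
def heatKernel (V : Type) [NormedAddCommGroup V] [NormedSpace ℝ V] (τ : ℝ) (x : E3) : V →L[ℝ] V :=
  kernel (heatSymbol τ) x • ContinuousLinearMap.id ℝ V

/-- The kernel of `e^{τΔ} ∇ ·`. -/
def divKernel (τ : ℝ) (x : E3) : E3 →L[ℝ] ℝ := ∑ l, kernel (heatDivSymbol τ l) x • coord l

/-- The kernel of `θ ↦ e^{τΔ} ℙ (θ e₃)`. -/
def buoyancyKernel (τ : ℝ) (x : E3) : ℝ →L[ℝ] E3 :=
  ∑ k, kernel (heatLeraySymbol τ k 2) x •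
    (ContinuousLinearMap.id ℝ ℝ).smulRight (basisVec k)

/-- The kernel of `e^{τΔ} ℙ ∇ ·`. -/
def lerayDivKernel (τ : ℝ) (x : E3) : Mat →L[ℝ] E3 :=
  ∑ i : Fin 3 × Fin 3 × Fin 3, kernel (heatLerayDivSymbol τ i.1 i.2.1 i.2.2) x •
    ((ContinuousLinearMap.proj (R := ℝ) (φ := fun _ : Fin 3 => ℝ) i.2.1).comp
      (ContinuousLinearMap.proj (R := ℝ) (φ := fun _ : Fin 3 => Fin 3 → ℝ) i.2.2)).smulRight
      (basisVec i.1)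

lemma kernelFamily_heat (V : Type) [NormedAddCommGroup V] [NormedSpace ℝ V] (n : ℕ) :
    KernelFamily (3 / 2) n (heatKernel V) := (scalarFamily_heat n).smul_const _

lemma kernelFamily_div : KernelFamily 2 4 divKernel :=
  KernelFamily.sum (by norm_num) fun l => (scalarFamily_heatDiv l).smul_const _

lemma kernelFamily_buoyancy : KernelFamily (3 / 2) 3 buoyancyKernel :=
  KernelFamily.sum (by norm_num) fun k => (scalarFamily_heatLeray k 2).smul_const _

lemma kernelFamily_lerayDiv : KernelFamily 2 4 lerayDivKernel :=
  KernelFamily.sum (by norm_num) fun i =>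
    (scalarFamily_heatLerayDiv i.1 i.2.1 i.2.2).smul_const _

lemma heat_eq_kconv {V : Type} [NormedAddCommGroup V] [NormedSpace ℝ V] (t : ℝ) (f : E3 → V) :
    heat t f = kconv (heatKernel V t) f := rfl

/-! ### Multiplier operators as convolutions with operator-valued kernels -/

section MultiplierConverges

variable {a N : ℝ} {m : ℝ → E3 → ℂ}

lemma ScalarFamily.multiplierConverges (hκ : ScalarFamily a N (fun τ => kernel (m τ))) {τ : ℝ}
    (hτ : 0 < τ) {r q : ℝ≥0∞} [r.HolderConjugate q] (hr : DecayExponent N r) {f : E3 → ℝ}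
    (hf : MemLp f q volume) (x : E3) : MultiplierConverges (m τ) f x := by
  have hK := hκ.smul_const (ContinuousLinearMap.id ℝ ℝ)
  exact integrable_kconv_of_holder (hK.memLp hr hτ) hf x

end MultiplierConverges

/-- Divergent Bochner integrals are 0 by convention, so exchanging the sum over components with the
convolution requires each component to converge. -/
lemma heatDiv_eq_kconv {τ : ℝ} {F : E3 → E3} {x : E3}
    (h : ∀ l, MultiplierConverges (heatDivSymbol τ l) (fun y => F y l) x) :
    heatDiv τ F x = kconv (divKernel τ) F x := by
  simp only [heatDiv, multiplierOp, kconv, divKernel, sum_apply,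
    smul_apply]
  exact (integral_finsetSum Finset.univ fun l _ => h l).symm

/-- Since `e3` has a single nonzero coordinate, only the column j = 2 of the Leray matrix
contributes and only its convergence is required. -/
lemma heatLeray_eq_kconv {τ : ℝ} {θ : E3 → ℝ} {x : E3}
    (h : ∀ k, MultiplierConverges (heatLeraySymbol τ k 2) θ x) :
    heatLeray τ (fun y => θ y • e3) x = kconv (buoyancyKernel τ) θ x := by
  simp only [kconv, buoyancyKernel, sum_apply, smul_apply,
    ContinuousLinearMap.smulRight_apply, ContinuousLinearMap.id_apply]
  rw [integral_finsetSum]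
  · ext k
    simp only [heatLeray, multiplierOp, Fin.sum_univ_three, e3, PiLp.smul_apply, PiLp.add_apply]
    have e : ∀ i : Fin 3, ∫ y, kernel (heatLeraySymbol τ i 2) (x - y) • θ y • basisVec i =
        (∫ y, kernel (heatLeraySymbol τ i 2) (x - y) * θ y) • basisVec i := fun i => by
      rw [← integral_smul_const]
      simp only [smul_smul]
    rw [e, e, e]
    fin_cases k <;> simp [EuclideanSpace.single]
  · intro k _
    have := (h k).smul_const (basisVec k)
    simpa only [smul_smul] using this

lemma norm_tensor_le (u v : E3) : ‖(fun l j => u l * v j : Mat)‖ ≤ ‖u‖ * ‖v‖ := by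
  have hle : ∀ (w : E3) (i : Fin 3), ‖w i‖ ≤ ‖w‖ := fun w i => PiLp.norm_apply_le w i
  rw [pi_norm_le_iff_of_nonneg (by positivity)]
  intro l
  rw [pi_norm_le_iff_of_nonneg (by positivity)]
  intro j
  rw [norm_mul]
  exact mul_le_mul (hle u l) (hle v j) (norm_nonneg _) (norm_nonneg _)

/-- The tensor product of vectors, as a bounded bilinear map. -/
def tensorL : E3 →L[ℝ] E3 →L[ℝ] Mat :=
  LinearMap.mkContinuous₂ (LinearMap.mk₂ ℝ (fun u v l j => u l * v j)
    (fun u u' v => by funext l j; simp [add_mul])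
    (fun c u v => by funext l j; simp [mul_assoc])
    (fun u v v' => by funext l j; simp [mul_add])
    (fun c u v => by funext l j; simp; ring)) 1 fun u v => by
      rw [one_mul]
      exact norm_tensor_le u v

lemma tensorL_apply (u v : E3) (l j : Fin 3) : tensorL u v l j = u l * v j := rfl

lemma norm_tensorL_le (u v : E3) : ‖tensorL u v‖ ≤ ‖u‖ * ‖v‖ := norm_tensor_le u v

lemma heatLerayDiv_eq_kconv {τ : ℝ} {u v : E3 → E3} {x : E3}
    (h : ∀ k j l, MultiplierConverges (heatLerayDivSymbol τ k j l) (fun y => u y l * v y j) x) :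
    heatLerayDiv τ (tensor u v) x = kconv (lerayDivKernel τ) (fun y => tensorL (u y) (v y)) x := by
  simp only [kconv, lerayDivKernel, sum_apply, smul_apply,
    ContinuousLinearMap.smulRight_apply, ContinuousLinearMap.comp_apply,
    ContinuousLinearMap.proj_apply, tensorL_apply]
  rw [integral_finsetSum]
  · have e : ∀ i : Fin 3 × Fin 3 × Fin 3, ∫ y, kernel (heatLerayDivSymbol τ i.1 i.2.1 i.2.2) (x - y) •
        (u y i.2.2 * v y i.2.1) • basisVec i.1 =
        (∫ y, kernel (heatLerayDivSymbol τ i.1 i.2.1 i.2.2) (x - y) * (u y i.2.2 * v y i.2.1)) •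
          basisVec i.1 := fun i => by
      rw [← integral_smul_const]
      simp only [smul_smul]
    simp only [e]
    rw [Fintype.sum_prod_type]
    simp only [Fintype.sum_prod_type, ← Finset.sum_smul]
    ext k
    simp only [heatLerayDiv, multiplierOp, tensor, Matrix.of_apply, smul_eq_mul,
      Fin.sum_univ_three, PiLp.add_apply, PiLp.smul_apply]
    fin_cases k <;> simp
  · intro i _
    have := (h i.1 i.2.1 i.2.2).smul_const (basisVec i.1)
    simpa only [smul_smul] using this

/-! ### The heat kernel has mass one -/

/-- The mass of a kernel is its symbol at ξ = 0, by Fourier inversion in the Schwartz class. -/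
lemma integral_heatKernel : ∫ x, kernel (heatSymbol 1) x = 1 := by
  have h0 : heatSymbol 1 = heatSchwartz := funext fun ξ => (heatSchwartz_apply ξ).symm
  have h1 : ∫ x, 𝓕⁻ (heatSymbol 1) x = 1 := by
    have h2 : 𝓕 (𝓕⁻ heatSchwartz) = heatSchwartz := FourierTransform.fourier_fourierInv_eq _
    have h3 : (𝓕 (𝓕⁻ heatSchwartz) : 𝓢(E3, ℂ)) 0 = 1 := by
      rw [h2, heatSchwartz_apply]; simp [heatSymbol]
    rw [SchwartzMap.fourier_coe, Real.fourier_eq'] at h3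
    rw [← h3, h0]
    simp [SchwartzMap.fourierInv_coe]
  have hint : Integrable (𝓕⁻ (heatSymbol 1)) := by
    rw [h0, ← SchwartzMap.fourierInv_coe]; exact (𝓕⁻ heatSchwartz).integrable
  have := integral_re hint
  rw [h1] at this
  simpa [kernel] using this

/-! ### Divergence-free fields -/

lemma continuous_fderiv_test {φ : E3 → ℝ} (hφ : ContDiff ℝ (⊤ : ℕ∞) φ) :
    Continuous (fderiv ℝ φ) := hφ.continuous_fderiv (by simp)

lemma memLp_fderiv_test {φ : E3 → ℝ} (hφ : ContDiff ℝ (⊤ : ℕ∞) φ) (hc : HasCompactSupport φ)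
    (p : ℝ≥0∞) : MemLp (fderiv ℝ φ) p volume :=
  (continuous_fderiv_test hφ).memLp_of_hasCompactSupport (hc.fderiv ℝ)

/-- The pairing of `L^p` with the gradient of a test function. -/
def gradPairing {φ : E3 → ℝ} (hφ : ContDiff ℝ (⊤ : ℕ∞) φ) (hc : HasCompactSupport φ)
    (r p : ℝ≥0∞) [Fact (1 ≤ r)] [Fact (1 ≤ p)] [r.HolderConjugate p] :
    Lp E3 p (volume : Measure E3) →L[ℝ] ℝ :=
  (ContinuousLinearMap.id ℝ (E3 →L[ℝ] ℝ)).lpPairing volume r p (memLp_fderiv_test hφ hc r).toLp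

lemma gradPairing_apply {φ : E3 → ℝ} (hφ : ContDiff ℝ (⊤ : ℕ∞) φ) (hc : HasCompactSupport φ)
    (r p : ℝ≥0∞) [Fact (1 ≤ r)] [Fact (1 ≤ p)] [r.HolderConjugate p]
    (f : Lp E3 p (volume : Measure E3)) :
    gradPairing hφ hc r p f = ∫ x, fderiv ℝ φ x (f x) := by
  rw [gradPairing, ContinuousLinearMap.lpPairing_eq_integral]
  refine integral_congr_ae ?_
  filter_upwards [MemLp.coeFn_toLp (memLp_fderiv_test hφ hc r)] with x hx
  rw [hx]
  rfl

lemma isDivergenceFree_congr {f g : E3 → E3} (h : f =ᵐ[volume] g) (hf : IsDivergenceFree f) :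
    IsDivergenceFree g := fun φ hφ hc => by
  rw [← hf φ hφ hc]
  refine integral_congr_ae ?_
  filter_upwards [h] with x hx
  rw [hx]

section

variable {V : Type*} [NormedAddCommGroup V] [NormedSpace ℝ V] {r q : ℝ≥0∞} [r.HolderConjugate q]
  {k : E3 → V →L[ℝ] E3} {f : E3 → V} {φ : E3 → ℝ}

/-- Fubini: the gradient of the test function is integrable, and the absolute convolution integral
is bounded uniformly in x by Hölder. -/
lemma integral_fderiv_kconv (hφ : ContDiff ℝ (⊤ : ℕ∞) φ) (hc : HasCompactSupport φ)
    (hk : MemLp k r volume) (hf : MemLp f q volume) :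
    Integrable (fun z : E3 × E3 => fderiv ℝ φ z.1 (k (z.1 - z.2) (f z.2))) ∧
    ∫ x, fderiv ℝ φ x (kconv k f x) = ∫ y, ∫ x, fderiv ℝ φ x (k (x - y) (f y)) := by
  have hm : AEStronglyMeasurable (fun z : E3 × E3 => fderiv ℝ φ z.1 (k (z.1 - z.2) (f z.2)))
      (volume.prod volume) := by
    have h1 : AEStronglyMeasurable (fun z : E3 × E3 => k (z.1 - z.2)) (volume.prod volume) :=
      hk.1.comp_quasiMeasurePreserving (quasiMeasurePreserving_sub _ _)
    have h2 : AEStronglyMeasurable (fun z : E3 × E3 => k (z.1 - z.2) (f z.2))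
        (volume.prod volume) :=
      isBoundedBilinearMap_apply.continuous.comp_aestronglyMeasurable (h1.prodMk hf.1.comp_snd)
    have h3 : AEStronglyMeasurable (fun z : E3 × E3 => fderiv ℝ φ z.1) (volume.prod volume) :=
      ((continuous_fderiv_test hφ).comp continuous_fst).aestronglyMeasurable
    exact isBoundedBilinearMap_apply.continuous.comp_aestronglyMeasurable (h3.prodMk h2)
  have hi : Integrable (fun z : E3 × E3 => fderiv ℝ φ z.1 (k (z.1 - z.2) (f z.2)))
      (volume.prod volume) := by
    rw [integrable_prod_iff hm]
    have hb : ∀ x, Integrable (fun y => fderiv ℝ φ x (k (x - y) (f y))) := fun x =>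
      (fderiv ℝ φ x).integrable_comp (integrable_kconv_of_holder hk hf x)
    refine ⟨Eventually.of_forall hb, ?_⟩
    refine ((memLp_one_iff_integrable.1 (memLp_fderiv_test hφ hc 1)).norm.mul_const
      (eLpNorm k r volume * eLpNorm f q volume).toReal).mono' hm.norm.integral_prod_right' ?_
    refine Eventually.of_forall fun x => ?_
    rw [Real.norm_of_nonneg (integral_nonneg fun _ => norm_nonneg _)]
    have hkx := integrable_kconv_of_holder hk hf x
    calc ∫ y, ‖fderiv ℝ φ x (k (x - y) (f y))‖
        ≤ ∫ y, ‖fderiv ℝ φ x‖ * ‖k (x - y) (f y)‖ :=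
          integral_mono (hb x).norm (hkx.norm.const_mul _) fun y => (fderiv ℝ φ x).le_opNorm _
      _ = ‖fderiv ℝ φ x‖ * ∫ y, ‖k (x - y) (f y)‖ := integral_const_mul _ _
      _ ≤ _ := by
          refine mul_le_mul_of_nonneg_left ?_ (norm_nonneg _)
          rw [integral_norm_eq_lintegral_enorm hkx.1]
          refine ENNReal.toReal_mono (ENNReal.mul_ne_top hk.2.ne hf.2.ne) ?_
          exact (lintegral_mono fun y => (k (x - y)).le_opENorm (f y)).trans
            (lintegral_kconv_le_of_holder hk.1 hf.1 r q x)
  refine ⟨hi, ?_⟩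
  rw [← integral_integral_swap hi]
  refine integral_congr_ae (Eventually.of_forall fun x => ?_)
  exact ((fderiv ℝ φ x).integral_comp_comm (integrable_kconv_of_holder hk hf x)).symm

lemma contDiff_translate (hφ : ContDiff ℝ (⊤ : ℕ∞) φ) (y : E3) :
    ContDiff ℝ (⊤ : ℕ∞) (fun x => φ (x + y)) := hφ.comp (contDiff_id.add contDiff_const)

lemma hasCompactSupport_translate (hc : HasCompactSupport φ) (y : E3) :
    HasCompactSupport (fun x => φ (x + y)) := hc.comp_homeomorph (Homeomorph.addRight y)

/-- Convolution with a kernel of zero divergence gives a divergence-free field. -/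
lemma isDivergenceFree_kconv (hk : MemLp k r volume) (hf : MemLp f q volume)
    (hdiv : ∀ φ : E3 → ℝ, ContDiff ℝ (⊤ : ℕ∞) φ → HasCompactSupport φ → ∀ v,
      ∫ x, fderiv ℝ φ x (k x v) = 0) : IsDivergenceFree (kconv k f) := by
  intro φ hφ hc
  rw [(integral_fderiv_kconv hφ hc hk hf).2]
  refine integral_eq_zero_of_ae (Eventually.of_forall fun y => ?_)
  have h := hdiv _ (contDiff_translate hφ y) (hasCompactSupport_translate hc y) (f y)
  simp only [fderiv_comp_add_right] at h
  simp only [Pi.zero_apply]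
  rw [← integral_add_right_eq_self (μ := (volume : Measure E3)) _ y]
  simpa only [add_sub_cancel_right] using h

/-- Convolution with a scalar kernel preserves divergence-free fields. -/
lemma isDivergenceFree_kconv_scalar {κ : E3 → ℝ} {f : E3 → E3}
    (hk : MemLp (fun x => κ x • ContinuousLinearMap.id ℝ E3) r volume) (hf : MemLp f q volume)
    (hdiv : IsDivergenceFree f) :
    IsDivergenceFree (kconv (fun x => κ x • ContinuousLinearMap.id ℝ E3) f) := by
  intro φ hφ hc
  obtain ⟨hi, _⟩ := integral_fderiv_kconv hφ hc hk hf
  -- The measure-preserving shear (x, y) ↦ (x, x - y) moves the translation from the kernel to the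
  -- field, so that the inner integral in x tests a translate of f.
  have hi2 : Integrable (fun z : E3 × E3 => fderiv ℝ φ z.1 (κ z.2 • f (z.1 - z.2)))
      (volume.prod volume) := by
    have hmp : MeasurePreserving (fun z : E3 × E3 => (z.1, z.1 - z.2)) (volume.prod volume)
        (volume.prod volume) :=
      (MeasurePreserving.id volume).skew_product (g := fun x y => x - y) (by fun_prop)
        (Eventually.of_forall fun x => (Measure.measurePreserving_sub_left volume x).map_eq)
    have := hmp.integrable_comp_of_integrable hi
    simpa [Function.comp_def] using this
  calc ∫ x, fderiv ℝ φ x (kconv (fun x => κ x • ContinuousLinearMap.id ℝ E3) f x)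
      = ∫ x, ∫ z, fderiv ℝ φ x (κ z • f (x - z)) := by
        refine integral_congr_ae (Eventually.of_forall fun x => ?_)
        have h1 := (fderiv ℝ φ x).integral_comp_comm (integrable_kconv_of_holder hk hf x)
        refine h1.symm.trans ?_
        beta_reduce
        rw [← integral_sub_left_eq_self (fun z => fderiv ℝ φ x (κ z • f (x - z))) volume x]
        simp
    _ = ∫ z, ∫ x, fderiv ℝ φ x (κ z • f (x - z)) := integral_integral_swap hi2
    _ = ∫ z : E3, (0 : ℝ) := by
        refine integral_congr_ae (Eventually.of_forall fun z => ?_)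
        have h2 := hdiv _ (contDiff_translate hφ z) (hasCompactSupport_translate hc z)
        simp only [map_smul, smul_eq_mul]
        rw [integral_const_mul, ← integral_add_right_eq_self (μ := (volume : Measure E3)) _ z]
        simp only [add_sub_cancel_right]
        simp only [fderiv_comp_add_right] at h2
        rw [h2, mul_zero]
    _ = 0 := integral_zero _ _

end

/-- A vector of kernels is divergence-free when its symbol is orthogonal to ξ: moving the inverse
transform onto the test function turns ∂_k φ into a multiple of ξ_k times the inverse transform of
φ, and the sum over k vanishes under the integral. -/
lemma sum_integral_kernel_eq_zero {m : Fin 3 → E3 → ℂ} (hm : ∀ k, Integrable (m k))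
    (h0 : ∀ ξ, ∑ k, ((ξ k : ℝ) : ℂ) * m k ξ = 0) {φ : E3 → ℝ} (hφ : ContDiff ℝ (⊤ : ℕ∞) φ)
    (hc : HasCompactSupport φ) :
    ∑ k, ∫ x, kernel (m k) x * fderiv ℝ φ x (basisVec k) = 0 := by
  have hc' : HasCompactSupport (fun x => ((φ x : ℝ) : ℂ)) := hc.comp_left Complex.ofReal_zero
  have hφ' : ContDiff ℝ (⊤ : ℕ∞) (fun x => ((φ x : ℝ) : ℂ)) := Complex.ofRealCLM.contDiff.comp hφ
  set Φ : 𝓢(E3, ℂ) := hc'.toSchwartzMap hφ' with hΦ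
  have hcoe : (Φ : E3 → ℂ) = fun x => ((φ x : ℝ) : ℂ) := rfl
  set ψ : Fin 3 → 𝓢(E3, ℂ) := fun k => LineDeriv.lineDerivOp (basisVec k) Φ with hψ
  have hψ1 : ∀ k x, ψ k x = ((fderiv ℝ φ x (basisVec k) : ℝ) : ℂ) := by
    intro k x
    rw [hψ, SchwartzMap.lineDerivOp_apply_eq_fderiv, hcoe]
    have h1 : HasFDerivAt (fun x => ((φ x : ℝ) : ℂ)) (Complex.ofRealCLM.comp (fderiv ℝ φ x)) x :=
      Complex.ofRealCLM.hasFDerivAt.comp x (hφ.differentiable (by simp) x).hasFDerivAt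
    rw [h1.fderiv]
    rfl
  have hψ2 : ∀ k ξ, 𝓕⁻ (ψ k) ξ =
      -(2 * Real.pi * Complex.I) * (((ξ k : ℝ) : ℂ) * 𝓕⁻ Φ ξ) := by
    intro k ξ
    have htg : (fun ξ : E3 => inner ℝ ξ (basisVec k)).HasTemperateGrowth :=
      Function.hasTemperateGrowth_inner_left _
    rw [hψ, SchwartzMap.fourierInv_lineDerivOp_eq, smul_apply,
      SchwartzMap.smulLeftCLM_apply_apply htg]
    have : inner ℝ ξ (basisVec k) = ξ k := by
      simp [basisVec, EuclideanSpace.inner_single_right]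
    simp [this]
  -- The inverse transform is the Fourier integral for the form `-innerₗ`, which equals its own
  -- flip; integrability of both functions is all that the exchange needs.
  have hflip : ∀ k, ∫ x, 𝓕⁻ (m k) x * ψ k x = ∫ ξ, m k ξ * 𝓕⁻ (ψ k) ξ := by
    intro k
    have := VectorFourier.integral_fourierIntegral_smul_eq_flip (μ := (volume : Measure E3))
      (ν := (volume : Measure E3)) (L := -innerₗ E3) Real.continuous_fourierChar
      (by simpa using! continuous_inner.neg) (hm k) (ψ k).integrable
    have hL : (-innerₗ E3).flip = -innerₗ E3 := by
      ext v w
      simp [real_inner_comm]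
    rw [hL] at this
    rw [SchwartzMap.fourierInv_coe]
    exact this
  have hint : ∀ k, Integrable (fun ξ => m k ξ * 𝓕⁻ (ψ k) ξ) := by
    intro k
    obtain ⟨C, hC⟩ : ∃ C, ∀ ξ, ‖𝓕⁻ (ψ k) ξ‖ ≤ C :=
      ⟨_, fun ξ => SchwartzMap.norm_le_seminorm ℝ (𝓕⁻ (ψ k)) ξ⟩
    exact (hm k).mul_bdd (𝓕⁻ (ψ k)).continuous.aestronglyMeasurable (Eventually.of_forall hC)
  have hbd : ∀ k, Integrable (fun x => 𝓕⁻ (m k) x * ψ k x) := by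
    intro k
    obtain ⟨C, hC⟩ : ∃ C, ∀ x, ‖𝓕⁻ (m k) x‖ ≤ C := by
      refine ⟨∫ ξ, ‖m k ξ‖, fun x => ?_⟩
      exact VectorFourier.norm_fourierIntegral_le_integral_norm _ _ _ _ _
    exact (ψ k).integrable.bdd_mul
      (continuous_fourierInv (hm k)).aestronglyMeasurable (Eventually.of_forall hC)
  have hsum : ∑ k, ∫ x, 𝓕⁻ (m k) x * ψ k x = 0 := by
    simp only [hflip]
    rw [← integral_finsetSum _ fun k _ => hint k]
    refine integral_eq_zero_of_ae (Eventually.of_forall fun ξ => ?_)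
    have := congrArg (fun c => -(2 * Real.pi * Complex.I) * 𝓕⁻ Φ ξ * c) (h0 ξ)
    simp only [mul_zero, Finset.mul_sum] at this
    rw [Pi.zero_apply, ← this]
    refine Finset.sum_congr rfl fun k _ => ?_
    rw [hψ2]
    ring
  -- The kernel is the real part of the inverse transform, and ψ takes real values, so the real
  -- identity is the real part of the complex one.
  have hre : ∀ k, ∫ x, kernel (m k) x * fderiv ℝ φ x (basisVec k)
      = (∫ x, 𝓕⁻ (m k) x * ψ k x).re := by
    intro k
    rw [← RCLike.re_eq_complex_re, ← integral_re (hbd k)]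
    refine integral_congr_ae (Eventually.of_forall fun x => ?_)
    simp [hψ1, kernel]
  simp only [hre]
  rw [← Complex.re_sum, hsum, Complex.zero_re]

/-- The Leray matrix projects onto the orthogonal complement of ξ. -/
lemma sum_mul_leraySymbol (j : Fin 3) (ξ : E3) :
    ∑ k, ((ξ k : ℝ) : ℂ) * leraySymbol k j ξ = 0 := by
  rcases eq_or_ne ξ 0 with rfl | hξ
  · simp
  have hn : ‖ξ‖ ^ 2 ≠ 0 := by have := norm_pos_iff.2 hξ; positivity
  have h2 : ‖ξ‖ ^ 2 = ξ 0 ^ 2 + ξ 1 ^ 2 + ξ 2 ^ 2 := by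
    rw [EuclideanSpace.real_norm_sq_eq, Fin.sum_univ_three]
  have h3 : ∀ k : Fin 3, ξ k * ((if k = j then 1 else 0) - ξ k * ξ j / ‖ξ‖ ^ 2)
      = (if k = j then ξ k else 0) - ξ k ^ 2 * (ξ j / ‖ξ‖ ^ 2) := by
    intro k; split_ifs <;> ring
  have h4 : ∑ k, ξ k * ((if k = j then 1 else 0) - ξ k * ξ j / ‖ξ‖ ^ 2) = 0 := by
    simp only [h3]
    rw [Finset.sum_sub_distrib, Finset.sum_ite_eq' Finset.univ j, ← Finset.sum_mul,
      Fin.sum_univ_three, ← h2]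
    simp only [Finset.mem_univ, if_true]
    field_simp
    simp
  simp only [leraySymbol, ← Complex.ofReal_mul, ← Complex.ofReal_sum]
  exact Complex.ofReal_eq_zero.2 h4

lemma integrable_fderiv_mul_kernel {κ : E3 → ℝ} (hκ : Continuous κ) {φ : E3 → ℝ}
    (hφ : ContDiff ℝ (⊤ : ℕ∞) φ) (hc : HasCompactSupport φ) (v : E3) :
    Integrable fun x => κ x * fderiv ℝ φ x v := by
  refine Continuous.integrable_of_hasCompactSupport
    (hκ.mul ((continuous_fderiv_test hφ).clm_apply continuous_const)) ?_
  exact ((hc.fderiv ℝ).comp_left (g := fun L : E3 →L[ℝ] ℝ => L v) (by simp)).mul_left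

lemma ScalarFamily.continuous {a N : ℝ} {κ : ℝ → E3 → ℝ} (h : ScalarFamily a N κ) {τ : ℝ}
    (hτ : 0 < τ) : Continuous (κ τ) := by
  have : κ τ = fun x => τ ^ (-a) * κ 1 ((√τ)⁻¹ • x) := funext (h.scaling τ hτ)
  rw [this]
  have := h.continuous_one
  fun_prop

lemma integrable_of_scaled {m : ℝ → E3 → ℂ} (hm : Integrable (m 1)) {τ e : ℝ} (hτ : 0 < τ)
    (hs : ∀ ξ, m τ ξ = ((τ ^ e : ℝ) : ℂ) * m 1 (√τ • ξ)) : Integrable (m τ) := by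
  have : m τ = fun ξ => ((τ ^ e : ℝ) : ℂ) * m 1 (√τ • ξ) := funext hs
  rw [this]
  exact ((integrable_comp_smul_iff volume (m 1) (Real.sqrt_pos.2 hτ).ne').2 hm).const_mul _

lemma integrable_heatLeraySymbol {τ : ℝ} (hτ : 0 < τ) (k j : Fin 3) :
    Integrable (heatLeraySymbol τ k j) :=
  integrable_of_scaled (m := fun τ => heatLeraySymbol τ k j) (decayingSymbol_heatLeray k j).integrable
    (e := 0) hτ fun ξ => by
    simp [heatLeraySymbol, heatSymbol_one_sqrt_smul hτ, leraySymbol_smul (Real.sqrt_pos.2 hτ)]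

lemma integrable_heatLerayDivSymbol {τ : ℝ} (hτ : 0 < τ) (k j l : Fin 3) :
    Integrable (heatLerayDivSymbol τ k j l) :=
  integrable_of_scaled (m := fun τ => heatLerayDivSymbol τ k j l)
    (decayingSymbol_heatLerayDiv k j l).integrable (e := -(1 : ℝ) / 2) hτ fun ξ => by
      simp only [heatLerayDivSymbol, heatSymbol_one_sqrt_smul hτ, derivSymbol_smul,
        leraySymbol_smul (Real.sqrt_pos.2 hτ)]
      linear_combination
        (-(heatSymbol τ ξ * leraySymbol k j ξ * derivSymbol l ξ)) * sqrt_cancel hτ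

lemma integral_fderiv_buoyancyKernel {τ : ℝ} (hτ : 0 < τ) {φ : E3 → ℝ}
    (hφ : ContDiff ℝ (⊤ : ℕ∞) φ) (hc : HasCompactSupport φ) (v : ℝ) :
    ∫ x, fderiv ℝ φ x (buoyancyKernel τ x v) = 0 := by
  have h1 := sum_integral_kernel_eq_zero (m := fun k => heatLeraySymbol τ k 2)
    (fun k => integrable_heatLeraySymbol hτ k 2) (fun ξ => by
      have := congrArg (fun c => heatSymbol τ ξ * c) (sum_mul_leraySymbol 2 ξ)
      simp only [mul_zero, Finset.mul_sum] at this
      rw [← this]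
      exact Finset.sum_congr rfl fun k _ => by rw [heatLeraySymbol]; ring) hφ hc
  have h2 : ∀ x, fderiv ℝ φ x (buoyancyKernel τ x v) =
      v * ∑ k, kernel (heatLeraySymbol τ k 2) x * fderiv ℝ φ x (basisVec k) := by
    intro x
    simp only [buoyancyKernel, sum_apply, smul_apply, ContinuousLinearMap.smulRight_apply,
      ContinuousLinearMap.id_apply, map_sum, map_smul, smul_eq_mul, Finset.mul_sum]
    exact Finset.sum_congr rfl fun k _ => by ring
  simp only [h2]
  rw [integral_const_mul, integral_finsetSum _ fun k _ =>
    integrable_fderiv_mul_kernel ((scalarFamily_heatLeray k 2).continuous hτ) hφ hc _, h1, mul_zero]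

lemma integral_fderiv_lerayDivKernel {τ : ℝ} (hτ : 0 < τ) {φ : E3 → ℝ}
    (hφ : ContDiff ℝ (⊤ : ℕ∞) φ) (hc : HasCompactSupport φ) (v : Mat) :
    ∫ x, fderiv ℝ φ x (lerayDivKernel τ x v) = 0 := by
  have h1 : ∀ j l : Fin 3, ∑ k, ∫ x, kernel (heatLerayDivSymbol τ k j l) x *
      fderiv ℝ φ x (basisVec k) = 0 := fun j l =>
    sum_integral_kernel_eq_zero (m := fun k => heatLerayDivSymbol τ k j l)
      (fun k => integrable_heatLerayDivSymbol hτ k j l) (fun ξ => by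
      have := congrArg (fun c => heatSymbol τ ξ * derivSymbol l ξ * c) (sum_mul_leraySymbol j ξ)
      simp only [mul_zero, Finset.mul_sum] at this
      rw [← this]
      exact Finset.sum_congr rfl fun k _ => by rw [heatLerayDivSymbol]; ring) hφ hc
  have h2 : ∀ x, fderiv ℝ φ x (lerayDivKernel τ x v) = ∑ i : Fin 3 × Fin 3 × Fin 3,
      v i.2.2 i.2.1 * (kernel (heatLerayDivSymbol τ i.1 i.2.1 i.2.2) x *
        fderiv ℝ φ x (basisVec i.1)) := by
    intro x
    simp only [lerayDivKernel, sum_apply, smul_apply, ContinuousLinearMap.smulRight_apply,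
      ContinuousLinearMap.comp_apply, ContinuousLinearMap.proj_apply, map_sum, map_smul,
      smul_eq_mul]
    exact Finset.sum_congr rfl fun i _ => by ring
  simp only [h2]
  rw [integral_finsetSum _ fun i _ => (integrable_fderiv_mul_kernel
    ((scalarFamily_heatLerayDiv i.1 i.2.1 i.2.2).continuous hτ) hφ hc _).const_mul _]
  simp only [integral_const_mul, Fintype.sum_prod_type]
  rw [Finset.sum_comm]
  refine Finset.sum_eq_zero fun j _ => ?_
  rw [Finset.sum_comm]
  refine Finset.sum_eq_zero fun l _ => ?_
  rw [← Finset.mul_sum, h1, mul_zero]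

/-! ### The heat semigroup on `L^p` -/

section Translation

variable {G : Type*} [NormedAddCommGroup G] {p : ℝ≥0∞}

/-- Translation of a function in `L^p`. -/
def translate (h : E3) (f : Lp G p (volume : Measure E3)) : Lp G p (volume : Measure E3) :=
  Lp.compMeasurePreserving (fun x => x - h) (measurePreserving_sub_right volume h) f

lemma translate_ae_eq (h : E3) (f : Lp G p (volume : Measure E3)) :
    translate h f =ᵐ[volume] fun x => f (x - h) :=
  Lp.coeFn_compMeasurePreserving f (measurePreserving_sub_right volume h)

lemma norm_translate (h : E3) (f : Lp G p (volume : Measure E3)) : ‖translate h f‖ = ‖f‖ :=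
  Lp.norm_compMeasurePreserving f (measurePreserving_sub_right volume h)

lemma translate_zero (f : Lp G p (volume : Measure E3)) : translate 0 f = f := by
  refine Lp.ext ((translate_ae_eq 0 f).trans ?_)
  simp

lemma continuous_translate [Fact (1 ≤ p)] (hp : p ≠ ⊤) (f : Lp G p (volume : Measure E3)) :
    Continuous fun h => translate h f := by
  have hc : Continuous fun h : E3 => (⟨fun x => x - h, by fun_prop⟩ : C(E3, E3)) :=
    ContinuousMap.continuous_of_continuous_uncurry _ (by
      simp only [Function.uncurry_def, ContinuousMap.coe_mk]; fun_prop)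
  exact continuous_const.compMeasurePreservingLp hc
    (fun h => measurePreserving_sub_right volume h) hp

end Translation

section Heat

variable {V : Type} [NormedAddCommGroup V] [NormedSpace ℝ V]

/-- The heat kernel decays faster than any power; order 4, the first integer above the dimension,
already places it in every L^r. -/
lemma decayExponent_of_one_le {r : ℝ≥0∞} (hr : 1 ≤ r) : DecayExponent (4 : ℕ) r := by
  refine ⟨hr, ?_⟩
  rcases eq_or_ne r ⊤ with h | h
  · exact Or.inl h
  · right
    have : 1 ≤ r.toReal := by simpa using ENNReal.toReal_mono h hr
    push_cast
    linarith

lemma memLp_heatKernel {r : ℝ≥0∞} (hr : 1 ≤ r) {t : ℝ} (ht : 0 < t) :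
    MemLp (heatKernel V t) r volume :=
  (kernelFamily_heat V 4).memLp (decayExponent_of_one_le hr) ht

lemma kconv_sub_add {W : Type*} [NormedAddCommGroup W] [NormedSpace ℝ W] {k : E3 → V →L[ℝ] W}
    {f g : E3 → V} {r q : ℝ≥0∞} [r.HolderConjugate q]
    (hk : MemLp k r volume) (hf : MemLp f q volume) (hg : MemLp g q volume) :
    kconv k f = kconv k (f - g) + kconv k g := by
  funext x
  have := integral_add (integrable_kconv_of_holder hk (hf.sub hg) x)
    (integrable_kconv_of_holder hk hg x)
  simpa [kconv] using this

/-- `t^α ‖e^{tΔ} f‖_p → 0` as `t → 0` for `f ∈ L^q`, with the scaling exponent `α > 0`. -/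
lemma tendsto_heat_weighted {r r' q p : ℝ≥0∞} [r'.HolderConjugate q] (hr : 1 ≤ r) (hr' : 1 ≤ r')
    (hq : q ≠ ⊤) (hp : 1 ≤ p) {α : ℝ} (hα : α = 3 / 2 - 3 / (2 * r.toReal)) (hα0 : 0 < α)
    (hY : ∀ t : ℝ, 0 < t → ∀ g : E3 → V, MemLp g q volume →
      eLpNorm (kconv (heatKernel V t) g) p volume
        ≤ eLpNorm (heatKernel V t) r volume * eLpNorm g q volume)
    (hY1 : ∀ t : ℝ, 0 < t → ∀ g : E3 → V, MemLp g p volume →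
      eLpNorm (kconv (heatKernel V t) g) p volume
        ≤ eLpNorm (heatKernel V t) 1 volume * eLpNorm g p volume)
    {f : E3 → V} (hf : MemLp f q volume) :
    Tendsto (fun t : ℝ => ENNReal.ofReal (t ^ α) * eLpNorm (kconv (heatKernel V t) f) p volume)
      (𝓝[>] 0) (𝓝 0) := by
  rw [ENNReal.tendsto_nhds_zero]
  intro ε hε
  set C := eLpNorm (heatKernel V 1) r volume with hC
  have hCtop : C ≠ ⊤ := (memLp_heatKernel hr one_pos).2.ne
  set C1 := eLpNorm (heatKernel V 1) 1 volume with hC1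
  have hC1top : C1 ≠ ⊤ := (memLp_heatKernel le_rfl one_pos).2.ne
  -- The constant C + 1 replaces C so that the division is harmless when C = 0.
  have hδ : ε / 2 / (C + 1) ≠ 0 := by
    refine (ENNReal.div_pos (ENNReal.div_pos hε.ne' (by simp)).ne' ?_).ne'
    exact ENNReal.add_ne_top.2 ⟨hCtop, ENNReal.one_ne_top⟩
  -- The difference f - g is small uniformly in t, because t^α balances the singularity of the
  -- smoothing estimate. For g, which already lies in L^p, the semigroup is bounded and t^α itself
  -- tends to zero.
  obtain ⟨g, hgc, hfg, hgcont, hgq⟩ := hf.exists_hasCompactSupport_eLpNorm_sub_le hq hδ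
  have hgp : MemLp g p volume := hgcont.memLp_of_hasCompactSupport hgc
  have hlim : Tendsto (fun t : ℝ => ENNReal.ofReal (t ^ α) * (C1 * eLpNorm g p volume)) (𝓝[>] 0)
      (𝓝 0) := by
    have h1 : Tendsto (fun t : ℝ => t ^ α) (𝓝[>] 0) (𝓝 0) := by
      have := (Real.continuousAt_rpow_const 0 α (Or.inr hα0.le)).tendsto
      rw [Real.zero_rpow hα0.ne'] at this
      exact this.mono_left nhdsWithin_le_nhds
    have h2 := ENNReal.tendsto_ofReal h1
    rw [ENNReal.ofReal_zero] at h2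
    have h3 := ENNReal.Tendsto.mul_const (b := C1 * eLpNorm g p volume) h2
      (Or.inr (ENNReal.mul_ne_top hC1top hgp.2.ne))
    rwa [zero_mul] at h3
  have hε2 : 0 < ε / 2 := ENNReal.div_pos hε.ne' (by simp)
  filter_upwards [self_mem_nhdsWithin, ENNReal.tendsto_nhds_zero.1 hlim _ hε2] with t ht ht2
  have ht : 0 < t := ht
  rw [kconv_sub_add (memLp_heatKernel hr' ht) hf hgq]
  have hm : ∀ {h : E3 → V}, MemLp h q volume →
      AEStronglyMeasurable (kconv (heatKernel V t) h) volume := fun hh =>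
    aestronglyMeasurable_kconv (memLp_heatKernel hr ht).1 hh.1
  have e1 : ENNReal.ofReal (t ^ α) * (eLpNorm (heatKernel V t) r volume) = C := by
    rw [(kernelFamily_heat V 4).eLpNorm_eq r ht, ← mul_assoc,
      ← ENNReal.ofReal_mul (by positivity), ← Real.rpow_add ht, hα]
    ring_nf
    simp [hC]
  have e2 : eLpNorm (heatKernel V t) 1 volume = C1 := by
    rw [(kernelFamily_heat V 4).eLpNorm_eq 1 ht]
    norm_num [hC1]
  calc ENNReal.ofReal (t ^ α) * eLpNorm (kconv (heatKernel V t) (f - g) +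
        kconv (heatKernel V t) g) p volume
      ≤ ENNReal.ofReal (t ^ α) * (eLpNorm (heatKernel V t) r volume * eLpNorm (f - g) q volume
          + eLpNorm (heatKernel V t) 1 volume * eLpNorm g p volume) := by
        gcongr
        refine (eLpNorm_add_le (hm (hf.sub hgq)) (hm hgq) hp).trans ?_
        exact add_le_add (hY t ht _ (hf.sub hgq)) (hY1 t ht g hgp)
    _ = C * eLpNorm (f - g) q volume + ENNReal.ofReal (t ^ α) * (C1 * eLpNorm g p volume) := by
        rw [mul_add, ← mul_assoc, e1, e2]
    _ ≤ ε / 2 + ε / 2 := by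
        refine add_le_add ?_ ht2
        calc C * eLpNorm (f - g) q volume ≤ (C + 1) * (ε / 2 / (C + 1)) := by
              gcongr
              exact le_self_add
          _ ≤ ε / 2 := ENNReal.mul_div_le
    _ = ε := ENNReal.add_halves ε

lemma eLpNorm_top_kconv_le {W : Type*} [NormedAddCommGroup W] [NormedSpace ℝ W]
    {k : E3 → V →L[ℝ] W} {f : E3 → V} {r q : ℝ≥0∞} [r.HolderConjugate q]
    (hk : AEStronglyMeasurable k volume) (hf : AEStronglyMeasurable f volume) :
    eLpNorm (kconv k f) ⊤ volume ≤ eLpNorm k r volume * eLpNorm f q volume :=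
  (eLpNorm_exponent_top (f := kconv k f)).trans_le (eLpNormEssSup_le_of_ae_enorm_bound
    (Eventually.of_forall fun x => enorm_kconv_le_of_holder hk hf r q x))

lemma heatKernel_scaling {t : ℝ} (ht : 0 < t) (z : E3) :
    kernel (heatSymbol t) z = t ^ (-(3 : ℝ) / 2) * kernel (heatSymbol 1) ((√t)⁻¹ • z) := by
  have := (scalarFamily_heat 4).scaling t ht z
  rwa [neg_div]

/-- A non-integrable function has Bochner integral 0, whereas this one integrates to 1. -/
lemma integrable_heatKernel_one : Integrable (kernel (heatSymbol 1)) := by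
  by_contra h
  have := integral_heatKernel
  rw [integral_undef h] at this
  exact zero_ne_one this

/-- Rescaling writes `e^{tΔ} f` as an average of translates of f by √t w against a weight that does
not depend on t; only the translations move as t → 0. -/
lemma kconv_heatKernel_eq {t : ℝ} (ht : 0 < t) (f : E3 → V) (x : E3) :
    kconv (heatKernel V t) f x = ∫ w, kernel (heatSymbol 1) w • f (x - √t • w) := by
  have h1 : kconv (heatKernel V t) f x = ∫ z, kernel (heatSymbol t) z • f (x - z) := by
    rw [← integral_sub_left_eq_self (fun z => kernel (heatSymbol t) z • f (x - z)) volume x]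
    simp [kconv, heatKernel]
  have hs : 0 < √t := Real.sqrt_pos.2 ht
  have h2 := Measure.integral_comp_inv_smul_of_nonneg (μ := (volume : Measure E3))
    (fun w => kernel (heatSymbol 1) w • f (x - √t • w)) hs.le
  rw [h1]
  have h3 : ∀ z, kernel (heatSymbol t) z • f (x - z) = t ^ (-(3 : ℝ) / 2) •
      (kernel (heatSymbol 1) ((√t)⁻¹ • z) • f (x - √t • (√t)⁻¹ • z)) := by
    intro z
    rw [heatKernel_scaling ht, smul_smul, smul_smul (√t), mul_inv_cancel₀ hs.ne', one_smul]
  simp only [h3]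
  rw [integral_smul, h2, smul_smul]
  have : t ^ (-(3 : ℝ) / 2) * √t ^ Module.finrank ℝ E3 = 1 := by
    rw [finrank_euclideanSpace, Fintype.card_fin, Real.sqrt_eq_rpow, ← Real.rpow_natCast,
      ← Real.rpow_mul ht.le, ← Real.rpow_add ht]
    norm_num
  rw [this, one_smul]

/-- The heat semigroup is strongly continuous at `t = 0`. -/
lemma tendsto_convOp_heat {p : ℝ≥0∞} [Fact (1 ≤ p)] [CompleteSpace V] [Fact ((1 : ℝ≥0∞) ≤ 1)]
    (h : YoungTriple 1 p p)
    (f : Lp V p (volume : Measure E3)) :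
    Tendsto (fun t => convOp (heatKernel V) h t f) (𝓝[>] 0) (𝓝 f) := by
  set κ := kernel (heatSymbol 1) with hκ
  have hκi : Integrable κ := integrable_heatKernel_one
  have htr := continuous_translate h.p_ne_top f
  have hmeas : ∀ t : ℝ, AEStronglyMeasurable (fun w => κ w • translate (√t • w) f) volume :=
    fun t => hκi.1.smul (htr.comp (continuous_const_smul (√t))).aestronglyMeasurable
  have hbd : ∀ (t : ℝ) (w : E3), ‖κ w • translate (√t • w) f‖ ≤ ‖κ w‖ * ‖f‖ := fun t w => by
    rw [norm_smul, norm_translate]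
  -- The average of translates is an identity in L^p, with a Bochner integral on the right, so the
  -- limit can be taken in norm.
  have heq : ∀ t : ℝ, 0 < t →
      convOp (heatKernel V) h t f = ∫ w, κ w • translate (√t • w) f := by
    intro t ht
    refine Lp.ext (((kernelFamily_heat V 4).convOp_ae_eq
      (decayExponent_of_one_le le_rfl) h ht f).trans ?_)
    have hint : Integrable (fun w => κ w • translate (√t • w) f) :=
      (hκi.norm.mul_const ‖f‖).mono' (hmeas t) (Eventually.of_forall (hbd t))
    have hcont : Continuous κ := (scalarFamily_heat 4).continuous_one
    have := ae_integral_Lp_apply (g := fun w x => κ w • f (x - √t • w)) hint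
      (Eventually.of_forall fun w => by
        refine (Lp.coeFn_smul _ _).trans ?_
        filter_upwards [translate_ae_eq (√t • w) f] with x hx
        rw [Pi.smul_apply, hx]) (by
        refine StronglyMeasurable.aestronglyMeasurable ?_
        refine (hcont.comp continuous_fst).stronglyMeasurable.smul ?_
        exact (Lp.stronglyMeasurable f).comp_measurable
          (g := fun z : E3 × E3 => z.2 - √t • z.1) (by fun_prop))
    filter_upwards [this] with x hx
    rw [hx.2, kconv_heatKernel_eq ht]
  -- Translation is norm continuous in L^p for finite p and isometric, so dominated convergence
  -- applies with majorant |κ| ‖f‖; the limit is f because κ has mass one.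
  have hlim : Tendsto (fun t : ℝ => ∫ w, κ w • translate (√t • w) f) (𝓝[>] 0)
      (𝓝 (∫ w, κ w • f)) := by
    refine tendsto_integral_filter_of_dominated_convergence (fun w => ‖κ w‖ * ‖f‖)
      (Eventually.of_forall hmeas) (Eventually.of_forall fun t => Eventually.of_forall (hbd t))
      (hκi.norm.mul_const _) (Eventually.of_forall fun w => ?_)
    have h1 : Continuous fun t : ℝ => κ w • translate (√t • w) f :=
      (htr.comp (f := fun t : ℝ => √t • w)
        (Real.continuous_sqrt.smul continuous_const)).const_smul (κ w)
    have h2 := (h1.tendsto 0).mono_left (nhdsWithin_le_nhds (s := Ioi 0))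
    simpa [translate_zero] using h2
  rw [integral_smul_const, integral_heatKernel, one_smul] at hlim
  refine hlim.congr' ?_
  filter_upwards [self_mem_nhdsWithin] with t ht
  exact (heq t ht).symm

end Heat

/-! ### Fixed points in spaces of paths vanishing at `t = 0` -/

section FixedPoint

variable {Z : Type*} [NormedAddCommGroup Z]

/-- A causal map of paths on `(0,T]` that contracts paths of size `2R` and leaves a ball and a
family of pointwise constraints invariant. -/
structure PicardMap (T R : ℝ) (P : ℝ → Set Z) (N : (ℝ → Z) → ℝ → Z) : Prop where
  time_pos : 0 < T
  radius_pos : 0 < R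
  continuousOn : ∀ z M, ContinuousOn z (Ioc 0 T) → (∀ t ∈ Ioc 0 T, ‖z t‖ ≤ M) →
    ContinuousOn (N z) (Ioc 0 T)
  contract : ∀ z w t δ, t ∈ Ioc 0 T → ContinuousOn z (Ioo 0 t) → ContinuousOn w (Ioo 0 t) →
    (∀ s ∈ Ioo 0 t, ‖z s‖ ≤ 2 * R) → (∀ s ∈ Ioo 0 t, ‖w s‖ ≤ 2 * R) →
    (∀ s ∈ Ioo 0 t, ‖z s - w s‖ ≤ δ) → ‖N z t - N w t‖ ≤ δ / 2
  data_le : ∀ t ∈ Ioc 0 T, ‖N 0 t‖ ≤ R / 2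
  data_tendsto : Tendsto (N 0) (𝓝[>] 0) (𝓝 0)
  isClosed : ∀ t, IsClosed (P t)
  zero_mem : ∀ t, 0 ∈ P t
  invariant : ∀ z, ContinuousOn z (Ioc 0 T) → (∀ t ∈ Ioc 0 T, ‖z t‖ ≤ R) →
    (∀ t ∈ Ioc 0 T, z t ∈ P t) → ∀ t ∈ Ioc 0 T, N z t ∈ P t

variable {T R : ℝ} {P : ℝ → Set Z} {N : (ℝ → Z) → ℝ → Z}

lemma exists_small_of_tendsto_zero {z : ℝ → Z} (hz : Tendsto z (𝓝[>] 0) (𝓝 0)) {ε : ℝ}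
    (hε : 0 < ε) : ∃ η > 0, ∀ s ∈ Ioo 0 η, ‖z s‖ < ε := by
  have h1 : ∀ᶠ s in 𝓝[>] (0 : ℝ), ‖z s‖ < ε := by
    have := hz.norm
    rw [norm_zero] at this
    exact this.eventually_lt_const hε
  obtain ⟨η, hη, hsub⟩ := mem_nhdsGT_iff_exists_Ioo_subset.1 h1
  exact ⟨η, hη, fun s hs => hsub hs⟩

namespace PicardMap

lemma norm_le (h : PicardMap T R P N) {z : ℝ → Z} {t δ : ℝ} (ht : t ∈ Ioc 0 T)
    (hc : ContinuousOn z (Ioo 0 t)) (hb : ∀ s ∈ Ioo 0 t, ‖z s‖ ≤ 2 * R)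
    (hδ : ∀ s ∈ Ioo 0 t, ‖z s‖ ≤ δ) : ‖N z t‖ ≤ ‖N 0 t‖ + δ / 2 := by
  have h1 := h.contract z 0 t δ ht hc continuousOn_const hb
    (fun s _ => by simpa using h.radius_pos.le) (by simpa using hδ)
  calc ‖N z t‖ = ‖N 0 t + (N z t - N 0 t)‖ := by rw [add_sub_cancel]
    _ ≤ _ := (norm_add_le _ _).trans (by linarith)

/-- By causality the norm of N z at time t is controlled by N 0 at t and by z on (0, t) alone; both
are small near t = 0. -/
lemma tendsto_zero (h : PicardMap T R P N) {z : ℝ → Z} (hc : ContinuousOn z (Ioc 0 T))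
    (hb : ∀ s ∈ Ioc 0 T, ‖z s‖ ≤ 2 * R) (hz : Tendsto z (𝓝[>] 0) (𝓝 0)) :
    Tendsto (N z) (𝓝[>] 0) (𝓝 0) := by
  rw [Metric.tendsto_nhds]
  intro ε hε
  obtain ⟨η, hη, hsm⟩ := exists_small_of_tendsto_zero hz hε
  obtain ⟨η', hη', hs'⟩ := exists_small_of_tendsto_zero h.data_tendsto (half_pos hε)
  filter_upwards [Ioo_mem_nhdsGT (lt_min (lt_min hη hη') h.time_pos)] with t ht
  have ht1 := lt_min_iff.1 ht.2
  have ht2 := lt_min_iff.1 ht1.1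
  have hsub : Ioo 0 t ⊆ Ioc 0 T := fun s hs => ⟨hs.1, (hs.2.trans ht1.2).le⟩
  rw [dist_zero_right]
  have := h.norm_le ⟨ht.1, ht1.2.le⟩ (hc.mono hsub) (fun s hs => hb s (hsub hs))
    (fun s hs => (hsm s ⟨hs.1, hs.2.trans ht2.1⟩).le)
  have := hs' t ⟨ht.1, ht2.2⟩
  linarith

/-- Each application of the contraction halves the distance, starting from the trivial bound 4R. The
hypotheses concern the open interval, but the conclusion includes the endpoint T'; the continuation
argument for uniqueness relies on this. -/
lemma eqOn_of_bounded (h : PicardMap T R P N) {z w : ℝ → Z} {T' : ℝ} (hT' : T' ≤ T)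
    (hz : ContinuousOn z (Ioc 0 T)) (hw : ContinuousOn w (Ioc 0 T))
    (hzb : ∀ s ∈ Ioo 0 T', ‖z s‖ ≤ 2 * R) (hwb : ∀ s ∈ Ioo 0 T', ‖w s‖ ≤ 2 * R)
    (hzN : EqOn z (N z) (Ioc 0 T)) (hwN : EqOn w (N w) (Ioc 0 T)) : EqOn z w (Ioc 0 T') := by
  have step : ∀ δ : ℝ, (∀ s ∈ Ioo 0 T', ‖z s - w s‖ ≤ δ) → ∀ t ∈ Ioc 0 T', ‖z t - w t‖ ≤ δ / 2 := by
    intro δ hδ t ht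
    have htT : t ∈ Ioc 0 T := ⟨ht.1, ht.2.trans hT'⟩
    have hsub : ∀ s ∈ Ioo 0 t, s ∈ Ioo 0 T' := fun s hs => ⟨hs.1, hs.2.trans_le ht.2⟩
    have hsub' : Ioo 0 t ⊆ Ioc 0 T := fun s hs => ⟨hs.1, (hs.2.trans_le htT.2).le⟩
    rw [hzN htT, hwN htT]
    exact h.contract z w t δ htT (hz.mono hsub') (hw.mono hsub') (fun s hs => hzb s (hsub s hs))
      (fun s hs => hwb s (hsub s hs)) fun s hs => hδ s (hsub s hs)
  have iter : ∀ n : ℕ, ∀ s ∈ Ioo 0 T', ‖z s - w s‖ ≤ 4 * R * (1 / 2) ^ n := by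
    intro n
    induction n with
    | zero =>
      intro s hs
      have := norm_sub_le (z s) (w s)
      have h1 := hzb s hs
      have h2 := hwb s hs
      simp only [pow_zero, mul_one]
      linarith
    | succ n ih =>
      intro s hs
      have := step _ ih s ⟨hs.1, hs.2.le⟩
      rw [pow_succ]
      linarith
  have lim : Tendsto (fun n : ℕ => 4 * R * (1 / 2 : ℝ) ^ n / 2) atTop (𝓝 0) := by
    have := ((tendsto_pow_atTop_nhds_zero_of_lt_one (r := (1 / 2 : ℝ)) (by norm_num)
      (by norm_num)).const_mul (4 * R)).div_const 2
    simpa using this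
  intro t ht
  have h0 : ‖z t - w t‖ ≤ 0 :=
    ge_of_tendsto' lim fun n => step _ (iter n) t ht
  exact sub_eq_zero.1 (norm_le_zero_iff.1 h0)

/-- A small fixed point is the only one in the class of paths vanishing at `t = 0`. -/
lemma unique (h : PicardMap T R P N) {z w : ℝ → Z}
    (hz : ContinuousOn z (Ioc 0 T)) (hw : ContinuousOn w (Ioc 0 T))
    (hzb : ∀ s ∈ Ioc 0 T, ‖z s‖ ≤ R) (hw0 : Tendsto w (𝓝[>] 0) (𝓝 0))
    (hzN : EqOn z (N z) (Ioc 0 T)) (hwN : EqOn w (N w) (Ioc 0 T)) : EqOn z w (Ioc 0 T) := by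
  have hR := h.radius_pos
  have hzb' : ∀ s ∈ Ioc 0 T, ‖z s‖ ≤ 2 * R := fun s hs => (hzb s hs).trans (by linarith)
  suffices hb : ∀ t ∈ Ioc 0 T, ‖w t‖ < 2 * R from
    h.eqOn_of_bounded le_rfl hz hw (fun s hs => hzb' s ⟨hs.1, hs.2.le⟩)
      (fun s hs => (hb s ⟨hs.1, hs.2.le⟩).le) hzN hwN
  by_contra! hcon
  obtain ⟨t₁, ht₁, hbig⟩ := hcon
  obtain ⟨η, hη, hsmall⟩ := exists_small_of_tendsto_zero hw0 (by linarith : 0 < 2 * R)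
  -- The times at which w is large. As w vanishes at 0 they stay away from 0, so the set is compact
  -- and has a least element t₀. Before t₀ the contraction applies and gives w = z up to and
  -- including t₀, where z has norm at most R < 2R.
  set A : Set ℝ := {t | t ∈ Icc η T ∧ 2 * R ≤ ‖w t‖} with hA
  have hηA : ∀ t ∈ Ioc 0 T, 2 * R ≤ ‖w t‖ → t ∈ A := fun t ht hwt => by
    refine ⟨⟨?_, ht.2⟩, hwt⟩
    by_contra! hlt
    exact absurd (hsmall t ⟨ht.1, hlt⟩) (not_lt.2 hwt)
  have hAc : IsCompact A := by
    have hcont : ContinuousOn (fun t => ‖w t‖) (Icc η T) :=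
      (hw.mono fun t ht => ⟨hη.trans_le ht.1, ht.2⟩).norm
    exact isCompact_Icc.of_isClosed_subset
      (hcont.preimage_isClosed_of_isClosed isClosed_Icc isClosed_Ici) fun t ht => ht.1
  obtain ⟨t₀, ht₀, hmin⟩ := hAc.exists_isLeast ⟨t₁, hηA t₁ ht₁ hbig⟩
  have ht₀T : t₀ ∈ Ioc 0 T := ⟨hη.trans_le ht₀.1.1, ht₀.1.2⟩
  have hwb : ∀ s ∈ Ioo 0 t₀, ‖w s‖ ≤ 2 * R := fun s hs => by
    by_contra! hlt
    exact absurd (hmin (hηA s ⟨hs.1, hs.2.le.trans ht₀T.2⟩ hlt.le)) (not_le.2 hs.2)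
  have := h.eqOn_of_bounded ht₀T.2 hz hw
    (fun s hs => hzb' s ⟨hs.1, hs.2.le.trans ht₀T.2⟩) hwb hzN hwN ⟨ht₀T.1, le_rfl⟩
  have h1 := hzb t₀ ht₀T
  rw [this] at h1
  linarith [ht₀.2]

open Classical in
/-- A small fixed point exists. -/
lemma exists_fixedPoint [CompleteSpace Z] (h : PicardMap T R P N) :
    ∃ z : ℝ → Z, ContinuousOn z (Ioc 0 T) ∧ (∀ t ∈ Ioc 0 T, ‖z t‖ ≤ R) ∧
      Tendsto z (𝓝[>] 0) (𝓝 0) ∧ (∀ t ∈ Ioc 0 T, z t ∈ P t) ∧ EqOn z (N z) (Ioc 0 T) := by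
  have hT := h.time_pos
  have hR := h.radius_pos
  set ext : C(Icc (0 : ℝ) T, Z) → ℝ → Z := fun z => IccExtend hT.le z with hext
  have hext_apply : ∀ z (t : Icc (0 : ℝ) T), ext z t = z t := fun z t => IccExtend_val _ _ _
  have hext_cont : ∀ z, Continuous (ext z) := fun z => z.continuous.Icc_extend'
  -- The map N carries information on (0, T] only; the value at t = 0 is reset to 0, the limit of N
  -- z there.
  set val : C(Icc (0 : ℝ) T, Z) → Icc (0 : ℝ) T → Z := fun z t =>
    Function.update (N (ext z)) 0 0 t with hval
  -- The default value 0 is never taken on the set S below, where continuity is proved.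
  set Φ : C(Icc (0 : ℝ) T, Z) → C(Icc (0 : ℝ) T, Z) := fun z =>
    if hc : Continuous (val z) then ⟨val z, hc⟩ else 0 with hΦ
  -- Paths on the closed interval with value 0 at t = 0 encode the vanishing condition, so that S is
  -- a closed subset of a complete space of continuous functions. The pointwise constraints are
  -- imposed for t ≠ 0 only.
  set S : Set C(Icc (0 : ℝ) T, Z) := {z | (∀ t, ‖z t‖ ≤ R) ∧ z ⟨0, le_rfl, hT.le⟩ = 0 ∧
    ∀ t : Icc (0 : ℝ) T, (t : ℝ) ≠ 0 → z t ∈ P t} with hS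
  have hSclosed : IsClosed S := by
    have h1 : S = (⋂ t, {z | ‖z t‖ ≤ R}) ∩ ({z | z ⟨0, le_rfl, hT.le⟩ = 0} ∩
        ⋂ t : Icc (0 : ℝ) T, ⋂ _ : (t : ℝ) ≠ 0, {z | z t ∈ P t}) := by
      ext z; simp [hS]
    rw [h1]
    refine (isClosed_iInter fun t => ?_).inter (IsClosed.inter ?_
      (isClosed_iInter fun t => isClosed_iInter fun _ => ?_))
    · exact isClosed_le (continuous_eval_const t).norm continuous_const
    · exact isClosed_eq (continuous_eval_const _) continuous_const
    · exact (h.isClosed t).preimage (continuous_eval_const t)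
  have hSext : ∀ z ∈ S, (∀ t ∈ Ioc 0 T, ‖ext z t‖ ≤ R) ∧ Tendsto (ext z) (𝓝[>] 0) (𝓝 0) ∧
      ∀ t ∈ Ioc 0 T, ext z t ∈ P t := by
    intro z hz
    refine ⟨fun t ht => ?_, ?_, fun t ht => ?_⟩
    · rw [hext_apply z ⟨t, ht.1.le, ht.2⟩]; exact hz.1 _
    · have h1 := ((hext_cont z).tendsto 0).mono_left (nhdsWithin_le_nhds (s := Ioi 0))
      rwa [hext_apply z ⟨0, le_rfl, hT.le⟩, hz.2.1] at h1
    · rw [hext_apply z ⟨t, ht.1.le, ht.2⟩]; exact hz.2.2 ⟨t, ht.1.le, ht.2⟩ ht.1.ne'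
  have hvalcont : ∀ z ∈ S, Continuous (val z) := by
    intro z hz
    obtain ⟨h1, h2, -⟩ := hSext z hz
    have hN := h.continuousOn (ext z) R (hext_cont z).continuousOn h1
    have hN0 := h.tendsto_zero (hext_cont z).continuousOn
      (fun s hs => (h1 s hs).trans (by linarith)) h2
    have : ContinuousOn (Function.update (N (ext z)) 0 0) (Icc 0 T) := by
      intro t ht
      rcases eq_or_lt_of_le ht.1 with rfl | ht0
      · rw [continuousWithinAt_update_same]
        exact hN0.mono_left (nhdsWithin_mono _ fun s hs =>
          lt_of_le_of_ne hs.1.1 (Ne.symm (by simpa using hs.2)))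
      · rw [continuousWithinAt_update_of_ne ht0.ne']
        refine (hN t ⟨ht0, ht.2⟩).mono_of_mem_nhdsWithin ?_
        filter_upwards [self_mem_nhdsWithin, mem_nhdsWithin_of_mem_nhds (lt_mem_nhds ht0)]
          with s hs hs0
        exact ⟨hs0, hs.2⟩
    exact continuousOn_iff_continuous_domRestrict.1 this
  have hΦval : ∀ z ∈ S, ∀ t, Φ z t = val z t := fun z hz t => by
    simp only [hΦ, dif_pos (hvalcont z hz)]
    rfl
  have hΦ0 : ∀ z ∈ S, ∀ t : Icc (0 : ℝ) T, (t : ℝ) = 0 → Φ z t = 0 := fun z hz t ht => by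
    rw [hΦval z hz, hval]; simp [ht]
  have hΦN : ∀ z ∈ S, ∀ t : Icc (0 : ℝ) T, (t : ℝ) ≠ 0 → Φ z t = N (ext z) t := fun z hz t ht => by
    rw [hΦval z hz, hval]; simp [ht]
  have hpos : ∀ t : Icc (0 : ℝ) T, (t : ℝ) ≠ 0 → (t : ℝ) ∈ Ioc 0 T := fun t ht =>
    ⟨lt_of_le_of_ne t.2.1 ht.symm, t.2.2⟩
  have hmaps : MapsTo Φ S S := by
    intro z hz
    obtain ⟨h1, h2, h3⟩ := hSext z hz
    refine ⟨fun t => ?_, hΦ0 z hz _ rfl, fun t ht => ?_⟩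
    · rcases eq_or_ne (t : ℝ) 0 with ht | ht
      · rw [hΦ0 z hz t ht, norm_zero]; exact hR.le
      · have htT := hpos t ht
        have hsub : ∀ s ∈ Ioo 0 (t : ℝ), s ∈ Ioc 0 T := fun s hs => ⟨hs.1, hs.2.le.trans htT.2⟩
        rw [hΦN z hz t ht]
        have h4 := h.norm_le (δ := R) htT (hext_cont z).continuousOn
          (fun s hs => (h1 s (hsub s hs)).trans (by linarith)) (fun s hs => h1 s (hsub s hs))
        have h5 := h.data_le t htT
        linarith
    · rw [hΦN z hz t ht]
      exact h.invariant (ext z) (hext_cont z).continuousOn h1 h3 t (hpos t ht)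
  have hcontr : ContractingWith (1 / 2) (hmaps.restrict Φ S S) := by
    refine ⟨by rw [div_lt_one] <;> norm_num, LipschitzWith.of_dist_le_mul fun z w => ?_⟩
    change dist (Φ z) (Φ w) ≤ _ * dist (z : C(Icc (0 : ℝ) T, Z)) w
    rw [ContinuousMap.dist_le (by positivity)]
    intro t
    rcases eq_or_ne (t : ℝ) 0 with ht | ht
    · rw [hΦ0 z z.2 t ht, hΦ0 w w.2 t ht, dist_self]
      positivity
    · have htT := hpos t ht
      have hsub : ∀ s ∈ Ioo 0 (t : ℝ), s ∈ Ioc 0 T := fun s hs => ⟨hs.1, hs.2.le.trans htT.2⟩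
      rw [hΦN z z.2 t ht, hΦN w w.2 t ht, dist_eq_norm]
      refine (h.contract (ext z) (ext w) t (dist (z : C(Icc (0 : ℝ) T, Z)) w) htT
        (hext_cont z).continuousOn (hext_cont w).continuousOn
        (fun s hs => ((hSext z z.2).1 s (hsub s hs)).trans (by linarith))
        (fun s hs => ((hSext w w.2).1 s (hsub s hs)).trans (by linarith)) fun s hs => ?_).trans ?_
      · have hs' := hsub s hs
        rw [hext_apply z ⟨s, hs'.1.le, hs'.2⟩, hext_apply w ⟨s, hs'.1.le, hs'.2⟩, ← dist_eq_norm]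
        exact ContinuousMap.dist_apply_le_dist _
      · push_cast
        linarith
  have h0S : (0 : C(Icc (0 : ℝ) T, Z)) ∈ S :=
    ⟨fun t => by simpa using hR.le, rfl, fun t _ => h.zero_mem t⟩
  obtain ⟨z, hzS, hzfix, -⟩ := ContractingWith.exists_fixedPoint' hSclosed.isComplete hmaps hcontr
    h0S (edist_ne_top _ _)
  obtain ⟨h1, h2, h3⟩ := hSext z hzS
  refine ⟨ext z, (hext_cont z).continuousOn, h1, h2, h3, fun t ht => ?_⟩
  rw [← hΦN z hzS ⟨t, ht.1.le, ht.2⟩ ht.1.ne', hzfix]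
  exact hext_apply z ⟨t, ht.1.le, ht.2⟩

end PicardMap

end FixedPoint

/-! ### The abstract integral equations -/

section Abstract

lemma SingularFamily.duhamel_sub {X Y : Type*} [NormedAddCommGroup X] [NormedSpace ℝ X]
    [NormedAddCommGroup Y] [NormedSpace ℝ Y] {C α β M t : ℝ} {S : ℝ → X →L[ℝ] Y} {F G : ℝ → X}
    (hS : SingularFamily C α S) (hβ : β < 1) (ht : 0 < t)
    (hF : ContinuousOn F (Ioo 0 t)) (hG : ContinuousOn G (Ioo 0 t))
    (hFM : ∀ s ∈ Ioo 0 t, ‖F s‖ ≤ M * s ^ (-β)) (hGM : ∀ s ∈ Ioo 0 t, ‖G s‖ ≤ M * s ^ (-β)) :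
    duhamel S F t - duhamel S G t = duhamel S (fun s => F s - G s) t := by
  simp only [duhamel, map_sub]
  exact (intervalIntegral.integral_sub (hS.intervalIntegrable hβ ht hF hFM)
    (hS.intervalIntegrable hβ ht hG hGM)).symm

/-- The linear and bilinear operators of the integral form of the Boussinesq system. -/
structure DuhamelSystem (E G M D : Type*) [NormedAddCommGroup E] [NormedSpace ℝ E]
    [NormedAddCommGroup G] [NormedSpace ℝ G] [NormedAddCommGroup M] [NormedSpace ℝ M]
    [NormedAddCommGroup D] [NormedSpace ℝ D] where
  inertia : ℝ → M →L[ℝ] E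
  buoyancy : ℝ → G →L[ℝ] E
  transport : ℝ → D →L[ℝ] G
  tensor : E →L[ℝ] E →L[ℝ] M
  flux : G →L[ℝ] E →L[ℝ] D
  inertiaConst : ℝ
  buoyancyConst : ℝ
  transportConst : ℝ
  singularFamily_inertia : SingularFamily inertiaConst (7 / 8) inertia
  singularFamily_buoyancy : SingularFamily buoyancyConst (3 / 4) buoyancy
  singularFamily_transport : SingularFamily transportConst (7 / 8) transport

variable {E G M D : Type*} [NormedAddCommGroup E] [NormedSpace ℝ E]
  [NormedAddCommGroup G] [NormedSpace ℝ G] [NormedAddCommGroup M] [NormedSpace ℝ M]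
  [NormedAddCommGroup D] [NormedSpace ℝ D]

/-- The unweighted velocity of a weighted pair. -/
def velocity (z : ℝ → E × G) (s : ℝ) : E := s ^ (-(1 / 8 : ℝ)) • (z s).1

/-- The unweighted temperature of a weighted pair. -/
def temperature (lam : ℝ) (z : ℝ → E × G) (s : ℝ) : G := (lam * s ^ (-(3 / 8 : ℝ))) • (z s).2

section Weights

set_option linter.unusedSectionVars false

variable {z w : ℝ → E × G} {lam r δ s : ℝ}

lemma norm_velocity_le (hs : 0 < s) (hz : ‖z s‖ ≤ r) : ‖velocity z s‖ ≤ r * s ^ (-(1 / 8 : ℝ)) := by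
  rw [velocity, norm_smul, Real.norm_of_nonneg (by positivity), mul_comm]
  exact mul_le_mul_of_nonneg_right ((norm_fst_le _).trans hz) (by positivity)

lemma norm_temperature_le (hl : 0 ≤ lam) (hs : 0 < s) (hz : ‖z s‖ ≤ r) :
    ‖temperature lam z s‖ ≤ lam * r * s ^ (-(3 / 8 : ℝ)) := by
  rw [temperature, norm_smul, Real.norm_of_nonneg (by positivity),
    show lam * r * s ^ (-(3 / 8 : ℝ)) = lam * s ^ (-(3 / 8 : ℝ)) * r by ring]
  exact mul_le_mul_of_nonneg_left ((norm_snd_le _).trans hz) (by positivity)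

lemma norm_velocity_sub_le (hs : 0 < s) (h : ‖z s - w s‖ ≤ δ) :
    ‖velocity z s - velocity w s‖ ≤ δ * s ^ (-(1 / 8 : ℝ)) := by
  have : velocity z s - velocity w s = velocity (z - w) s := by
    simp only [velocity, Pi.sub_apply, Prod.fst_sub, smul_sub]
  rw [this]
  exact norm_velocity_le hs h

lemma norm_temperature_sub_le (hl : 0 ≤ lam) (hs : 0 < s) (h : ‖z s - w s‖ ≤ δ) :
    ‖temperature lam z s - temperature lam w s‖ ≤ lam * δ * s ^ (-(3 / 8 : ℝ)) := by
  have : temperature lam z s - temperature lam w s = temperature lam (z - w) s := by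
    simp only [temperature, Pi.sub_apply, Prod.snd_sub, smul_sub]
  rw [this]
  exact norm_temperature_le hl hs h

lemma continuousOn_velocity {A : Set ℝ} (hA : A ⊆ Ioi 0) (hz : ContinuousOn z A) :
    ContinuousOn (velocity z) A :=
  (continuousOn_id.rpow_const fun _ hs => Or.inl (ne_of_gt (hA hs))).smul hz.fst

lemma continuousOn_temperature {A : Set ℝ} (hA : A ⊆ Ioi 0) (hz : ContinuousOn z A) :
    ContinuousOn (temperature lam z) A :=
  (continuousOn_const.mul (continuousOn_id.rpow_const fun _ hs => Or.inl (ne_of_gt (hA hs)))).smul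
    hz.snd

lemma mul_rpow_le {x y a b p q e : ℝ} (hs : 0 < s) (hx : 0 ≤ x) (hy : 0 ≤ y)
    (h1 : x ≤ a * s ^ p) (h2 : y ≤ b * s ^ q) (he : p + q = e) : x * y ≤ a * b * s ^ e := by
  calc x * y ≤ (a * s ^ p) * (b * s ^ q) := mul_le_mul h1 h2 hy (hx.trans h1)
    _ = a * b * s ^ e := by rw [← he, Real.rpow_add hs]; ring

end Weights

namespace DuhamelSystem

variable (𝒮 : DuhamelSystem E G M D)

/-- The right-hand side of the velocity equation. -/
def velocityRHS (a : ℝ → E) (u : ℝ → E) (θ : ℝ → G) (t : ℝ) : E :=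
  a t - duhamel 𝒮.inertia (fun s => 𝒮.tensor (u s) (u s)) t + duhamel 𝒮.buoyancy θ t

/-- The right-hand side of the temperature equation. -/
def temperatureRHS (a : ℝ → G) (u : ℝ → E) (θ : ℝ → G) (t : ℝ) : G :=
  a t - duhamel 𝒮.transport (fun s => 𝒮.flux (θ s) (u s)) t

/-- The map whose fixed points are the solutions, in weighted variables. -/
def picard (lam : ℝ) (a : ℝ → E) (a' : ℝ → G) (z : ℝ → E × G) (t : ℝ) : E × G :=
  (t ^ (1 / 8 : ℝ) • 𝒮.velocityRHS a (velocity z) (temperature lam z) t,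
    (lam⁻¹ * t ^ (3 / 8 : ℝ)) • 𝒮.temperatureRHS a' (velocity z) (temperature lam z) t)

section Bounds

variable {z : ℝ → E × G} {lam r s : ℝ}

lemma norm_tensor_le (hs : 0 < s) (hz : ‖z s‖ ≤ r) :
    ‖𝒮.tensor (velocity z s) (velocity z s)‖ ≤ ‖𝒮.tensor‖ * (r * r) * s ^ (-(1 / 4 : ℝ)) := by
  refine (𝒮.tensor.le_opNorm₂ _ _).trans ?_
  rw [mul_assoc, mul_assoc]
  refine mul_le_mul_of_nonneg_left ?_ (ContinuousLinearMap.opNorm_nonneg _)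
  exact mul_rpow_le hs (norm_nonneg _) (norm_nonneg _) (norm_velocity_le hs hz)
    (norm_velocity_le hs hz) (by norm_num)

lemma norm_flux_le (hl : 0 ≤ lam) (hs : 0 < s) (hz : ‖z s‖ ≤ r) :
    ‖𝒮.flux (temperature lam z s) (velocity z s)‖
      ≤ ‖𝒮.flux‖ * (lam * r * r) * s ^ (-(1 / 2 : ℝ)) := by
  refine (𝒮.flux.le_opNorm₂ _ _).trans ?_
  rw [mul_assoc, mul_assoc]
  refine mul_le_mul_of_nonneg_left ?_ (ContinuousLinearMap.opNorm_nonneg _)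
  exact mul_rpow_le hs (norm_nonneg _) (norm_nonneg _) (norm_temperature_le hl hs hz)
    (norm_velocity_le hs hz) (by norm_num)

lemma continuousOn_tensor {A : Set ℝ} (hA : A ⊆ Ioi 0) (hz : ContinuousOn z A) :
    ContinuousOn (fun s => 𝒮.tensor (velocity z s) (velocity z s)) A :=
  (𝒮.tensor.continuous.comp_continuousOn (continuousOn_velocity hA hz)).clm_apply
    (continuousOn_velocity hA hz)

lemma continuousOn_flux {A : Set ℝ} (hA : A ⊆ Ioi 0) (hz : ContinuousOn z A) :
    ContinuousOn (fun s => 𝒮.flux (temperature lam z s) (velocity z s)) A :=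
  (𝒮.flux.continuous.comp_continuousOn (continuousOn_temperature hA hz)).clm_apply
    (continuousOn_velocity hA hz)

end Bounds

lemma Ioc_subset_Ioi {T : ℝ} : Ioc 0 T ⊆ Ioi 0 := fun _ hs => hs.1

lemma Ioo_subset_Ioi {T : ℝ} : Ioo 0 T ⊆ Ioi 0 := fun _ hs => hs.1

variable {𝒮}

lemma continuousOn_picard {lam T : ℝ} (hl : 0 ≤ lam) {a : ℝ → E} {a' : ℝ → G}
    (ha : ContinuousOn a (Ioc 0 T)) (ha' : ContinuousOn a' (Ioc 0 T)) {z : ℝ → E × G} {r : ℝ}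
    (hz : ContinuousOn z (Ioc 0 T)) (hb : ∀ t ∈ Ioc 0 T, ‖z t‖ ≤ r) :
    ContinuousOn (𝒮.picard lam a a' z) (Ioc 0 T) := by
  have h1 := 𝒮.singularFamily_inertia.continuousOn_duhamel (β := 1 / 4) (by norm_num)
    (𝒮.continuousOn_tensor Ioc_subset_Ioi hz) fun s hs => 𝒮.norm_tensor_le hs.1 (hb s hs)
  have h2 := 𝒮.singularFamily_buoyancy.continuousOn_duhamel (β := 3 / 8) (by norm_num)
    (continuousOn_temperature (lam := lam) Ioc_subset_Ioi hz)
    fun s hs => norm_temperature_le hl hs.1 (hb s hs)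
  have h3 := 𝒮.singularFamily_transport.continuousOn_duhamel (β := 1 / 2) (by norm_num)
    (𝒮.continuousOn_flux (lam := lam) Ioc_subset_Ioi hz)
    fun s hs => 𝒮.norm_flux_le hl hs.1 (hb s hs)
  have hp : ∀ e : ℝ, ContinuousOn (fun t : ℝ => t ^ e) (Ioc 0 T) := fun e =>
    continuousOn_id.rpow_const fun t ht => Or.inl (ne_of_gt ht.1)
  exact ((hp _).smul ((ha.sub h1).add h2)).prodMk
    ((continuousOn_const.mul (hp _)).smul (ha'.sub h3))

/-- The bilinear differences carry the factor 4R = 2R + 2R. The constant `lam` survives only in the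
buoyancy term: the flux is linear in θ, so its `lam` cancels against the normalization of the second
component. All powers of t cancel, which is why no smallness of t appears. -/
lemma picard_contract {lam R t δ : ℝ} (hl : 0 < lam) (ht : 0 < t)
    (h1 : 𝒮.inertiaConst * (‖𝒮.tensor‖ * (4 * R)) * betaConst (7 / 8) (1 / 4)
      + 𝒮.buoyancyConst * lam * betaConst (3 / 4) (3 / 8) ≤ 1 / 2)
    (h2 : 𝒮.transportConst * (‖𝒮.flux‖ * (4 * R)) * betaConst (7 / 8) (1 / 2) ≤ 1 / 2)
    (a : ℝ → E) (a' : ℝ → G) {z w : ℝ → E × G}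
    (hz : ContinuousOn z (Ioo 0 t)) (hw : ContinuousOn w (Ioo 0 t))
    (hzb : ∀ s ∈ Ioo 0 t, ‖z s‖ ≤ 2 * R) (hwb : ∀ s ∈ Ioo 0 t, ‖w s‖ ≤ 2 * R)
    (hδ : ∀ s ∈ Ioo 0 t, ‖z s - w s‖ ≤ δ) :
    ‖𝒮.picard lam a a' z t - 𝒮.picard lam a a' w t‖ ≤ δ / 2 := by
  have hδ0 : 0 ≤ δ := (norm_nonneg _).trans (hδ (t / 2) ⟨by linarith, by linarith⟩)
  have e1 := 𝒮.singularFamily_inertia.duhamel_sub (β := 1 / 4) (by norm_num) ht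
    (𝒮.continuousOn_tensor Ioo_subset_Ioi hz) (𝒮.continuousOn_tensor Ioo_subset_Ioi hw)
    (fun s hs => 𝒮.norm_tensor_le hs.1 (hzb s hs)) (fun s hs => 𝒮.norm_tensor_le hs.1 (hwb s hs))
  have e2 := 𝒮.singularFamily_buoyancy.duhamel_sub (β := 3 / 8) (by norm_num) ht
    (continuousOn_temperature (lam := lam) Ioo_subset_Ioi hz)
    (continuousOn_temperature (lam := lam) Ioo_subset_Ioi hw)
    (fun s hs => norm_temperature_le hl.le hs.1 (hzb s hs))
    (fun s hs => norm_temperature_le hl.le hs.1 (hwb s hs))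
  have e3 := 𝒮.singularFamily_transport.duhamel_sub (β := 1 / 2) (by norm_num) ht
    (𝒮.continuousOn_flux (lam := lam) Ioo_subset_Ioi hz)
    (𝒮.continuousOn_flux (lam := lam) Ioo_subset_Ioi hw)
    (fun s hs => 𝒮.norm_flux_le hl.le hs.1 (hzb s hs))
    (fun s hs => 𝒮.norm_flux_le hl.le hs.1 (hwb s hs))
  -- Polarization: B(z, z) - B(w, w) = B(z - w, z) + B(w, z - w).
  have d1 : ∀ s ∈ Ioo 0 t, ‖𝒮.tensor (velocity z s) (velocity z s) -
      𝒮.tensor (velocity w s) (velocity w s)‖ ≤ ‖𝒮.tensor‖ * (4 * R) * δ * s ^ (-(1 / 4 : ℝ)) := by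
    intro s hs
    have : 𝒮.tensor (velocity z s) (velocity z s) - 𝒮.tensor (velocity w s) (velocity w s) =
        𝒮.tensor (velocity z s - velocity w s) (velocity z s) +
          𝒮.tensor (velocity w s) (velocity z s - velocity w s) := by
      simp only [map_sub, sub_apply]; abel
    rw [this]
    have i1 := mul_rpow_le (e := -(1 / 4)) hs.1 (norm_nonneg _) (norm_nonneg _)
      (norm_velocity_sub_le hs.1 (hδ s hs)) (norm_velocity_le hs.1 (hzb s hs)) (by norm_num)
    have i2 := mul_rpow_le (e := -(1 / 4)) hs.1 (norm_nonneg _) (norm_nonneg _)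
      (norm_velocity_le hs.1 (hwb s hs)) (norm_velocity_sub_le hs.1 (hδ s hs)) (by norm_num)
    refine (norm_add_le _ _).trans ?_
    have j1 := 𝒮.tensor.le_opNorm₂ (velocity z s - velocity w s) (velocity z s)
    have j2 := 𝒮.tensor.le_opNorm₂ (velocity w s) (velocity z s - velocity w s)
    rw [mul_assoc] at j1 j2
    have k1 := j1.trans (mul_le_mul_of_nonneg_left i1 (ContinuousLinearMap.opNorm_nonneg _))
    have k2 := j2.trans (mul_le_mul_of_nonneg_left i2 (ContinuousLinearMap.opNorm_nonneg _))
    linarith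
  have d3 : ∀ s ∈ Ioo 0 t, ‖𝒮.flux (temperature lam z s) (velocity z s) -
      𝒮.flux (temperature lam w s) (velocity w s)‖
        ≤ lam * (‖𝒮.flux‖ * (4 * R)) * δ * s ^ (-(1 / 2 : ℝ)) := by
    intro s hs
    have : 𝒮.flux (temperature lam z s) (velocity z s) -
        𝒮.flux (temperature lam w s) (velocity w s) =
        𝒮.flux (temperature lam z s - temperature lam w s) (velocity z s) +
          𝒮.flux (temperature lam w s) (velocity z s - velocity w s) := by
      simp only [map_sub, sub_apply]; abel
    rw [this]
    have i1 := mul_rpow_le (e := -(1 / 2)) hs.1 (norm_nonneg _) (norm_nonneg _)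
      (norm_temperature_sub_le hl.le hs.1 (hδ s hs)) (norm_velocity_le hs.1 (hzb s hs))
      (by norm_num)
    have i2 := mul_rpow_le (e := -(1 / 2)) hs.1 (norm_nonneg _) (norm_nonneg _)
      (norm_temperature_le hl.le hs.1 (hwb s hs)) (norm_velocity_sub_le hs.1 (hδ s hs))
      (by norm_num)
    refine (norm_add_le _ _).trans ?_
    have j1 := 𝒮.flux.le_opNorm₂ (temperature lam z s - temperature lam w s) (velocity z s)
    have j2 := 𝒮.flux.le_opNorm₂ (temperature lam w s) (velocity z s - velocity w s)
    rw [mul_assoc] at j1 j2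
    have k1 := j1.trans (mul_le_mul_of_nonneg_left i1 (ContinuousLinearMap.opNorm_nonneg _))
    have k2 := j2.trans (mul_le_mul_of_nonneg_left i2 (ContinuousLinearMap.opNorm_nonneg _))
    linarith
  have n1 := 𝒮.singularFamily_inertia.norm_duhamel_le (β := 1 / 4) (by norm_num) ht d1
  have n2 := 𝒮.singularFamily_buoyancy.norm_duhamel_le (β := 3 / 8) (by norm_num) ht
    fun s hs => norm_temperature_sub_le hl.le hs.1 (hδ s hs)
  have n3 := 𝒮.singularFamily_transport.norm_duhamel_le (β := 1 / 2) (by norm_num) ht d3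
  -- The Beta exponents reproduce the weights -1/8 for velocity, twice, and -3/8 for temperature.
  rw [← e1, show (1 - 7 / 8 - 1 / 4 : ℝ) = -(1 / 8) by norm_num] at n1
  rw [← e2, show (1 - 3 / 4 - 3 / 8 : ℝ) = -(1 / 8) by norm_num] at n2
  rw [← e3, show (1 - 7 / 8 - 1 / 2 : ℝ) = -(3 / 8) by norm_num] at n3
  rw [Prod.norm_def]
  have ht8 : 0 ≤ t ^ (1 / 8 : ℝ) := by positivity
  have ht38 : 0 ≤ lam⁻¹ * t ^ (3 / 8 : ℝ) := by positivity
  refine max_le ?_ ?_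
  · have : (𝒮.picard lam a a' z t - 𝒮.picard lam a a' w t).1 = t ^ (1 / 8 : ℝ) •
        (-(duhamel 𝒮.inertia (fun s => 𝒮.tensor (velocity z s) (velocity z s)) t -
          duhamel 𝒮.inertia (fun s => 𝒮.tensor (velocity w s) (velocity w s)) t) +
        (duhamel 𝒮.buoyancy (temperature lam z) t - duhamel 𝒮.buoyancy (temperature lam w) t)) := by
      simp only [picard, velocityRHS, Prod.fst_sub, ← smul_sub]
      congr 1
      abel
    rw [this, norm_smul, Real.norm_of_nonneg ht8]
    calc _ ≤ t ^ (1 / 8 : ℝ) * (_ + _) := by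
          refine mul_le_mul_of_nonneg_left ((norm_add_le _ _).trans ?_) ht8
          exact add_le_add ((norm_neg _).trans_le n1) n2
      _ = (𝒮.inertiaConst * (‖𝒮.tensor‖ * (4 * R)) * betaConst (7 / 8) (1 / 4)
            + 𝒮.buoyancyConst * lam * betaConst (3 / 4) (3 / 8)) * δ *
              (t ^ (1 / 8 : ℝ) * t ^ (-(1 / 8) : ℝ)) := by
          ring
      _ ≤ 1 / 2 * δ := by
          rw [← Real.rpow_add ht, add_neg_cancel, Real.rpow_zero, mul_one]
          exact mul_le_mul_of_nonneg_right h1 hδ0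
      _ = δ / 2 := by ring
  · have : (𝒮.picard lam a a' z t - 𝒮.picard lam a a' w t).2 = -((lam⁻¹ * t ^ (3 / 8 : ℝ)) •
        (duhamel 𝒮.transport (fun s => 𝒮.flux (temperature lam z s) (velocity z s)) t -
          duhamel 𝒮.transport (fun s => 𝒮.flux (temperature lam w s) (velocity w s)) t)) := by
      simp only [picard, temperatureRHS, Prod.snd_sub, ← smul_sub, ← smul_neg]
      congr 1
      abel
    rw [this, norm_neg, norm_smul, Real.norm_of_nonneg ht38]
    calc _ ≤ lam⁻¹ * t ^ (3 / 8 : ℝ) * _ := mul_le_mul_of_nonneg_left n3 ht38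
      _ = (𝒮.transportConst * (‖𝒮.flux‖ * (4 * R)) * betaConst (7 / 8) (1 / 2)) * δ *
              (lam⁻¹ * lam) * (t ^ (3 / 8 : ℝ) * t ^ (-(3 / 8) : ℝ)) := by
          ring
      _ ≤ 1 / 2 * δ := by
          rw [← Real.rpow_add ht, add_neg_cancel, Real.rpow_zero, mul_one,
            inv_mul_cancel₀ hl.ne', mul_one]
          exact mul_le_mul_of_nonneg_right h2 hδ0
      _ = δ / 2 := by ring

end DuhamelSystem

end Abstract

/-! ### Exponents -/

section Exponents

/-- Reduces the relation to real arithmetic; exponents equal to ⊤ are included, since both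
`⊤.toReal` and the inverse of 0 are 0. -/
lemma holderTriple_of_toReal {p q r : ℝ≥0∞} (hp : 1 ≤ p) (hq : 1 ≤ q) (hr : 1 ≤ r)
    (h : p.toReal⁻¹ + q.toReal⁻¹ = r.toReal⁻¹) : p.HolderTriple q r := by
  refine ⟨?_⟩
  have hz : ∀ {a : ℝ≥0∞}, 1 ≤ a → a⁻¹ ≠ ⊤ := fun ha =>
    ENNReal.inv_ne_top.2 (zero_lt_one.trans_le ha).ne'
  rw [← ENNReal.toReal_eq_toReal_iff' (ENNReal.add_ne_top.2 ⟨hz hp, hz hq⟩) (hz hr),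
    ENNReal.toReal_add (hz hp) (hz hq)]
  simpa using h

instance fact_one_le_four : Fact ((1 : ℝ≥0∞) ≤ 4) := ⟨by norm_num⟩

instance fact_one_le_four_thirds : Fact ((1 : ℝ≥0∞) ≤ 4 / 3) :=
  ⟨by rw [ENNReal.le_div_iff_mul_le] <;> norm_num⟩

instance fact_one_le_three_halves : Fact ((1 : ℝ≥0∞) ≤ 3 / 2) :=
  ⟨by rw [ENNReal.le_div_iff_mul_le] <;> norm_num⟩

instance fact_one_le_six_fifths : Fact ((1 : ℝ≥0∞) ≤ 6 / 5) :=
  ⟨by rw [ENNReal.le_div_iff_mul_le] <;> norm_num⟩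

instance fact_one_le_twelve_sevenths : Fact ((1 : ℝ≥0∞) ≤ 12 / 7) :=
  ⟨by rw [ENNReal.le_div_iff_mul_le] <;> norm_num⟩

instance fact_one_le_twelve_elevenths : Fact ((1 : ℝ≥0∞) ≤ 12 / 11) :=
  ⟨by rw [ENNReal.le_div_iff_mul_le] <;> norm_num⟩

instance holderTriple_four_four : (4 : ℝ≥0∞).HolderTriple 4 2 :=
  holderTriple_of_toReal Fact.out Fact.out Fact.out (by norm_num)

instance holderTriple_four_thirds_four : (4 / 3 : ℝ≥0∞).HolderTriple 4 1 :=
  holderTriple_of_toReal Fact.out Fact.out Fact.out (by norm_num)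

instance holderTriple_three_halves_three : (3 / 2 : ℝ≥0∞).HolderTriple 3 1 :=
  holderTriple_of_toReal Fact.out Fact.out Fact.out (by norm_num)

/-- A kernel family with scaling exponent a, measured in L^r, gives an operator of size τ^{-(a -
3/(2r))}. The kernel exponents below are dictated by the spaces, and a is 2 with a derivative and
3/2 without. -/
lemma youngTriple_inertia : YoungTriple (4 / 3) 2 4 :=
  ⟨Fact.out, Fact.out, Fact.out, by finiteness, by finiteness, by finiteness, by norm_num⟩

lemma youngTriple_transport : YoungTriple (4 / 3) 1 (4 / 3) :=
  ⟨Fact.out, Fact.out, Fact.out, by finiteness, by finiteness, by finiteness, by norm_num⟩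

lemma youngTriple_buoyancy : YoungTriple 2 (4 / 3) 4 :=
  ⟨Fact.out, Fact.out, Fact.out, by finiteness, by finiteness, by finiteness, by norm_num⟩

lemma youngTriple_inertia_three : YoungTriple (6 / 5) 2 3 :=
  ⟨Fact.out, Fact.out, Fact.out, by finiteness, by finiteness, by finiteness, by norm_num⟩

lemma youngTriple_buoyancy_three : YoungTriple (12 / 7) (4 / 3) 3 :=
  ⟨Fact.out, Fact.out, Fact.out, by finiteness, by finiteness, by finiteness, by norm_num⟩

lemma youngTriple_heat_velocity : YoungTriple (12 / 11) 3 4 :=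
  ⟨Fact.out, Fact.out, Fact.out, by finiteness, by finiteness, by finiteness, by norm_num⟩

lemma youngTriple_one {p : ℝ≥0∞} [hp : Fact (1 ≤ p)] (hp' : p ≠ ⊤) : YoungTriple 1 p p :=
  ⟨le_rfl, hp.out, hp.out, by finiteness, hp', hp', by simp [add_comm]⟩

lemma decayExponent_of_toReal {N : ℝ} {r : ℝ≥0∞} (h1 : 1 ≤ r) (h : 3 < N * r.toReal) :
    DecayExponent N r := ⟨h1, Or.inr h⟩

lemma decayExponent_top {N : ℝ} : DecayExponent N ⊤ := ⟨le_top, Or.inl rfl⟩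

end Exponents

/-! ### Interpolation and bounds in `L^∞` -/

section Interpolation

variable {V : Type*} [NormedAddCommGroup V]

/-- Pointwise |f|^q ≤ ‖f‖_∞^{q-p} |f|^p. No finiteness of the norms is assumed. -/
lemma eLpNorm_le_interpolation {p q : ℝ≥0∞} (hp : 1 ≤ p) (hpq : p ≤ q) (hq : q ≠ ⊤)
    {f : E3 → V} (hm : AEStronglyMeasurable f volume) : eLpNorm f q volume ≤
      eLpNorm f ⊤ volume ^ (1 - p.toReal / q.toReal) *
        eLpNorm f p volume ^ (p.toReal / q.toReal) := by
  have hp0 : p ≠ 0 := (zero_lt_one.trans_le hp).ne'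
  have hpt : p ≠ ⊤ := ne_top_of_le_ne_top hq hpq
  have hq0 : q ≠ 0 := (zero_lt_one.trans_le (hp.trans hpq)).ne'
  have hP : 0 < p.toReal := ENNReal.toReal_pos hp0 hpt
  have hQ : 0 < q.toReal := ENNReal.toReal_pos hq0 hq
  have hPQ : p.toReal ≤ q.toReal := ENNReal.toReal_mono hq hpq
  rw [eLpNorm_eq_lintegral_rpow_enorm_toReal hq0 hq, eLpNorm_eq_lintegral_rpow_enorm_toReal hp0 hpt,
    ← ENNReal.rpow_mul]
  set A := eLpNorm f ⊤ volume with hA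
  have h1 : ∫⁻ x, ‖f x‖ₑ ^ q.toReal ≤ A ^ (q.toReal - p.toReal) * ∫⁻ x, ‖f x‖ₑ ^ p.toReal := by
    rcases eq_or_ne A ⊤ with hAt | hAt
    · rcases eq_or_lt_of_le hPQ with h | h
      · rw [h]; simp
      -- As ⊤ * 0 = 0, the case of infinite supremum and zero integral must be excluded: f would
      -- vanish almost everywhere and its supremum would be 0.
      · rcases eq_or_ne (∫⁻ x, ‖f x‖ₑ ^ p.toReal) 0 with h0 | h0
        · have h2 : eLpNorm f p volume = 0 := by
            rw [eLpNorm_eq_lintegral_rpow_enorm_toReal hp0 hpt, h0,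
              ENNReal.zero_rpow_of_pos (by positivity)]
          have := (eLpNorm_eq_zero_iff hm hp0).1 h2
          rw [hA, eLpNorm_congr_ae this] at hAt
          simp at hAt
        · rw [hAt, ENNReal.top_rpow_of_pos (by linarith), ENNReal.top_mul h0]
          exact le_top
    · rw [← lintegral_const_mul' _ _ (ENNReal.rpow_ne_top_of_nonneg (by linarith) hAt)]
      have h2 : ∀ᵐ x : E3, ‖f x‖ₑ ≤ A := by
        rw [hA, eLpNorm_exponent_top]; exact ae_le_eLpNormEssSup
      refine lintegral_mono_ae ?_
      filter_upwards [h2] with x hx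
      calc ‖f x‖ₑ ^ q.toReal = ‖f x‖ₑ ^ (q.toReal - p.toReal) * ‖f x‖ₑ ^ p.toReal := by
            rw [← ENNReal.rpow_add_of_nonneg _ _ (by linarith) hP.le, sub_add_cancel]
        _ ≤ _ := by gcongr
  calc _ ≤ (A ^ (q.toReal - p.toReal) * ∫⁻ x, ‖f x‖ₑ ^ p.toReal) ^ (1 / q.toReal) := by gcongr
    _ = _ := by
        rw [ENNReal.mul_rpow_of_nonneg _ _ (by positivity), ← ENNReal.rpow_mul]
        congr 2 <;> field_simp

lemma eLpNorm_le_of_interpolation {p q : ℝ≥0∞} (hp : 1 ≤ p) (hpq : p ≤ q) (hq : q ≠ ⊤)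
    {f : E3 → V} (hf : AEStronglyMeasurable f volume) {x y η : ℝ}
    (hx : 0 ≤ x) (hy : 0 ≤ y) (hη : η = p.toReal / q.toReal)
    (h1 : eLpNorm f ⊤ volume ≤ ENNReal.ofReal x) (h2 : eLpNorm f p volume ≤ ENNReal.ofReal y) :
    eLpNorm f q volume ≤ ENNReal.ofReal (x ^ (1 - η) * y ^ η) := by
  have hη0 : 0 ≤ η := by rw [hη]; positivity
  have hη1 : η ≤ 1 := by
    rw [hη]
    exact div_le_one_of_le₀ (ENNReal.toReal_mono hq hpq) ENNReal.toReal_nonneg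
  refine (eLpNorm_le_interpolation hp hpq hq hf).trans ?_
  rw [← hη, ENNReal.ofReal_mul (by positivity), ← ENNReal.ofReal_rpow_of_nonneg hx (by linarith),
    ← ENNReal.ofReal_rpow_of_nonneg hy hη0]
  gcongr

/-- A limit in L^p is an almost everywhere limit along a subsequence. L^∞ bounds can therefore be
kept through an iteration that converges only in L⁴ and L^{4/3}. -/
lemma isClosed_eLpNorm_top_le {p : ℝ≥0∞} [Fact (1 ≤ p)] (c : ℝ≥0∞) :
    IsClosed {f : Lp V p (volume : Measure E3) | eLpNorm f ⊤ volume ≤ c} := by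
  refine IsSeqClosed.isClosed fun f g hf hfg => ?_
  obtain ⟨ns, -, hns⟩ := (tendstoInMeasure_of_tendsto_Lp hfg).exists_seq_tendsto_ae
  have hall : ∀ᵐ x : E3, ∀ n, ‖f n x‖ₑ ≤ c := ae_all_iff.2 fun n => by
    have h1 : ∀ᵐ x : E3, ‖f n x‖ₑ ≤ eLpNormEssSup (f n) volume := ae_le_eLpNormEssSup
    filter_upwards [h1] with x hx
    exact hx.trans ((eLpNorm_exponent_top (f := f n)).symm.trans_le (hf n))
  change eLpNorm g ⊤ volume ≤ c
  rw [eLpNorm_exponent_top]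
  refine eLpNormEssSup_le_of_ae_enorm_bound ?_
  filter_upwards [hns, hall] with x hx hx'
  exact le_of_tendsto' hx.enorm fun n => hx' _

end Interpolation

/-! ### Essential suprema of convolutions and of Duhamel integrals -/

section TopBounds

variable {V W : Type*} [NormedAddCommGroup V] [NormedSpace ℝ V]
  [NormedAddCommGroup W] [NormedSpace ℝ W]

lemma KernelFamily.norm_kconv_le {a N : ℝ} {K : ℝ → E3 → V →L[ℝ] W} (hK : KernelFamily a N K)
    {r q : ℝ≥0∞} (hr : DecayExponent N r) [r.HolderConjugate q] {τ e : ℝ} (hτ : 0 < τ)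
    (he : e = a - 3 / (2 * r.toReal)) {f : E3 → V} (hf : AEStronglyMeasurable f volume)
    {y : ℝ} (hy : 0 ≤ y) (hfy : eLpNorm f q volume ≤ ENNReal.ofReal y) (x : E3) :
    ‖kconv (K τ) f x‖ ≤ (eLpNorm (K 1) r volume).toReal * y * τ ^ (-e) := by
  have h1 := (enorm_kconv_le_of_holder (hK.continuous hτ).aestronglyMeasurable hf r q x).trans
    (mul_le_mul_right hfy _)
  have h2 : eLpNorm (K τ) r volume * ENNReal.ofReal y
      = ENNReal.ofReal ((eLpNorm (K 1) r volume).toReal * y * τ ^ (-e)) := by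
    rw [hK.eLpNorm_eq r hτ, ← ENNReal.ofReal_toReal (hK.memLp hr one_pos).2.ne,
      ← ENNReal.ofReal_mul (by positivity), ← ENNReal.ofReal_mul (by positivity), he,
      ENNReal.toReal_ofReal ENNReal.toReal_nonneg]
    congr 1
    ring_nf
  rw [h2, ← ofReal_norm] at h1
  exact (ENNReal.ofReal_le_ofReal_iff (by positivity)).1 h1

lemma eLpNorm_top_le_of_ae_eq_integral {α β c t : ℝ} (hα : α < 1) (hβ : β < 1) (ht : 0 < t)
    {f : E3 → W} {g : ℝ → E3 → W} (hf : ∀ᵐ x : E3, f x = ∫ s in (0 : ℝ)..t, g s x)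
    (hg : ∀ s ∈ Ioo 0 t, ∀ x, ‖g s x‖ ≤ c * ((t - s) ^ (-α) * s ^ (-β))) :
    eLpNorm f ⊤ volume ≤ ENNReal.ofReal (c * betaConst α β * t ^ (1 - α - β)) := by
  rw [eLpNorm_exponent_top]
  refine eLpNormEssSup_le_of_ae_enorm_bound ?_
  filter_upwards [hf] with x hx
  rw [hx, ← ofReal_norm]
  refine ENNReal.ofReal_le_ofReal ?_
  rw [mul_assoc, mul_comm (betaConst α β), ← integral_beta_scaled ht,
    ← intervalIntegral.integral_const_mul]
  refine intervalIntegral.norm_integral_le_of_norm_le ht.le ?_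
    ((intervalIntegrable_beta_scaled hα hβ ht).const_mul c)
  have : ∀ᵐ s : ℝ, s ≠ t := by simp [ae_iff]
  filter_upwards [this] with s h1 h2
  exact hg s ⟨h2.1, lt_of_le_of_ne h2.2 h1⟩ x

end TopBounds

/-! ### The operators of the Boussinesq system -/

/-- Velocities in `L⁴`. -/
abbrev VelocityL4 : Type := Lp E3 4 (volume : Measure E3)

/-- Temperatures in `L^{4/3}`. -/
abbrev TemperatureL43 : Type := Lp ℝ (4 / 3) (volume : Measure E3)

/-- The product `u ⊗ v` of fields in `L⁴`. -/
def tensorLp : VelocityL4 →L[ℝ] VelocityL4 →L[ℝ] Lp Mat 2 (volume : Measure E3) :=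
  tensorL.holderL volume 4 4 2

/-- Multiplication of a vector by a scalar, as a bounded bilinear map. -/
def scaleL : ℝ →L[ℝ] E3 →L[ℝ] E3 := ContinuousLinearMap.lsmul ℝ ℝ

/-- The product `θ u`. -/
def fluxLp : TemperatureL43 →L[ℝ] VelocityL4 →L[ℝ] Lp E3 1 (volume : Measure E3) :=
  scaleL.holderL volume (4 / 3) 4 1

lemma tensorLp_ae_eq (u v : VelocityL4) :
    tensorLp u v =ᵐ[volume] fun x => tensorL (u x) (v x) := tensorL.coeFn_holder u v

lemma fluxLp_ae_eq (θ : TemperatureL43) (u : VelocityL4) :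
    fluxLp θ u =ᵐ[volume] fun x => θ x • u x := scaleL.coeFn_holder θ u

/-- The Boussinesq system in `L⁴ × L^{4/3}`. -/
def system : DuhamelSystem VelocityL4 TemperatureL43 (Lp Mat 2 (volume : Measure E3))
    (Lp E3 1 (volume : Measure E3)) where
  inertia := convOp lerayDivKernel youngTriple_inertia
  buoyancy := convOp buoyancyKernel youngTriple_buoyancy
  transport := convOp divKernel youngTriple_transport
  tensor := tensorLp
  flux := fluxLp
  inertiaConst := (eLpNorm (lerayDivKernel 1) (4 / 3) volume).toReal
  buoyancyConst := (eLpNorm (buoyancyKernel 1) 2 volume).toReal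
  transportConst := (eLpNorm (divKernel 1) (4 / 3) volume).toReal
  singularFamily_inertia := kernelFamily_lerayDiv.singularFamily
    (decayExponent_of_toReal Fact.out (by norm_num)) _ (by norm_num) (by norm_num)
  singularFamily_buoyancy := kernelFamily_buoyancy.singularFamily
    (decayExponent_of_toReal Fact.out (by norm_num)) _ (by norm_num) (by norm_num)
  singularFamily_transport := kernelFamily_div.singularFamily
    (decayExponent_of_toReal Fact.out (by norm_num)) _ (by norm_num) (by norm_num)

/-! ### Weighted estimates of the Duhamel terms -/

section Pointwise

variable {u : ℝ → VelocityL4} {θ : ℝ → TemperatureL43} {t m n : ℝ}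

/-- A path of velocities and temperatures on `(0,t)` in the critical weighted classes. -/
structure KatoBound (t m n : ℝ) (u : ℝ → VelocityL4) (θ : ℝ → TemperatureL43) : Prop where
  time_pos : 0 < t
  continuousOn_velocity : ContinuousOn u (Ioo 0 t)
  continuousOn_temperature : ContinuousOn θ (Ioo 0 t)
  norm_velocity_le : ∀ s ∈ Ioo 0 t, ‖u s‖ ≤ m * s ^ (-(1 / 8 : ℝ))
  norm_temperature_le : ∀ s ∈ Ioo 0 t, ‖θ s‖ ≤ n * s ^ (-(3 / 8 : ℝ))

namespace KatoBound

lemma continuousOn_tensor (h : KatoBound t m n u θ) :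
    ContinuousOn (fun s => tensorLp (u s) (u s)) (Ioo 0 t) :=
  (tensorLp.continuous.comp_continuousOn h.continuousOn_velocity).clm_apply h.continuousOn_velocity

lemma continuousOn_flux (h : KatoBound t m n u θ) :
    ContinuousOn (fun s => fluxLp (θ s) (u s)) (Ioo 0 t) :=
  (fluxLp.continuous.comp_continuousOn h.continuousOn_temperature).clm_apply
    h.continuousOn_velocity

lemma norm_tensor_le (h : KatoBound t m n u θ) : ∀ s ∈ Ioo 0 t,
    ‖tensorLp (u s) (u s)‖ ≤ ‖tensorLp‖ * (m * m) * s ^ (-(1 / 4 : ℝ)) := by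
  intro s hs
  refine (tensorLp.le_opNorm₂ _ _).trans ?_
  rw [mul_assoc, mul_assoc]
  refine mul_le_mul_of_nonneg_left ?_ (ContinuousLinearMap.opNorm_nonneg _)
  exact mul_rpow_le hs.1 (norm_nonneg _) (norm_nonneg _) (h.norm_velocity_le s hs)
    (h.norm_velocity_le s hs) (by norm_num)

lemma norm_flux_le (h : KatoBound t m n u θ) : ∀ s ∈ Ioo 0 t,
    ‖fluxLp (θ s) (u s)‖ ≤ ‖fluxLp‖ * (n * m) * s ^ (-(1 / 2 : ℝ)) := by
  intro s hs
  refine (fluxLp.le_opNorm₂ _ _).trans ?_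
  rw [mul_assoc, mul_assoc]
  refine mul_le_mul_of_nonneg_left ?_ (ContinuousLinearMap.opNorm_nonneg _)
  exact mul_rpow_le hs.1 (norm_nonneg _) (norm_nonneg _) (h.norm_temperature_le s hs)
    (h.norm_velocity_le s hs) (by norm_num)

/-- The target exponent p is left free: realizations of the same term in different L^p spaces are
identified through one and the same pointwise integral. -/
lemma inertia_ae_eq (h : KatoBound t m n u θ) {r p : ℝ≥0∞} [Fact (1 ≤ r)] [Fact (1 ≤ p)]
    (hY : YoungTriple r 2 p) (hr : DecayExponent 4 r) (hα : 2 - 3 / (2 * r.toReal) < 1) :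
    ∀ᵐ x : E3, IntervalIntegrable
        (fun s => kconv (lerayDivKernel (t - s)) (tensorLp (u s) (u s)) x) volume 0 t ∧
      duhamel (convOp lerayDivKernel hY) (fun s => tensorLp (u s) (u s)) t x =
        ∫ s in (0 : ℝ)..t, kconv (lerayDivKernel (t - s)) (tensorLp (u s) (u s)) x :=
  kernelFamily_lerayDiv.duhamel_ae_eq hr hY rfl hα (r' := 2)
    (decayExponent_of_toReal Fact.out (by norm_num)) (by norm_num) h.time_pos
    h.continuousOn_tensor h.norm_tensor_le

lemma buoyancy_ae_eq (h : KatoBound t m n u θ) {r p : ℝ≥0∞} [Fact (1 ≤ r)] [Fact (1 ≤ p)]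
    (hY : YoungTriple r (4 / 3) p) (hr : DecayExponent 3 r)
    (hα : 3 / 2 - 3 / (2 * r.toReal) < 1) :
    ∀ᵐ x : E3, IntervalIntegrable
        (fun s => kconv (buoyancyKernel (t - s)) (θ s) x) volume 0 t ∧
      duhamel (convOp buoyancyKernel hY) θ t x =
        ∫ s in (0 : ℝ)..t, kconv (buoyancyKernel (t - s)) (θ s) x :=
  kernelFamily_buoyancy.duhamel_ae_eq hr hY rfl hα (r' := 4)
    (decayExponent_of_toReal Fact.out (by norm_num)) (by norm_num) h.time_pos
    h.continuousOn_temperature h.norm_temperature_le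

lemma transport_ae_eq (h : KatoBound t m n u θ) {r p : ℝ≥0∞} [Fact (1 ≤ r)] [Fact (1 ≤ p)]
    (hY : YoungTriple r 1 p) (hr : DecayExponent 4 r) (hα : 2 - 3 / (2 * r.toReal) < 1) :
    ∀ᵐ x : E3, IntervalIntegrable
        (fun s => kconv (divKernel (t - s)) (fluxLp (θ s) (u s)) x) volume 0 t ∧
      duhamel (convOp divKernel hY) (fun s => fluxLp (θ s) (u s)) t x =
        ∫ s in (0 : ℝ)..t, kconv (divKernel (t - s)) (fluxLp (θ s) (u s)) x :=
  kernelFamily_div.duhamel_ae_eq hr hY rfl hα (r' := ⊤) decayExponent_top (by norm_num) h.time_pos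
    h.continuousOn_flux h.norm_flux_le

end KatoBound

lemma eLpNorm_tensorLp_le (u v : VelocityL4) {x y : ℝ} (hx : 0 ≤ x)
    (h1 : eLpNorm u ⊤ volume ≤ ENNReal.ofReal x) (h2 : ‖v‖ ≤ y) :
    eLpNorm (tensorLp u v) 4 volume ≤ ENNReal.ofReal (x * y) := by
  rw [eLpNorm_congr_ae (tensorLp_ae_eq u v), ENNReal.ofReal_mul hx]
  refine (eLpNorm_le_eLpNorm_top_mul_eLpNorm 4 u (Lp.memLp v).1 (fun a b => tensorL a b) 1
    (Eventually.of_forall fun z => ?_)).trans ?_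
  · rw [one_mul]
    exact norm_tensorL_le (u z) (v z)
  · rw [ENNReal.coe_one, one_mul]
    refine mul_le_mul' h1 ?_
    rw [← ENNReal.ofReal_toReal (Lp.eLpNorm_ne_top v)]
    exact ENNReal.ofReal_le_ofReal h2

lemma eLpNorm_fluxLp_le (θ : TemperatureL43) (v : VelocityL4) {x y : ℝ} (hx : 0 ≤ x)
    (h1 : eLpNorm θ ⊤ volume ≤ ENNReal.ofReal x) (h2 : ‖v‖ ≤ y) :
    eLpNorm (fluxLp θ v) 4 volume ≤ ENNReal.ofReal (x * y) := by
  rw [eLpNorm_congr_ae (fluxLp_ae_eq θ v), ENNReal.ofReal_mul hx]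
  refine (eLpNorm_le_eLpNorm_top_mul_eLpNorm 4 θ (Lp.memLp v).1 (fun a b => a • b) 1
    (Eventually.of_forall fun z => ?_)).trans ?_
  · rw [one_mul]
    exact (norm_smul (θ z) (v z)).le
  · rw [ENNReal.coe_one, one_mul]
    refine mul_le_mul' h1 ?_
    rw [← ENNReal.ofReal_toReal (Lp.eLpNorm_ne_top v)]
    exact ENNReal.ofReal_le_ofReal h2

lemma Lp.eLpNorm_le_ofReal {V : Type*} [NormedAddCommGroup V] {p : ℝ≥0∞}
    {f : Lp V p (volume : Measure E3)} {y : ℝ} (h : ‖f‖ ≤ y) :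
    eLpNorm f p volume ≤ ENNReal.ofReal y := by
  rw [← ENNReal.ofReal_toReal (Lp.eLpNorm_ne_top f)]
  exact ENNReal.ofReal_le_ofReal h

/-- The nonlinear terms in `L^∞`. -/
lemma exists_inertia_top_bound : ∃ c : ℝ, 0 ≤ c ∧ ∀ {t m n A : ℝ} {u : ℝ → VelocityL4}
    {θ : ℝ → TemperatureL43}, KatoBound t m n u θ → 0 ≤ m → 0 ≤ A →
    (∀ s ∈ Ioo 0 t, eLpNorm (u s) ⊤ volume ≤ ENNReal.ofReal (A * s ^ (-(1 / 2 : ℝ)))) →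
    eLpNorm (duhamel system.inertia (fun s => system.tensor (u s) (u s)) t : VelocityL4) ⊤ volume
      ≤ ENNReal.ofReal (c * (A * m) * t ^ (-(1 / 2 : ℝ))) := by
  refine ⟨(eLpNorm (lerayDivKernel 1) (4 / 3) volume).toReal * betaConst (7 / 8) (5 / 8),
    mul_nonneg ENNReal.toReal_nonneg (betaConst_nonneg _ _), ?_⟩
  intro t m n A u θ h hm hA hu
  have hae := h.inertia_ae_eq youngTriple_inertia
    (decayExponent_of_toReal Fact.out (by norm_num)) (by norm_num)
  have key := eLpNorm_top_le_of_ae_eq_integral (α := 7 / 8) (β := 5 / 8)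
    (c := (eLpNorm (lerayDivKernel 1) (4 / 3) volume).toReal * (A * m)) (by norm_num) (by norm_num)
    h.time_pos (hae.mono fun x hx => hx.2) fun s hs x => by
      have hs0 := hs.1
      have hτ : 0 < t - s := sub_pos.2 hs.2
      -- One factor is taken in L^∞ and the other in L⁴, so u ⊗ u lies in L⁴ with weight
      -- s^{-1/2-1/8} = s^{-5/8}. The kernel is taken in the conjugate space L^{4/3}, of size
      -- (t-s)^{-7/8}.
      have h1 := eLpNorm_tensorLp_le (u s) (u s) (by positivity) (hu s hs)
        (h.norm_velocity_le s hs)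
      refine (kernelFamily_lerayDiv.norm_kconv_le (r := 4 / 3) (q := 4) (e := 7 / 8)
        (decayExponent_of_toReal Fact.out (by norm_num)) hτ (by norm_num) (Lp.memLp _).1
        (by positivity) h1 x).trans (le_of_eq ?_)
      rw [show (-(5 / 8) : ℝ) = -(1 / 2) + -(1 / 8) by norm_num, Real.rpow_add hs0]
      ring
  refine key.trans (le_of_eq ?_)
  rw [show (1 - 7 / 8 - 5 / 8 : ℝ) = -(1 / 2) by norm_num]
  congr 1
  ring

/-- Neither bound on θ suffices alone, since s^{-3/2} is not integrable at 0 and the kernel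
conjugate to L^{4/3} has size (t-s)^{-9/8}. Interpolating θ into L² gives s^{-3/4} against a kernel
of size (t-s)^{-3/4}. The result is sublinear in B. -/
lemma exists_buoyancy_top_bound : ∃ c : ℝ, 0 ≤ c ∧ ∀ {t m n B : ℝ} {u : ℝ → VelocityL4}
    {θ : ℝ → TemperatureL43}, KatoBound t m n u θ → 0 ≤ n → 0 ≤ B →
    (∀ s ∈ Ioo 0 t, eLpNorm (θ s) ⊤ volume ≤ ENNReal.ofReal (B * s ^ (-(3 / 2 : ℝ)))) →
    eLpNorm (duhamel system.buoyancy θ t : VelocityL4) ⊤ volume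
      ≤ ENNReal.ofReal (c * (B ^ (1 / 3 : ℝ) * n ^ (2 / 3 : ℝ)) * t ^ (-(1 / 2 : ℝ))) := by
  refine ⟨(eLpNorm (buoyancyKernel 1) 2 volume).toReal * betaConst (3 / 4) (3 / 4),
    mul_nonneg ENNReal.toReal_nonneg (betaConst_nonneg _ _), ?_⟩
  intro t m n B u θ h hn hB hθ
  have hae := h.buoyancy_ae_eq youngTriple_buoyancy
    (decayExponent_of_toReal Fact.out (by norm_num)) (by norm_num)
  have key := eLpNorm_top_le_of_ae_eq_integral (α := 3 / 4) (β := 3 / 4)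
    (c := (eLpNorm (buoyancyKernel 1) 2 volume).toReal * (B ^ (1 / 3 : ℝ) * n ^ (2 / 3 : ℝ)))
    (by norm_num) (by norm_num) h.time_pos (hae.mono fun x hx => hx.2) fun s hs x => by
      have hs0 := hs.1
      have hτ : 0 < t - s := sub_pos.2 hs.2
      have h1 := eLpNorm_le_of_interpolation (q := 2) (η := 2 / 3) Fact.out
        (by rw [ENNReal.div_le_iff_le_mul] <;> norm_num) (by norm_num)
        (Lp.memLp (θ s)).1 (by positivity) (by positivity) (by norm_num) (hθ s hs)
        (Lp.eLpNorm_le_ofReal (h.norm_temperature_le s hs))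
      refine (kernelFamily_buoyancy.norm_kconv_le (r := 2) (q := 2) (e := 3 / 4)
        (decayExponent_of_toReal Fact.out (by norm_num)) hτ (by norm_num) (Lp.memLp _).1
        (by positivity) h1 x).trans (le_of_eq ?_)
      rw [Real.mul_rpow hB (by positivity), Real.mul_rpow hn (by positivity),
        ← Real.rpow_mul hs0.le, ← Real.rpow_mul hs0.le,
        show (1 - 2 / 3 : ℝ) = 1 / 3 by norm_num,
        show (-(3 / 4) : ℝ) = -(3 / 2) * (1 / 3) + -(3 / 8) * (2 / 3) by norm_num,
        Real.rpow_add hs0]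
      norm_num
      ring
  refine key.trans (le_of_eq ?_)
  rw [show (1 - 3 / 4 - 3 / 4 : ℝ) = -(1 / 2) by norm_num]
  congr 1
  ring

/-- No single estimate covers (0, t): the L^∞ bound on θ is too singular at s = 0, and the estimate
from L¹ is too singular at s = t. The integral is cut at t/2. On each half the offending factor, to
the power -9/8, is taken at a distance at least t/2 from its singularity, and both halves then share
the density (t-s)^{-7/8} s^{-1/2}. -/
lemma exists_transport_top_bound : ∃ c : ℝ, 0 ≤ c ∧ ∀ {t m n B : ℝ} {u : ℝ → VelocityL4}
    {θ : ℝ → TemperatureL43}, KatoBound t m n u θ → 0 ≤ m → 0 ≤ n → 0 ≤ B →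
    (∀ s ∈ Ioo 0 t, eLpNorm (θ s) ⊤ volume ≤ ENNReal.ofReal (B * s ^ (-(3 / 2 : ℝ)))) →
    eLpNorm (duhamel system.transport (fun s => system.flux (θ s) (u s)) t : TemperatureL43) ⊤ volume
      ≤ ENNReal.ofReal (c * (m * (n + B)) * t ^ (-(3 / 2 : ℝ))) := by
  set C₁ := (eLpNorm (divKernel 1) ⊤ volume).toReal * ‖fluxLp‖ with hC₁
  set C₂ := (eLpNorm (divKernel 1) (4 / 3) volume).toReal with hC₂
  have hC₁0 : 0 ≤ C₁ := mul_nonneg ENNReal.toReal_nonneg (ContinuousLinearMap.opNorm_nonneg _)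
  have hC₂0 : 0 ≤ C₂ := ENNReal.toReal_nonneg
  refine ⟨(C₁ + C₂) * 2 ^ (9 / 8 : ℝ) * betaConst (7 / 8) (1 / 2),
    mul_nonneg (by positivity) (betaConst_nonneg _ _), ?_⟩
  intro t m n B u θ h hm hn hB hθ
  have ht := h.time_pos
  have hae := h.transport_ae_eq youngTriple_transport
    (decayExponent_of_toReal Fact.out (by norm_num)) (by norm_num)
  have key := eLpNorm_top_le_of_ae_eq_integral (α := 7 / 8) (β := 1 / 2)
    (c := (C₁ + C₂) * (m * (n + B)) * (t / 2) ^ (-(9 / 8) : ℝ))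
    (by norm_num) (by norm_num) ht (hae.mono fun x hx => hx.2) fun s hs x => by
      have hs0 := hs.1
      have hτ : 0 < t - s := sub_pos.2 hs.2
      have hmono : ∀ y : ℝ, t / 2 ≤ y → y ^ (-(9 / 8) : ℝ) ≤ (t / 2) ^ (-(9 / 8) : ℝ) := fun y hy =>
        Real.rpow_le_rpow_of_nonpos (by positivity) hy (by norm_num)
      set P := (t / 2) ^ (-(9 / 8) : ℝ) with hP
      have hP0 : 0 ≤ P := by positivity
      rcases le_total s (t / 2) with hle | hle
      -- First half: θu in L¹ with weight s^{-1/2}, kernel in L^∞ of size (t-s)^{-2}, with t - s ≥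
      -- t/2.
      · have h1 := Lp.eLpNorm_le_ofReal (h.norm_flux_le s hs)
        have h0 : 0 ≤ ‖fluxLp‖ := ContinuousLinearMap.opNorm_nonneg _
        refine (kernelFamily_div.norm_kconv_le (r := ⊤) (q := 1) (e := 2)
          decayExponent_top hτ (by norm_num) (Lp.memLp _).1 (by positivity) h1 x).trans ?_
        have h2 : (t - s) ^ (-2 : ℝ) ≤ P * (t - s) ^ (-(7 / 8) : ℝ) := by
          rw [show (-2 : ℝ) = -(9 / 8) + -(7 / 8) by norm_num, Real.rpow_add hτ]
          exact mul_le_mul_of_nonneg_right (hmono _ (by linarith)) (by positivity)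
        calc _ ≤ (eLpNorm (divKernel 1) ⊤ volume).toReal *
              (‖fluxLp‖ * (n * m) * s ^ (-(1 / 2) : ℝ)) * (P * (t - s) ^ (-(7 / 8) : ℝ)) :=
              mul_le_mul_of_nonneg_left h2 (by positivity)
          _ = C₁ * (m * n) * P * ((t - s) ^ (-(7 / 8) : ℝ) * s ^ (-(1 / 2) : ℝ)) := by
              rw [hC₁]; ring
          _ ≤ _ := by
              gcongr <;> linarith
      -- Second half: θ in L^∞ and u in L⁴, so θu lies in L⁴ with weight s^{-3/2-1/8}, and s ≥ t/2;
      -- the kernel lies in L^{4/3}.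
      · have h1 := eLpNorm_fluxLp_le (θ s) (u s) (by positivity) (hθ s hs)
          (h.norm_velocity_le s hs)
        refine (kernelFamily_div.norm_kconv_le (r := 4 / 3) (q := 4) (e := 7 / 8)
          (decayExponent_of_toReal Fact.out (by norm_num)) hτ (by norm_num) (Lp.memLp _).1
          (by positivity) h1 x).trans ?_
        have h2 : s ^ (-(3 / 2) : ℝ) * s ^ (-(1 / 8) : ℝ) ≤ P * s ^ (-(1 / 2) : ℝ) := by
          rw [← Real.rpow_add hs0, show (-(3 / 2) + -(1 / 8) : ℝ) = -(9 / 8) + -(1 / 2) by norm_num,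
            Real.rpow_add hs0]
          exact mul_le_mul_of_nonneg_right (hmono _ hle) (by positivity)
        calc _ = C₂ * (m * B) * (s ^ (-(3 / 2) : ℝ) * s ^ (-(1 / 8) : ℝ)) *
                (t - s) ^ (-(7 / 8) : ℝ) := by rw [hC₂]; ring
          _ ≤ C₂ * (m * B) * (P * s ^ (-(1 / 2) : ℝ)) * (t - s) ^ (-(7 / 8) : ℝ) := by gcongr
          _ = C₂ * (m * B) * P * ((t - s) ^ (-(7 / 8) : ℝ) * s ^ (-(1 / 2) : ℝ)) := by ring
          _ ≤ _ := by
              gcongr <;> linarith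
  refine key.trans (le_of_eq ?_)
  have h3 : (t / 2) ^ (-(9 / 8) : ℝ) = 2 ^ (9 / 8 : ℝ) * t ^ (-(9 / 8) : ℝ) := by
    rw [Real.div_rpow ht.le (by norm_num), Real.rpow_neg (by norm_num : (0 : ℝ) ≤ 2), div_inv_eq_mul,
      mul_comm]
  rw [h3, show (1 - 7 / 8 - 1 / 2 : ℝ) = -(3 / 8) by norm_num,
    show (-(3 / 2) : ℝ) = -(9 / 8) + -(3 / 8) by norm_num, Real.rpow_add ht]
  congr 1
  ring

end Pointwise

/-! ### Solutions in the critical weighted class -/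

/-! ### Heat evolution of the data -/

section HeatData

variable (u₀ : VectorL3) (θ₀ : ScalarL1)

/-- `e^{tΔ} u₀` in `L⁴`. -/
def heatVelocity (t : ℝ) : VelocityL4 := convOp (heatKernel E3) youngTriple_heat_velocity t u₀

/-- `e^{tΔ} θ₀` in `L^{4/3}`. -/
def heatTemperature (t : ℝ) : TemperatureL43 :=
  convOp (heatKernel ℝ) youngTriple_transport t θ₀

lemma heatVelocity_ae_eq {t : ℝ} (ht : 0 < t) :
    heatVelocity u₀ t =ᵐ[volume] kconv (heatKernel E3 t) u₀ :=
  (kernelFamily_heat E3 4).convOp_ae_eq (decayExponent_of_one_le Fact.out) _ ht u₀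

lemma heatTemperature_ae_eq {t : ℝ} (ht : 0 < t) :
    heatTemperature θ₀ t =ᵐ[volume] kconv (heatKernel ℝ t) θ₀ :=
  (kernelFamily_heat ℝ 4).convOp_ae_eq (decayExponent_of_one_le Fact.out) _ ht θ₀

lemma continuousOn_heatVelocity : ContinuousOn (heatVelocity u₀) (Ioi 0) :=
  ((kernelFamily_heat E3 4).continuousOn_convOp (decayExponent_of_one_le Fact.out) _).clm_apply
    continuousOn_const

lemma continuousOn_heatTemperature : ContinuousOn (heatTemperature θ₀) (Ioi 0) :=
  ((kernelFamily_heat ℝ 4).continuousOn_convOp (decayExponent_of_one_le Fact.out) _).clm_apply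
    continuousOn_const

lemma eLpNorm_smul_Lp {V : Type*} [NormedAddCommGroup V] [NormedSpace ℝ V] {p q : ℝ≥0∞} {c : ℝ}
    (hc : 0 ≤ c) (f : Lp V p (volume : Measure E3)) :
    eLpNorm (c • f : Lp V p (volume : Measure E3)) q volume
      = ENNReal.ofReal c * eLpNorm f q volume := by
  rw [eLpNorm_congr_ae (Lp.coeFn_smul c f), eLpNorm_const_smul, Real.enorm_eq_ofReal hc]

/-- From L³ to L⁴ the kernel exponent is 12/11, and 3/2 - 3/(2r) is the weight 1/8. Pointwise
convergence of the convolution uses the exponent 3/2 conjugate to 3. -/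
lemma tendsto_weighted_heatVelocity :
    Tendsto (fun t : ℝ => t ^ (1 / 8 : ℝ) • heatVelocity u₀ t) (𝓝[>] 0) (𝓝 0) := by
  have h := tendsto_heat_weighted (r := 12 / 11) (r' := 3 / 2) (q := 3) (p := 4) (α := 1 / 8)
    Fact.out Fact.out (by norm_num) Fact.out (by norm_num) (by norm_num)
    (fun t ht g hg => eLpNorm_kconv_le (memLp_heatKernel (r := 12 / 11) Fact.out ht).1 hg.1
      youngTriple_heat_velocity)
    (fun t ht g hg => eLpNorm_kconv_le (memLp_heatKernel le_rfl ht).1 hg.1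
      (youngTriple_one (by norm_num))) (Lp.memLp u₀)
  rw [tendsto_zero_iff_enorm_tendsto_zero]
  refine h.congr' ?_
  filter_upwards [self_mem_nhdsWithin] with t ht
  have ht : 0 < t := ht
  rw [Lp.enorm_def, eLpNorm_smul_Lp (by positivity), eLpNorm_congr_ae (heatVelocity_ae_eq u₀ ht)]

lemma tendsto_weighted_heatTemperature :
    Tendsto (fun t : ℝ => t ^ (3 / 8 : ℝ) • heatTemperature θ₀ t) (𝓝[>] 0) (𝓝 0) := by
  have h := tendsto_heat_weighted (r := 4 / 3) (r' := ⊤) (q := 1) (p := 4 / 3) (α := 3 / 8)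
    Fact.out le_top (by norm_num) Fact.out (by norm_num) (by norm_num)
    (fun t ht g hg => eLpNorm_kconv_le (memLp_heatKernel (r := 4 / 3) Fact.out ht).1 hg.1
      youngTriple_transport)
    (fun t ht g hg => eLpNorm_kconv_le (memLp_heatKernel le_rfl ht).1 hg.1
      (youngTriple_one (by finiteness))) (Lp.memLp θ₀)
  rw [tendsto_zero_iff_enorm_tendsto_zero]
  refine h.congr' ?_
  filter_upwards [self_mem_nhdsWithin] with t ht
  have ht : 0 < t := ht
  rw [Lp.enorm_def, eLpNorm_smul_Lp (by positivity),
    eLpNorm_congr_ae (heatTemperature_ae_eq θ₀ ht)]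

lemma tendsto_top_heatVelocity :
    Tendsto (fun t : ℝ => ENNReal.ofReal (t ^ (1 / 2 : ℝ)) * eLpNorm (heatVelocity u₀ t) ⊤ volume)
      (𝓝[>] 0) (𝓝 0) := by
  have h := tendsto_heat_weighted (r := 3 / 2) (r' := 3 / 2) (q := 3) (p := ⊤) (α := 1 / 2)
    Fact.out Fact.out (by norm_num) le_top (by norm_num) (by norm_num)
    (fun t ht g hg => eLpNorm_top_kconv_le (memLp_heatKernel (r := 3 / 2) Fact.out ht).1 hg.1)
    (fun t ht g hg => eLpNorm_top_kconv_le (memLp_heatKernel le_rfl ht).1 hg.1) (Lp.memLp u₀)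
  refine h.congr' ?_
  filter_upwards [self_mem_nhdsWithin] with t ht
  rw [eLpNorm_congr_ae (heatVelocity_ae_eq u₀ ht)]

lemma tendsto_top_heatTemperature :
    Tendsto (fun t : ℝ => ENNReal.ofReal (t ^ (3 / 2 : ℝ)) *
      eLpNorm (heatTemperature θ₀ t) ⊤ volume) (𝓝[>] 0) (𝓝 0) := by
  have h := tendsto_heat_weighted (r := ⊤) (r' := ⊤) (q := 1) (p := ⊤) (α := 3 / 2)
    le_top le_top (by norm_num) le_top (by norm_num) (by norm_num)
    (fun t ht g hg => eLpNorm_top_kconv_le (memLp_heatKernel le_top ht).1 hg.1)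
    (fun t ht g hg => eLpNorm_top_kconv_le (memLp_heatKernel le_rfl ht).1 hg.1) (Lp.memLp θ₀)
  refine h.congr' ?_
  filter_upwards [self_mem_nhdsWithin] with t ht
  rw [eLpNorm_congr_ae (heatTemperature_ae_eq θ₀ ht)]

lemma heat_top_bound {V : Type} [NormedAddCommGroup V] [NormedSpace ℝ V] {r q : ℝ≥0∞} (hr : 1 ≤ r)
    [r.HolderConjugate q] {e : ℝ} (he : e = 3 / 2 - 3 / (2 * r.toReal)) {f : E3 → V}
    (hf : MemLp f q volume) :
    ∃ H : ℝ, 0 ≤ H ∧ ∀ t : ℝ, 0 < t →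
      eLpNorm (kconv (heatKernel V t) f) ⊤ volume ≤ ENNReal.ofReal (H * t ^ (-e)) := by
  refine ⟨(eLpNorm (heatKernel V 1) r volume).toReal * (eLpNorm f q volume).toReal,
    by positivity, fun t ht => ?_⟩
  rw [eLpNorm_exponent_top]
  refine eLpNormEssSup_le_of_ae_enorm_bound (Eventually.of_forall fun x => ?_)
  rw [← ofReal_norm]
  exact ENNReal.ofReal_le_ofReal ((kernelFamily_heat V 4).norm_kconv_le
    (decayExponent_of_one_le hr) ht he hf.1 ENNReal.toReal_nonneg
    (ENNReal.ofReal_toReal hf.2.ne).ge x)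

end HeatData

/-! ### Paths and solutions in the Kato class -/

lemma duhamel_congr {X Y : Type*} [NormedAddCommGroup X] [NormedSpace ℝ X]
    [NormedAddCommGroup Y] [NormedSpace ℝ Y] (S : ℝ → X →L[ℝ] Y) {F G : ℝ → X} {t : ℝ}
    (ht : 0 ≤ t) (h : ∀ s ∈ Ioc 0 t, F s = G s) : duhamel S F t = duhamel S G t := by
  refine intervalIntegral.integral_congr_ae (Eventually.of_forall fun s hs => ?_)
  rw [uIoc_of_le ht] at hs
  rw [h s hs]

/-- Paths in the critical weighted class on `(0,T]`. -/
structure KatoPath (T : ℝ) (u : ℝ → VelocityL4) (θ : ℝ → TemperatureL43) : Prop where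
  continuousOn_velocity : ContinuousOn u (Ioc 0 T)
  continuousOn_temperature : ContinuousOn θ (Ioc 0 T)
  tendsto_velocity : Tendsto (fun t : ℝ => t ^ (1 / 8 : ℝ) • u t) (𝓝[>] 0) (𝓝 0)
  tendsto_temperature : Tendsto (fun t : ℝ => t ^ (3 / 8 : ℝ) • θ t) (𝓝[>] 0) (𝓝 0)

/-- A solution of the integral equations in the critical weighted class on `(0,T]`. -/
structure KatoSolution (T : ℝ) (u₀ : VectorL3) (θ₀ : ScalarL1) (u : ℝ → VelocityL4)
    (θ : ℝ → TemperatureL43) : Prop extends KatoPath T u θ where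
  velocity_eq : ∀ t ∈ Ioc 0 T, u t = system.velocityRHS (heatVelocity u₀) u θ t
  temperature_eq : ∀ t ∈ Ioc 0 T, θ t = system.temperatureRHS (heatTemperature θ₀) u θ t

/-- Near t = 0 the limit bounds the path, and away from 0 compactness does. -/
lemma exists_bound_of_tendsto {Z : Type*} [NormedAddCommGroup Z] {T : ℝ}
    {z : ℝ → Z} (hz : ContinuousOn z (Ioc 0 T)) (h0 : Tendsto z (𝓝[>] 0) (𝓝 0)) :
    ∃ M : ℝ, 0 ≤ M ∧ ∀ t ∈ Ioc 0 T, ‖z t‖ ≤ M := by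
  obtain ⟨η, hη, hs⟩ := exists_small_of_tendsto_zero h0 one_pos
  have hc : ContinuousOn (fun t => ‖z t‖) (Icc η T) :=
    (hz.mono fun t ht => ⟨hη.trans_le ht.1, ht.2⟩).norm
  obtain ⟨M, hM⟩ := isCompact_Icc.bddAbove_image hc
  refine ⟨max 1 M, zero_le_one.trans (le_max_left _ _), fun t ht => ?_⟩
  rcases lt_or_ge t η with h | h
  · exact (hs t ⟨ht.1, h⟩).le.trans (le_max_left _ _)
  · exact (hM ⟨t, ⟨h, ht.2⟩, rfl⟩).trans (le_max_right _ _)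

lemma norm_le_of_weighted {Z : Type*} [NormedAddCommGroup Z] [NormedSpace ℝ Z] {t e M : ℝ}
    (ht : 0 < t) {z : Z} (h : ‖t ^ e • z‖ ≤ M) : ‖z‖ ≤ M * t ^ (-e) := by
  rw [norm_smul, Real.norm_of_nonneg (by positivity)] at h
  rw [Real.rpow_neg ht.le, ← div_eq_mul_inv, le_div_iff₀ (by positivity)]
  linarith

namespace KatoPath

variable {T : ℝ} {u : ℝ → VelocityL4} {θ : ℝ → TemperatureL43}

lemma exists_katoBound (h : KatoPath T u θ) :
    ∃ m n : ℝ, 0 ≤ m ∧ 0 ≤ n ∧ ∀ t ∈ Ioc 0 T, KatoBound t m n u θ := by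
  have hp : ∀ e : ℝ, ContinuousOn (fun t : ℝ => t ^ e) (Ioc 0 T) := fun e =>
    continuousOn_id.rpow_const fun t ht => Or.inl (ne_of_gt ht.1)
  obtain ⟨m, hm, hum⟩ := exists_bound_of_tendsto ((hp _).smul h.continuousOn_velocity)
    h.tendsto_velocity
  obtain ⟨n, hn, hθn⟩ := exists_bound_of_tendsto ((hp _).smul h.continuousOn_temperature)
    h.tendsto_temperature
  refine ⟨m, n, hm, hn, fun t ht => ?_⟩
  have hsub : Ioo 0 t ⊆ Ioc 0 T := fun s hs => ⟨hs.1, hs.2.le.trans ht.2⟩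
  exact ⟨ht.1, h.continuousOn_velocity.mono hsub, h.continuousOn_temperature.mono hsub,
    fun s hs => norm_le_of_weighted hs.1 (hum s (hsub hs)),
    fun s hs => norm_le_of_weighted hs.1 (hθn s (hsub hs))⟩

/-- The vanishing condition turns into arbitrarily small constants on short intervals. With critical
scaling this is the only source of smallness, and every limit at t = 0 below rests on it. -/
lemma exists_small_katoBound (h : KatoPath T u θ) (hT : 0 < T) {ε : ℝ} (hε : 0 < ε) :
    ∃ η > 0, ∀ t ∈ Ioo 0 η, KatoBound t ε ε u θ := by
  obtain ⟨η₁, hη₁, h1⟩ := exists_small_of_tendsto_zero h.tendsto_velocity hε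
  obtain ⟨η₂, hη₂, h2⟩ := exists_small_of_tendsto_zero h.tendsto_temperature hε
  refine ⟨min (min η₁ η₂) T, lt_min (lt_min hη₁ hη₂) hT, fun t ht => ?_⟩
  have htT := (lt_min_iff.1 ht.2).2
  have ht12 := lt_min_iff.1 (lt_min_iff.1 ht.2).1
  have hsub : Ioo 0 t ⊆ Ioc 0 T := fun s hs => ⟨hs.1, (hs.2.trans htT).le⟩
  exact ⟨ht.1, h.continuousOn_velocity.mono hsub, h.continuousOn_temperature.mono hsub,
    fun s hs => norm_le_of_weighted hs.1 (h1 s ⟨hs.1, hs.2.trans ht12.1⟩).le,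
    fun s hs => norm_le_of_weighted hs.1 (h2 s ⟨hs.1, hs.2.trans ht12.2⟩).le⟩

end KatoPath

/-! ### Passage between weighted and unweighted variables -/

lemma smul_rpow_cancel {Z : Type*} [AddCommGroup Z] [Module ℝ Z] {t e f : ℝ} (ht : 0 < t)
    (h : e + f = 0) (z : Z) : t ^ e • t ^ f • z = z := by
  rw [smul_smul, ← Real.rpow_add ht, h, Real.rpow_zero, one_smul]

/-- The weighted form of a pair. -/
def weighted (lam : ℝ) (u : ℝ → VelocityL4) (θ : ℝ → TemperatureL43) (t : ℝ) :
    VelocityL4 × TemperatureL43 :=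
  (t ^ (1 / 8 : ℝ) • u t, (lam⁻¹ * t ^ (3 / 8 : ℝ)) • θ t)

section Weighted

variable {lam : ℝ} {u : ℝ → VelocityL4} {θ : ℝ → TemperatureL43}
  {z : ℝ → VelocityL4 × TemperatureL43} {t : ℝ}

lemma velocity_weighted (ht : 0 < t) : velocity (weighted lam u θ) t = u t :=
  smul_rpow_cancel ht (by norm_num) _

lemma temperature_weighted (hl : lam ≠ 0) (ht : 0 < t) :
    temperature lam (weighted lam u θ) t = θ t := by
  simp only [temperature, weighted]
  rw [smul_smul, show lam * t ^ (-(3 / 8 : ℝ)) * (lam⁻¹ * t ^ (3 / 8 : ℝ))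
    = (lam * lam⁻¹) * (t ^ (-(3 / 8 : ℝ)) * t ^ (3 / 8 : ℝ)) by ring, mul_inv_cancel₀ hl,
    ← Real.rpow_add ht]
  norm_num

lemma rpow_smul_velocity (ht : 0 < t) : t ^ (1 / 8 : ℝ) • velocity z t = (z t).1 :=
  smul_rpow_cancel ht (by norm_num) _

lemma rpow_smul_temperature (ht : 0 < t) :
    t ^ (3 / 8 : ℝ) • temperature lam z t = lam • (z t).2 := by
  rw [temperature, smul_smul, show t ^ (3 / 8 : ℝ) * (lam * t ^ (-(3 / 8 : ℝ)))
    = lam * (t ^ (3 / 8 : ℝ) * t ^ (-(3 / 8 : ℝ))) by ring, ← Real.rpow_add ht]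
  norm_num

end Weighted

/-- Weighting and unweighting are inverse to each other only for positive times, and the Duhamel
integrals see only (0, t]. -/
lemma picard_weighted {lam : ℝ} (hl : lam ≠ 0) (a : ℝ → VelocityL4) (a' : ℝ → TemperatureL43)
    (u : ℝ → VelocityL4) (θ : ℝ → TemperatureL43) {t : ℝ} (ht : 0 < t) :
    system.picard lam a a' (weighted lam u θ) t =
      (t ^ (1 / 8 : ℝ) • system.velocityRHS a u θ t,
        (lam⁻¹ * t ^ (3 / 8 : ℝ)) • system.temperatureRHS a' u θ t) := by
  have hv : ∀ s ∈ Ioc 0 t, velocity (weighted lam u θ) s = u s := fun s hs =>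
    velocity_weighted hs.1
  have hθ : ∀ s ∈ Ioc 0 t, temperature lam (weighted lam u θ) s = θ s := fun s hs =>
    temperature_weighted hl hs.1
  simp only [DuhamelSystem.picard, DuhamelSystem.velocityRHS, DuhamelSystem.temperatureRHS]
  rw [duhamel_congr system.inertia ht.le fun s hs => by rw [hv s hs],
    duhamel_congr system.buoyancy ht.le hθ,
    duhamel_congr system.transport ht.le fun s hs => by rw [hv s hs, hθ s hs]]

/-! ### Propagation of bounds in L^∞ -/

section TopNorm

variable {V : Type*} [NormedAddCommGroup V] {p : ℝ≥0∞} {f g : Lp V p (volume : Measure E3)}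

lemma eLpNorm_top_Lp_add_le :
    eLpNorm (f + g : Lp V p (volume : Measure E3)) ⊤ volume
      ≤ eLpNorm f ⊤ volume + eLpNorm g ⊤ volume := by
  rw [eLpNorm_congr_ae (Lp.coeFn_add f g)]
  exact eLpNorm_add_le (Lp.aestronglyMeasurable f) (Lp.aestronglyMeasurable g) le_top

lemma eLpNorm_top_Lp_sub_le :
    eLpNorm (f - g : Lp V p (volume : Measure E3)) ⊤ volume
      ≤ eLpNorm f ⊤ volume + eLpNorm g ⊤ volume := by
  rw [eLpNorm_congr_ae (Lp.coeFn_sub f g)]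
  exact eLpNorm_sub_le (Lp.aestronglyMeasurable f) (Lp.aestronglyMeasurable g) le_top

end TopNorm

/-- Bounds in `L^∞` with the critical weights on `(0,t)`. -/
structure TopBound (t A B : ℝ) (u : ℝ → VelocityL4) (θ : ℝ → TemperatureL43) : Prop where
  velocity_const_nonneg : 0 ≤ A
  temperature_const_nonneg : 0 ≤ B
  velocity_le : ∀ s ∈ Ioo 0 t, eLpNorm (u s) ⊤ volume ≤ ENNReal.ofReal (A * s ^ (-(1 / 2 : ℝ)))
  temperature_le : ∀ s ∈ Ioo 0 t, eLpNorm (θ s) ⊤ volume ≤ ENNReal.ofReal (B * s ^ (-(3 / 2 : ℝ)))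

/-- The integral equations propagate bounds in `L^∞`. -/
lemma exists_top_bound : ∃ c : ℝ, 0 ≤ c ∧ ∀ {t m n A B : ℝ} {u : ℝ → VelocityL4}
    {θ : ℝ → TemperatureL43} (a : ℝ → VelocityL4) (a' : ℝ → TemperatureL43),
    KatoBound t m n u θ → 0 ≤ m → 0 ≤ n → TopBound t A B u θ →
    eLpNorm (system.velocityRHS a u θ t) ⊤ volume ≤ eLpNorm (a t) ⊤ volume +
      ENNReal.ofReal (c * (A * m + B ^ (1 / 3 : ℝ) * n ^ (2 / 3 : ℝ)) * t ^ (-(1 / 2 : ℝ))) ∧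
    eLpNorm (system.temperatureRHS a' u θ t) ⊤ volume ≤ eLpNorm (a' t) ⊤ volume +
      ENNReal.ofReal (c * (m * (n + B)) * t ^ (-(3 / 2 : ℝ))) := by
  obtain ⟨c₁, hc₁, h₁⟩ := exists_inertia_top_bound
  obtain ⟨c₂, hc₂, h₂⟩ := exists_buoyancy_top_bound
  obtain ⟨c₃, hc₃, h₃⟩ := exists_transport_top_bound
  refine ⟨c₁ + c₂ + c₃, by positivity, fun {t m n A B u θ} a a' h hm hn hAB => ?_⟩
  have hA := hAB.velocity_const_nonneg
  have hB := hAB.temperature_const_nonneg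
  have ht := h.time_pos
  have i₁ := h₁ h hm hA hAB.velocity_le
  have i₂ := h₂ h hn hB hAB.temperature_le
  have i₃ := h₃ h hm hn hB hAB.temperature_le
  constructor
  · refine eLpNorm_top_Lp_add_le.trans ?_
    refine (add_le_add eLpNorm_top_Lp_sub_le le_rfl).trans ?_
    rw [add_assoc]
    refine add_le_add le_rfl ((add_le_add i₁ i₂).trans ?_)
    rw [← ENNReal.ofReal_add (by positivity) (by positivity), ← add_mul]
    refine ENNReal.ofReal_le_ofReal (mul_le_mul_of_nonneg_right ?_ (by positivity))
    rw [mul_add]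
    gcongr <;> linarith
  · refine eLpNorm_top_Lp_sub_le.trans (add_le_add le_rfl (i₃.trans ?_))
    refine ENNReal.ofReal_le_ofReal ?_
    gcongr
    linarith

/-- The `L^∞` constraint in weighted variables. -/
def topConstraint (lam A B t : ℝ) : Set (VelocityL4 × TemperatureL43) :=
  {f | eLpNorm (t ^ (-(1 / 8 : ℝ)) • f.1 : VelocityL4) ⊤ volume
      ≤ ENNReal.ofReal (A * t ^ (-(1 / 2 : ℝ))) ∧
    eLpNorm ((lam * t ^ (-(3 / 8 : ℝ))) • f.2 : TemperatureL43) ⊤ volume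
      ≤ ENNReal.ofReal (B * t ^ (-(3 / 2 : ℝ)))}

lemma isClosed_topConstraint (lam A B t : ℝ) : IsClosed (topConstraint lam A B t) := by
  have h1 : Continuous fun f : VelocityL4 × TemperatureL43 => t ^ (-(1 / 8 : ℝ)) • f.1 := by
    fun_prop
  have h2 : Continuous fun f : VelocityL4 × TemperatureL43 => (lam * t ^ (-(3 / 8 : ℝ))) • f.2 := by
    fun_prop
  have h3 := (isClosed_eLpNorm_top_le (V := E3) (p := 4)
    (ENNReal.ofReal (A * t ^ (-(1 / 2 : ℝ))))).preimage h1
  have h4 := (isClosed_eLpNorm_top_le (V := ℝ) (p := 4 / 3)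
    (ENNReal.ofReal (B * t ^ (-(3 / 2 : ℝ))))).preimage h2
  exact h3.inter h4

lemma zero_mem_topConstraint (lam A B t : ℝ) :
    (0 : VelocityL4 × TemperatureL43) ∈ topConstraint lam A B t := by
  have h0 : ∀ {V : Type} [NormedAddCommGroup V] (p : ℝ≥0∞),
      eLpNorm (0 : Lp V p (volume : Measure E3)) ⊤ volume = 0 := fun p => by
    rw [eLpNorm_congr_ae (Lp.coeFn_zero _ _ _), eLpNorm_zero]
  constructor
  · rw [Prod.fst_zero, smul_zero, h0]; exact bot_le
  · rw [Prod.snd_zero, smul_zero, h0]; exact bot_le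

/-! ### Choice of the parameters and the solution -/

lemma picard_zero {lam : ℝ} (a : ℝ → VelocityL4) (a' : ℝ → TemperatureL43) (t : ℝ) :
    system.picard lam a a' 0 t =
      (t ^ (1 / 8 : ℝ) • a t, lam⁻¹ • t ^ (3 / 8 : ℝ) • a' t) := by
  simp [DuhamelSystem.picard, DuhamelSystem.velocityRHS, DuhamelSystem.temperatureRHS, duhamel,
    velocity, temperature, smul_smul]

lemma tendsto_picard_zero (lam : ℝ) (u₀ : VectorL3) (θ₀ : ScalarL1) :
    Tendsto (system.picard lam (heatVelocity u₀) (heatTemperature θ₀) 0) (𝓝[>] 0) (𝓝 0) := by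
  have h1 : Tendsto (fun t : ℝ => lam⁻¹ • t ^ (3 / 8 : ℝ) • heatTemperature θ₀ t) (𝓝[>] 0)
      (𝓝 0) := by
    simpa only [smul_zero] using (tendsto_weighted_heatTemperature θ₀).const_smul lam⁻¹
  have h2 := (tendsto_weighted_heatVelocity u₀).prodMk_nhds h1
  have h3 : system.picard lam (heatVelocity u₀) (heatTemperature θ₀) 0 = fun t =>
      (t ^ (1 / 8 : ℝ) • heatVelocity u₀ t, lam⁻¹ • t ^ (3 / 8 : ℝ) • heatTemperature θ₀ t) :=
    funext (picard_zero _ _)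
  rw [h3]
  exact h2

/-- The choices are triangular. First `lam` absorbs the linear buoyancy constant, and R absorbs the
bilinear constants and c. Then B, whose inequality does not involve A, and finally A. Each of the
last two inequalities contains its own unknown with coefficient cR ≤ 1/16, so twice the remaining
terms is large enough, however large the data constants H₁ and H₂ are. -/
lemma exists_small_parameters {K₁ K₂ L c H₁ H₂ : ℝ} (hK₁ : 0 ≤ K₁) (hK₂ : 0 ≤ K₂) (hL : 0 ≤ L)
    (hc : 0 ≤ c) (hH₁ : 0 ≤ H₁) (hH₂ : 0 ≤ H₂) : ∃ R lam A B : ℝ, 0 < R ∧ 0 < lam ∧ 0 ≤ A ∧ 0 ≤ B ∧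
      4 * (K₁ * R) + L * lam ≤ 1 / 2 ∧ 4 * (K₂ * R) ≤ 1 / 2 ∧
      H₁ + c * (A * R + B ^ (1 / 3 : ℝ) * (lam * R) ^ (2 / 3 : ℝ)) ≤ A ∧
      H₂ + c * (R * (lam * R + B)) ≤ B := by
  set lam := (4 * (L + 1))⁻¹ with hlam
  have hlam0 : 0 < lam := by positivity
  have hlamL : L * lam ≤ 1 / 4 := by
    rw [hlam, ← div_eq_mul_inv, div_le_iff₀ (by positivity)]; linarith
  set R := (16 * (K₁ + K₂ + c + 1))⁻¹ with hR
  have hR0 : 0 < R := by positivity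
  have hsum : (K₁ + K₂ + c + 1) * R = 1 / 16 := by
    rw [hR]; field_simp
  have hK₁R : K₁ * R ≤ 1 / 16 := by nlinarith
  have hK₂R : K₂ * R ≤ 1 / 16 := by nlinarith
  have hcR : c * R ≤ 1 / 16 := by nlinarith
  set B := 2 * (H₂ + c * (R * (lam * R))) with hB
  have hB0 : 0 ≤ B := by positivity
  set A := 2 * (H₁ + c * (B ^ (1 / 3 : ℝ) * (lam * R) ^ (2 / 3 : ℝ))) with hA
  have hA0 : 0 ≤ A := by positivity
  have hAR : A * (c * R) ≤ A * (1 / 16) := mul_le_mul_of_nonneg_left hcR hA0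
  have hBR : B * (c * R) ≤ B * (1 / 16) := mul_le_mul_of_nonneg_left hcR hB0
  exact ⟨R, lam, A, B, hR0, hlam0, hA0, hB0, by linarith, by linarith, by linarith, by linarith⟩

/-- Only the smallness of the data in the weighted norm restricts T. The constants of contraction
and of the L^∞ constraint do not depend on time, so T is chosen after all other parameters,
including `lam`. -/
lemma exists_picardMap (u₀ : VectorL3) (θ₀ : ScalarL1) : ∃ T R lam A B : ℝ, 0 < lam ∧ 0 ≤ A ∧
    0 ≤ B ∧ PicardMap T R (topConstraint lam A B)
      (system.picard lam (heatVelocity u₀) (heatTemperature θ₀)) := by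
  obtain ⟨c, hc, htop⟩ := exists_top_bound
  obtain ⟨H₁, hH₁, hdata₁⟩ := heat_top_bound (r := 3 / 2) (e := 1 / 2) Fact.out (by norm_num)
    (Lp.memLp u₀)
  obtain ⟨H₂, hH₂, hdata₂⟩ := heat_top_bound (r := ⊤) (e := 3 / 2) le_top (by norm_num)
    (Lp.memLp θ₀)
  obtain ⟨R, lam, A, B, hR0, hlam0, hA0, hB0, hs₁, hs₂, hs₃, hs₄⟩ := exists_small_parameters
    (mul_nonneg (mul_nonneg system.singularFamily_inertia.const_nonneg
      (ContinuousLinearMap.opNorm_nonneg system.tensor)) (betaConst_nonneg (7 / 8) (1 / 4)))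
    (mul_nonneg (mul_nonneg system.singularFamily_transport.const_nonneg
      (ContinuousLinearMap.opNorm_nonneg system.flux)) (betaConst_nonneg (7 / 8) (1 / 2)))
    (mul_nonneg system.singularFamily_buoyancy.const_nonneg (betaConst_nonneg (3 / 4) (3 / 8)))
    hc hH₁ hH₂
  have hzero := tendsto_picard_zero lam u₀ θ₀
  obtain ⟨η, hη, hsmall⟩ := exists_small_of_tendsto_zero hzero (half_pos hR0)
  -- Half of η, because the smallness of the data is known on the open interval (0, η) and is needed
  -- on (0, T] with its endpoint.
  refine ⟨η / 2, R, lam, A, B, hlam0, hA0, hB0, ?_⟩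
  have hT : 0 < η / 2 := half_pos hη
  refine ⟨hT, hR0, fun z M hz hM => ?_, fun z w t δ ht hz hw hzb hwb hδ => ?_, fun t ht => ?_, hzero,
    isClosed_topConstraint lam A B, zero_mem_topConstraint lam A B, fun z hz hzR hzP t ht => ?_⟩
  · exact DuhamelSystem.continuousOn_picard hlam0.le
      ((continuousOn_heatVelocity u₀).mono DuhamelSystem.Ioc_subset_Ioi)
      ((continuousOn_heatTemperature θ₀).mono DuhamelSystem.Ioc_subset_Ioi) hz hM
  · refine DuhamelSystem.picard_contract hlam0 ht.1 ?_ ?_ _ _ hz hw hzb hwb hδ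
    · refine le_trans (le_of_eq ?_) hs₁
      ring
    · refine le_trans (le_of_eq ?_) hs₂
      ring
  · exact (hsmall t ⟨ht.1, by linarith [ht.2]⟩).le
  · have ht0 := ht.1
    have hsub : Ioo 0 t ⊆ Ioc 0 (η / 2) := fun s hs => ⟨hs.1, hs.2.le.trans ht.2⟩
    have hkato : KatoBound t R (lam * R) (velocity z) (temperature lam z) :=
      ⟨ht.1, continuousOn_velocity DuhamelSystem.Ioo_subset_Ioi (hz.mono hsub),
        continuousOn_temperature DuhamelSystem.Ioo_subset_Ioi (hz.mono hsub),
        fun s hs => norm_velocity_le hs.1 (hzR s (hsub hs)),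
        fun s hs => norm_temperature_le hlam0.le hs.1 (hzR s (hsub hs))⟩
    have htb : TopBound t A B (velocity z) (temperature lam z) :=
      ⟨hA0, hB0, fun s hs => (hzP s (hsub hs)).1, fun s hs => (hzP s (hsub hs)).2⟩
    obtain ⟨hv, hθ⟩ := htop (heatVelocity u₀) (heatTemperature θ₀) hkato hR0.le (by positivity) htb
    have e1 : (t ^ (-(1 / 8 : ℝ)) • (system.picard lam (heatVelocity u₀) (heatTemperature θ₀) z t).1)
        = system.velocityRHS (heatVelocity u₀) (velocity z) (temperature lam z) t :=
      smul_rpow_cancel ht.1 (by norm_num) _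
    have e2 : ((lam * t ^ (-(3 / 8 : ℝ))) •
        (system.picard lam (heatVelocity u₀) (heatTemperature θ₀) z t).2)
        = system.temperatureRHS (heatTemperature θ₀) (velocity z) (temperature lam z) t := by
      simp only [DuhamelSystem.picard]
      rw [smul_smul, show lam * t ^ (-(3 / 8 : ℝ)) * (lam⁻¹ * t ^ (3 / 8 : ℝ))
        = (lam * lam⁻¹) * (t ^ (-(3 / 8 : ℝ)) * t ^ (3 / 8 : ℝ)) by ring,
        mul_inv_cancel₀ hlam0.ne', ← Real.rpow_add ht.1]
      norm_num
    constructor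
    · rw [e1]
      refine hv.trans ?_
      rw [eLpNorm_congr_ae (heatVelocity_ae_eq u₀ ht.1)]
      refine (add_le_add (hdata₁ t ht.1) le_rfl).trans ?_
      rw [← ENNReal.ofReal_add (by positivity) (by positivity), ← add_mul]
      refine ENNReal.ofReal_le_ofReal (mul_le_mul_of_nonneg_right ?_ (by positivity))
      exact hs₃
    · rw [e2]
      refine hθ.trans ?_
      rw [eLpNorm_congr_ae (heatTemperature_ae_eq θ₀ ht.1)]
      refine (add_le_add (hdata₂ t ht.1) le_rfl).trans ?_
      rw [← ENNReal.ofReal_add (by positivity) (by positivity), ← add_mul]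
      refine ENNReal.ofReal_le_ofReal (mul_le_mul_of_nonneg_right ?_ (by positivity))
      exact hs₄

/-- Local existence and uniqueness in the critical weighted class. -/
lemma exists_katoSolution (u₀ : VectorL3) (θ₀ : ScalarL1) : ∃ T : ℝ, 0 < T ∧
    ∃ (u : ℝ → VelocityL4) (θ : ℝ → TemperatureL43) (A B : ℝ), KatoSolution T u₀ θ₀ u θ ∧
      0 ≤ A ∧ 0 ≤ B ∧
      (∀ s ∈ Ioc 0 T, eLpNorm (u s) ⊤ volume ≤ ENNReal.ofReal (A * s ^ (-(1 / 2 : ℝ)))) ∧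
      (∀ s ∈ Ioc 0 T, eLpNorm (θ s) ⊤ volume ≤ ENNReal.ofReal (B * s ^ (-(3 / 2 : ℝ)))) ∧
      ∀ v η, KatoSolution T u₀ θ₀ v η → EqOn v u (Ioc 0 T) ∧ EqOn η θ (Ioc 0 T) := by
  obtain ⟨T, R, lam, A, B, hlam, hA, hB, hP⟩ := exists_picardMap u₀ θ₀
  obtain ⟨z, hz, hzR, hz0, hzP, hzN⟩ := hP.exists_fixedPoint
  have hp : ∀ e : ℝ, ContinuousOn (fun t : ℝ => t ^ e) (Ioc 0 T) := fun e =>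
    continuousOn_id.rpow_const fun t ht => Or.inl (ne_of_gt ht.1)
  refine ⟨T, hP.time_pos, velocity z, temperature lam z, A, B, ?_, hA, hB,
    fun s hs => (hzP s hs).1, fun s hs => (hzP s hs).2, fun v η hv => ?_⟩
  · refine ⟨⟨continuousOn_velocity DuhamelSystem.Ioc_subset_Ioi hz,
      continuousOn_temperature DuhamelSystem.Ioc_subset_Ioi hz, ?_, ?_⟩, fun t ht => ?_,
      fun t ht => ?_⟩
    · refine (hz0.fst_nhds).congr' ?_
      filter_upwards [self_mem_nhdsWithin] with t ht
      exact (rpow_smul_velocity ht).symm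
    · have := (hz0.snd_nhds).const_smul lam
      rw [Prod.snd_zero, smul_zero] at this
      refine this.congr' ?_
      filter_upwards [self_mem_nhdsWithin] with t ht
      exact (rpow_smul_temperature ht).symm
    · have := congrArg Prod.fst (hzN ht)
      rw [velocity, this]
      exact smul_rpow_cancel ht.1 (by norm_num) _
    · have := congrArg Prod.snd (hzN ht)
      rw [temperature, this]
      simp only [DuhamelSystem.picard]
      rw [smul_smul, show lam * t ^ (-(3 / 8 : ℝ)) * (lam⁻¹ * t ^ (3 / 8 : ℝ))
        = (lam * lam⁻¹) * (t ^ (-(3 / 8 : ℝ)) * t ^ (3 / 8 : ℝ)) by ring,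
        mul_inv_cancel₀ hlam.ne', ← Real.rpow_add ht.1]
      norm_num
  · have hw : ContinuousOn (weighted lam v η) (Ioc 0 T) :=
      ((hp _).smul hv.continuousOn_velocity).prodMk
        ((continuousOn_const.mul (hp _)).smul hv.continuousOn_temperature)
    have hw0 : Tendsto (weighted lam v η) (𝓝[>] 0) (𝓝 0) := by
      have := hv.tendsto_velocity.prodMk_nhds (hv.tendsto_temperature.const_smul lam⁻¹)
      rw [smul_zero] at this
      exact this.congr fun t => by rw [smul_smul]; rfl
    -- Any solution in the Kato class is, in weighted variables, a fixed point vanishing at t = 0;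
    -- its size is not assumed small, and `PicardMap.unique` does not ask for it.
    have hwN : EqOn (weighted lam v η)
        (system.picard lam (heatVelocity u₀) (heatTemperature θ₀) (weighted lam v η)) (Ioc 0 T) := by
      intro t ht
      rw [picard_weighted hlam.ne' _ _ _ _ ht.1, ← hv.velocity_eq t ht, ← hv.temperature_eq t ht]
      rfl
    have heq := hP.unique hz hw hzR hw0 hzN hwN
    refine ⟨fun t ht => ?_, fun t ht => ?_⟩
    · rw [← velocity_weighted (lam := lam) (u := v) (θ := η) ht.1, velocity, velocity, heq ht]
    · rw [← temperature_weighted (u := v) (θ := η) hlam.ne' ht.1, temperature, temperature, heq ht]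

/-! ### Regularity of solutions -/

/-- The error φ(ε) is available on an interval depending on ε; ε is fixed before t tends to zero. -/
lemma tendsto_zero_of_le_add {g h : ℝ → ℝ≥0∞} {φ : ℝ → ℝ} (hh : Tendsto h (𝓝[>] 0) (𝓝 0))
    (hφ : Tendsto φ (𝓝[>] 0) (𝓝 0))
    (H : ∀ ε > 0, ∃ η > 0, ∀ t ∈ Ioo 0 η, g t ≤ h t + ENNReal.ofReal (φ ε)) :
    Tendsto g (𝓝[>] 0) (𝓝 0) := by
  rw [ENNReal.tendsto_nhds_zero]
  intro δ hδ
  have hδ2 : 0 < δ / 2 := ENNReal.div_pos hδ.ne' (by simp)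
  have h1 : Tendsto (fun ε => ENNReal.ofReal (φ ε)) (𝓝[>] 0) (𝓝 0) := by
    simpa using ENNReal.tendsto_ofReal hφ
  obtain ⟨ε, hε1, hε2⟩ := ((ENNReal.tendsto_nhds_zero.1 h1 _ hδ2).and self_mem_nhdsWithin).exists
  obtain ⟨η, hη, hg⟩ := H ε hε2
  filter_upwards [Ioo_mem_nhdsGT hη, ENNReal.tendsto_nhds_zero.1 hh _ hδ2] with t ht ht2
  exact (hg t ht).trans ((add_le_add ht2 hε1).trans (ENNReal.add_halves δ).le)

lemma continuousOn_rpow_Ioc (T e : ℝ) : ContinuousOn (fun t : ℝ => t ^ e) (Ioc 0 T) :=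
  continuousOn_id.rpow_const fun _ ht => Or.inl (ne_of_gt ht.1)

lemma tendsto_rpow_zero {e : ℝ} (he : 0 < e) : Tendsto (fun t : ℝ => t ^ e) (𝓝[>] 0) (𝓝 0) := by
  have := (Real.continuousAt_rpow_const 0 e (Or.inr he.le)).tendsto
  rw [Real.zero_rpow he.ne'] at this
  exact this.mono_left nhdsWithin_le_nhds

/-! ### Realization of solutions in L³ and L¹ -/

section ThreeOne

/-- The operators `e^{τΔ} ℙ ∇ ·` from `L²` to `L³`. -/
def inertiaThree : ℝ → Lp Mat 2 (volume : Measure E3) →L[ℝ] VectorL3 :=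
  convOp lerayDivKernel youngTriple_inertia_three

/-- The operators `θ ↦ e^{τΔ} ℙ (θ e₃)` from `L^{4/3}` to `L³`. -/
def buoyancyThree : ℝ → TemperatureL43 →L[ℝ] VectorL3 :=
  convOp buoyancyKernel youngTriple_buoyancy_three

/-- The operators `e^{τΔ} ∇ ·` on `L¹`. -/
def transportOne : ℝ → Lp E3 1 (volume : Measure E3) →L[ℝ] ScalarL1 :=
  convOp divKernel (youngTriple_one ENNReal.one_ne_top)

/-- The singularities 3/4, 5/8 and 1/2 of the three families complement the weights 1/4, 3/8 and 1/2
of their arguments to 1. The Duhamel integrals in L³ and L¹ are thus bounded without any power of t,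
and tend to 0 with the constants. -/
lemma singularFamily_inertiaThree :
    SingularFamily (eLpNorm (lerayDivKernel 1) (6 / 5) volume).toReal (3 / 4) inertiaThree :=
  kernelFamily_lerayDiv.singularFamily
    (decayExponent_of_toReal Fact.out (by norm_num)) _ (by norm_num) (by norm_num)

lemma singularFamily_buoyancyThree :
    SingularFamily (eLpNorm (buoyancyKernel 1) (12 / 7) volume).toReal (5 / 8) buoyancyThree :=
  kernelFamily_buoyancy.singularFamily
    (decayExponent_of_toReal Fact.out (by norm_num)) _ (by norm_num) (by norm_num)

lemma singularFamily_transportOne :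
    SingularFamily (eLpNorm (divKernel 1) 1 volume).toReal (1 / 2) transportOne :=
  kernelFamily_div.singularFamily
    (decayExponent_of_toReal Fact.out (by norm_num)) _ (by norm_num) (by norm_num)

open Classical in
/-- The velocity in `L³` determined by a solution in the critical weighted class. -/
def velocityThree (u₀ : VectorL3) (u : ℝ → VelocityL4) (θ : ℝ → TemperatureL43) (t : ℝ) :
    VectorL3 :=
  if t = 0 then u₀ else convOp (heatKernel E3) (youngTriple_one (p := 3) (by norm_num)) t u₀
    - duhamel inertiaThree (fun s => tensorLp (u s) (u s)) t + duhamel buoyancyThree θ t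

open Classical in
/-- The temperature in `L¹` determined by a solution in the critical weighted class. -/
def temperatureOne (θ₀ : ScalarL1) (u : ℝ → VelocityL4) (θ : ℝ → TemperatureL43) (t : ℝ) :
    ScalarL1 :=
  if t = 0 then θ₀ else convOp (heatKernel ℝ) (youngTriple_one (p := 1) (by norm_num)) t θ₀
    - duhamel transportOne (fun s => fluxLp (θ s) (u s)) t

variable {T : ℝ} {u₀ : VectorL3} {θ₀ : ScalarL1} {u : ℝ → VelocityL4} {θ : ℝ → TemperatureL43}

/-- The pointwise form of the velocity equation, for any `L^p` realization of its terms. -/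
lemma KatoBound.velocity_ae_eq {t m n : ℝ} (h : KatoBound t m n u θ) {r₀ r r' p : ℝ≥0∞}
    [Fact (1 ≤ r₀)] [Fact (1 ≤ r)] [Fact (1 ≤ r')] [Fact (1 ≤ p)] (hY₀ : YoungTriple r₀ 3 p)
    (hY : YoungTriple r 2 p) (hY' : YoungTriple r' (4 / 3) p) (hr : DecayExponent 4 r)
    (hr' : DecayExponent 3 r') (hα : 2 - 3 / (2 * r.toReal) < 1)
    (hα' : 3 / 2 - 3 / (2 * r'.toReal) < 1) :
    ∀ᵐ x : E3, (convOp (heatKernel E3) hY₀ t u₀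
        - duhamel (convOp lerayDivKernel hY) (fun s => tensorLp (u s) (u s)) t
        + duhamel (convOp buoyancyKernel hY') θ t : Lp E3 p volume) x
      = kconv (heatKernel E3 t) u₀ x
        - (∫ s in (0 : ℝ)..t, kconv (lerayDivKernel (t - s)) (tensorLp (u s) (u s)) x)
        + ∫ s in (0 : ℝ)..t, kconv (buoyancyKernel (t - s)) (θ s) x := by
  filter_upwards [Lp.coeFn_add (convOp (heatKernel E3) hY₀ t u₀
      - duhamel (convOp lerayDivKernel hY) (fun s => tensorLp (u s) (u s)) t)
      (duhamel (convOp buoyancyKernel hY') θ t), Lp.coeFn_sub (convOp (heatKernel E3) hY₀ t u₀)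
      (duhamel (convOp lerayDivKernel hY) (fun s => tensorLp (u s) (u s)) t),
    (kernelFamily_heat E3 4).convOp_ae_eq (decayExponent_of_one_le Fact.out) hY₀ h.time_pos u₀,
    h.inertia_ae_eq hY hr hα, h.buoyancy_ae_eq hY' hr' hα'] with x h1 h2 h3 h4 h5
  rw [h1, Pi.add_apply, h2, Pi.sub_apply, h3, h4.2, h5.2]

/-- The pointwise form of the temperature equation. -/
lemma KatoBound.temperature_ae_eq {t m n : ℝ} (h : KatoBound t m n u θ) {r₀ r p : ℝ≥0∞}
    [Fact (1 ≤ r₀)] [Fact (1 ≤ r)] [Fact (1 ≤ p)] (hY₀ : YoungTriple r₀ 1 p)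
    (hY : YoungTriple r 1 p) (hr : DecayExponent 4 r) (hα : 2 - 3 / (2 * r.toReal) < 1) :
    ∀ᵐ x : E3, (convOp (heatKernel ℝ) hY₀ t θ₀
        - duhamel (convOp divKernel hY) (fun s => fluxLp (θ s) (u s)) t : Lp ℝ p volume) x
      = kconv (heatKernel ℝ t) θ₀ x
        - ∫ s in (0 : ℝ)..t, kconv (divKernel (t - s)) (fluxLp (θ s) (u s)) x := by
  filter_upwards [Lp.coeFn_sub (convOp (heatKernel ℝ) hY₀ t θ₀)
      (duhamel (convOp divKernel hY) (fun s => fluxLp (θ s) (u s)) t),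
    (kernelFamily_heat ℝ 4).convOp_ae_eq (decayExponent_of_one_le Fact.out) hY₀ h.time_pos θ₀,
    h.transport_ae_eq hY hr hα] with x h1 h2 h3
  rw [h1, Pi.sub_apply, h2, h3.2]

lemma KatoBound.velocityRHS_ae_eq {t m n : ℝ} (h : KatoBound t m n u θ) :
    ∀ᵐ x : E3, system.velocityRHS (heatVelocity u₀) u θ t x = kconv (heatKernel E3 t) u₀ x
        - (∫ s in (0 : ℝ)..t, kconv (lerayDivKernel (t - s)) (tensorLp (u s) (u s)) x)
        + ∫ s in (0 : ℝ)..t, kconv (buoyancyKernel (t - s)) (θ s) x :=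
  h.velocity_ae_eq youngTriple_heat_velocity youngTriple_inertia youngTriple_buoyancy
    (decayExponent_of_toReal Fact.out (by norm_num))
    (decayExponent_of_toReal Fact.out (by norm_num)) (by norm_num) (by norm_num)

lemma KatoBound.temperatureRHS_ae_eq {t m n : ℝ} (h : KatoBound t m n u θ) :
    ∀ᵐ x : E3, system.temperatureRHS (heatTemperature θ₀) u θ t x = kconv (heatKernel ℝ t) θ₀ x
        - ∫ s in (0 : ℝ)..t, kconv (divKernel (t - s)) (fluxLp (θ s) (u s)) x :=
  h.temperature_ae_eq youngTriple_transport youngTriple_transport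
    (decayExponent_of_toReal Fact.out (by norm_num)) (by norm_num)

namespace KatoSolution

/-- Both sides are evaluated at almost every point by the same integrals of the same convolutions,
although they are Bochner integrals in different spaces. -/
lemma velocityThree_ae_eq (h : KatoSolution T u₀ θ₀ u θ) {t : ℝ} (ht : t ∈ Ioc 0 T) :
    velocityThree u₀ u θ t =ᵐ[volume] u t := by
  obtain ⟨m, n, -, -, hb⟩ := h.exists_katoBound
  have h1 := (hb t ht).velocity_ae_eq (u₀ := u₀) (youngTriple_one (p := 3) (by norm_num))
    youngTriple_inertia_three youngTriple_buoyancy_three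
    (decayExponent_of_toReal Fact.out (by norm_num))
    (decayExponent_of_toReal Fact.out (by norm_num)) (by norm_num) (by norm_num)
  rw [velocityThree, if_neg ht.1.ne', h.velocity_eq t ht]
  filter_upwards [h1, (hb t ht).velocityRHS_ae_eq (u₀ := u₀)] with x hx1 hx2
  exact hx1.trans hx2.symm

lemma temperatureOne_ae_eq (h : KatoSolution T u₀ θ₀ u θ) {t : ℝ} (ht : t ∈ Ioc 0 T) :
    temperatureOne θ₀ u θ t =ᵐ[volume] θ t := by
  obtain ⟨m, n, -, -, hb⟩ := h.exists_katoBound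
  have h1 := (hb t ht).temperature_ae_eq (θ₀ := θ₀) (youngTriple_one (p := 1) (by norm_num))
    (youngTriple_one (p := 1) (by norm_num))
    (decayExponent_of_toReal Fact.out (by norm_num)) (by norm_num)
  rw [temperatureOne, if_neg ht.1.ne', h.temperature_eq t ht]
  filter_upwards [h1, (hb t ht).temperatureRHS_ae_eq (θ₀ := θ₀)] with x hx1 hx2
  exact hx1.trans hx2.symm

end KatoSolution

/-- A Duhamel integral with the critical scaling tends to zero at `t = 0`. -/
lemma SingularFamily.tendsto_duhamel {X Y : Type*} [NormedAddCommGroup X] [NormedSpace ℝ X]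
    [NormedAddCommGroup Y] [NormedSpace ℝ Y] {C α β : ℝ} {S : ℝ → X →L[ℝ] Y} {F : ℝ → X}
    (hS : SingularFamily C α S) (hαβ : α + β = 1) (hβ : β < 1) {φ : ℝ → ℝ}
    (hφ : Tendsto φ (𝓝[>] 0) (𝓝 0))
    (H : ∀ ε > 0, ∃ η > 0, ∀ t ∈ Ioo 0 η, ∀ s ∈ Ioo 0 t, ‖F s‖ ≤ φ ε * s ^ (-β)) :
    Tendsto (duhamel S F) (𝓝[>] 0) (𝓝 0) := by
  rw [tendsto_zero_iff_enorm_tendsto_zero]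
  refine tendsto_zero_of_le_add (h := fun _ => 0) tendsto_const_nhds
    (φ := fun ε => C * φ ε * betaConst α β) ?_ fun ε hε => ?_
  · simpa using (hφ.const_mul C).mul_const (betaConst α β)
  · obtain ⟨η, hη, hF⟩ := H ε hε
    refine ⟨η, hη, fun t ht => ?_⟩
    have h1 := hS.norm_duhamel_le hβ ht.1 (hF t ht)
    rw [show 1 - α - β = 0 by linarith, Real.rpow_zero, one_mul] at h1
    rw [zero_add, ← ofReal_norm]
    exact ENNReal.ofReal_le_ofReal h1

lemma continuousOn_Icc_of_tendsto {Z : Type*} [TopologicalSpace Z] {z : ℝ → Z} {T : ℝ}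
    (hz : ContinuousOn z (Ioc 0 T)) (h0 : Tendsto z (𝓝[>] 0) (𝓝 (z 0))) :
    ContinuousOn z (Icc 0 T) := by
  intro t ht
  rcases eq_or_lt_of_le ht.1 with rfl | ht0
  · have h1 : ContinuousWithinAt z (Ioi 0) 0 := h0
    exact (continuousWithinAt_Ioi_iff_Ici.1 h1).mono Icc_subset_Ici_self
  · refine (hz t ⟨ht0, ht.2⟩).mono_of_mem_nhdsWithin ?_
    filter_upwards [self_mem_nhdsWithin, mem_nhdsWithin_of_mem_nhds (lt_mem_nhds ht0)]
      with s hs hs0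
    exact ⟨hs0, hs.2⟩

namespace KatoSolution

lemma norm_tensor_le (h : KatoSolution T u₀ θ₀ u θ) : ∃ M : ℝ, ∀ s ∈ Ioc 0 T,
    ‖tensorLp (u s) (u s)‖ ≤ M * s ^ (-(1 / 4 : ℝ)) := by
  obtain ⟨M, -, hM⟩ := exists_bound_of_tendsto
    ((continuousOn_rpow_Ioc T _).smul h.continuousOn_velocity) h.tendsto_velocity
  refine ⟨‖tensorLp‖ * (M * M), fun s hs => ?_⟩
  refine (tensorLp.le_opNorm₂ _ _).trans ?_
  rw [mul_assoc, mul_assoc]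
  refine mul_le_mul_of_nonneg_left ?_ (ContinuousLinearMap.opNorm_nonneg _)
  have h1 := norm_le_of_weighted hs.1 (hM s hs)
  exact mul_rpow_le hs.1 (norm_nonneg _) (norm_nonneg _) h1 h1 (by norm_num)

lemma norm_temperature_le (h : KatoSolution T u₀ θ₀ u θ) : ∃ M : ℝ, ∀ s ∈ Ioc 0 T,
    ‖θ s‖ ≤ M * s ^ (-(3 / 8 : ℝ)) := by
  obtain ⟨M, -, hM⟩ := exists_bound_of_tendsto
    ((continuousOn_rpow_Ioc T _).smul h.continuousOn_temperature) h.tendsto_temperature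
  exact ⟨M, fun s hs => norm_le_of_weighted hs.1 (hM s hs)⟩

lemma norm_flux_le (h : KatoSolution T u₀ θ₀ u θ) : ∃ M : ℝ, ∀ s ∈ Ioc 0 T,
    ‖fluxLp (θ s) (u s)‖ ≤ M * s ^ (-(1 / 2 : ℝ)) := by
  obtain ⟨M, -, hM⟩ := exists_bound_of_tendsto
    ((continuousOn_rpow_Ioc T _).smul h.continuousOn_velocity) h.tendsto_velocity
  obtain ⟨M', hM'⟩ := h.norm_temperature_le
  refine ⟨‖fluxLp‖ * (M' * M), fun s hs => ?_⟩
  refine (fluxLp.le_opNorm₂ _ _).trans ?_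
  rw [mul_assoc, mul_assoc]
  refine mul_le_mul_of_nonneg_left ?_ (ContinuousLinearMap.opNorm_nonneg _)
  exact mul_rpow_le hs.1 (norm_nonneg _) (norm_nonneg _) (hM' s hs)
    (norm_le_of_weighted hs.1 (hM s hs)) (by norm_num)

/-- At t = 0 the heat semigroup is strongly continuous on L³, and the two Duhamel terms vanish
because the weighted norms of the solution do. -/
lemma continuousOn_velocityThree (h : KatoSolution T u₀ θ₀ u θ) (hT : 0 < T) :
    ContinuousOn (velocityThree u₀ u θ) (Icc 0 T) := by
  have hEq : ∀ t, 0 < t → velocityThree u₀ u θ t =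
      convOp (heatKernel E3) (youngTriple_one (p := 3) (by norm_num)) t u₀
      - duhamel inertiaThree (fun s => tensorLp (u s) (u s)) t + duhamel buoyancyThree θ t :=
    fun t ht => if_neg ht.ne'
  obtain ⟨M, hM⟩ := h.norm_tensor_le
  obtain ⟨M', hM'⟩ := h.norm_temperature_le
  refine continuousOn_Icc_of_tendsto ?_ ?_
  · have h1 : ContinuousOn (fun t => convOp (heatKernel E3)
        (youngTriple_one (p := 3) (by norm_num)) t u₀) (Ioc 0 T) :=
      (((kernelFamily_heat E3 4).continuousOn_convOp (decayExponent_of_one_le Fact.out) _).clm_apply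
        continuousOn_const).mono DuhamelSystem.Ioc_subset_Ioi
    have h2 := singularFamily_inertiaThree.continuousOn_duhamel (β := 1 / 4) (by norm_num)
      ((tensorLp.continuous.comp_continuousOn h.continuousOn_velocity).clm_apply
        h.continuousOn_velocity) hM
    have h3 := singularFamily_buoyancyThree.continuousOn_duhamel (β := 3 / 8) (by norm_num)
      h.continuousOn_temperature hM'
    exact ((h1.sub h2).add h3).congr fun t ht => hEq t ht.1
  · have h1 := tendsto_convOp_heat (youngTriple_one (p := 3) (by norm_num)) u₀
    have h2 : Tendsto (duhamel inertiaThree fun s => tensorLp (u s) (u s)) (𝓝[>] 0) (𝓝 0) := by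
      refine singularFamily_inertiaThree.tendsto_duhamel (β := 1 / 4) (by norm_num) (by norm_num)
        (φ := fun ε => ‖tensorLp‖ * (ε * ε)) ?_ fun ε hε => ?_
      · have : Continuous fun ε : ℝ => ‖tensorLp‖ * (ε * ε) := by fun_prop
        simpa using (this.tendsto 0).mono_left (nhdsWithin_le_nhds (s := Ioi 0))
      · obtain ⟨η, hη, hb⟩ := h.exists_small_katoBound hT hε
        exact ⟨η, hη, fun t ht => (hb t ht).norm_tensor_le⟩
    have h3 : Tendsto (duhamel buoyancyThree θ) (𝓝[>] 0) (𝓝 0) := by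
      refine singularFamily_buoyancyThree.tendsto_duhamel (β := 3 / 8) (by norm_num) (by norm_num)
        (φ := fun ε => ε) (tendsto_id.mono_left nhdsWithin_le_nhds) fun ε hε => ?_
      obtain ⟨η, hη, hb⟩ := h.exists_small_katoBound hT hε
      exact ⟨η, hη, fun t ht => (hb t ht).norm_temperature_le⟩
    have h4 := (h1.sub h2).add h3
    rw [sub_zero, add_zero] at h4
    rw [show velocityThree u₀ u θ 0 = u₀ from if_pos rfl]
    refine h4.congr' ?_
    filter_upwards [self_mem_nhdsWithin] with t ht
    exact (hEq t ht).symm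

lemma continuousOn_temperatureOne (h : KatoSolution T u₀ θ₀ u θ) (hT : 0 < T) :
    ContinuousOn (temperatureOne θ₀ u θ) (Icc 0 T) := by
  have hEq : ∀ t, 0 < t → temperatureOne θ₀ u θ t =
      convOp (heatKernel ℝ) (youngTriple_one (p := 1) (by norm_num)) t θ₀
      - duhamel transportOne (fun s => fluxLp (θ s) (u s)) t := fun t ht => if_neg ht.ne'
  obtain ⟨M, hM⟩ := h.norm_flux_le
  refine continuousOn_Icc_of_tendsto ?_ ?_
  · have h1 : ContinuousOn (fun t => convOp (heatKernel ℝ)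
        (youngTriple_one (p := 1) (by norm_num)) t θ₀) (Ioc 0 T) :=
      (((kernelFamily_heat ℝ 4).continuousOn_convOp (decayExponent_of_one_le Fact.out) _).clm_apply
        continuousOn_const).mono DuhamelSystem.Ioc_subset_Ioi
    have h2 := singularFamily_transportOne.continuousOn_duhamel (β := 1 / 2) (by norm_num)
      ((fluxLp.continuous.comp_continuousOn h.continuousOn_temperature).clm_apply
        h.continuousOn_velocity) hM
    exact (h1.sub h2).congr fun t ht => hEq t ht.1
  · have h1 := tendsto_convOp_heat (youngTriple_one (p := 1) (by norm_num)) θ₀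
    have h2 : Tendsto (duhamel transportOne fun s => fluxLp (θ s) (u s)) (𝓝[>] 0) (𝓝 0) := by
      refine singularFamily_transportOne.tendsto_duhamel (β := 1 / 2) (by norm_num) (by norm_num)
        (φ := fun ε => ‖fluxLp‖ * (ε * ε)) ?_ fun ε hε => ?_
      · have : Continuous fun ε : ℝ => ‖fluxLp‖ * (ε * ε) := by fun_prop
        simpa using (this.tendsto 0).mono_left (nhdsWithin_le_nhds (s := Ioi 0))
      · obtain ⟨η, hη, hb⟩ := h.exists_small_katoBound hT hε
        exact ⟨η, hη, fun t ht => (hb t ht).norm_flux_le⟩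
    have h4 := h1.sub h2
    rw [sub_zero] at h4
    rw [show temperatureOne θ₀ u θ 0 = θ₀ from if_pos rfl]
    refine h4.congr' ?_
    filter_upwards [self_mem_nhdsWithin] with t ht
    exact (hEq t ht).symm

end KatoSolution

end ThreeOne

lemma ofReal_rpow_mul_le {t e K : ℝ} (ht : 0 < t) {a b : ℝ≥0∞}
    (h : a ≤ b + ENNReal.ofReal (K * t ^ (-e))) :
    ENNReal.ofReal (t ^ e) * a ≤ ENNReal.ofReal (t ^ e) * b + ENNReal.ofReal K := by
  calc ENNReal.ofReal (t ^ e) * a ≤ ENNReal.ofReal (t ^ e) * (b + ENNReal.ofReal (K * t ^ (-e))) := by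
        gcongr
    _ = _ := by
        rw [mul_add, ← ENNReal.ofReal_mul (by positivity),
          show t ^ e * (K * t ^ (-e)) = K * (t ^ e * t ^ (-e)) by ring, ← Real.rpow_add ht,
          add_neg_cancel, Real.rpow_zero, mul_one]

/-! ### Divergence -/

section Divergence

/-- Restates the condition through continuous functionals on L³, which are linear and commute with
Bochner integrals. -/
lemma isDivergenceFree_iff_gradPairing {f : VectorL3} : IsDivergenceFree f ↔
    ∀ (φ : E3 → ℝ) (hφ : ContDiff ℝ (⊤ : ℕ∞) φ) (hc : HasCompactSupport φ),
      gradPairing hφ hc (3 / 2) 3 f = 0 :=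
  forall_congr' fun φ => forall_congr' fun hφ => forall_congr' fun hc => by rw [gradPairing_apply]

lemma isDivergenceFree_Lp_add {f g : VectorL3} (hf : IsDivergenceFree f) (hg : IsDivergenceFree g) :
    IsDivergenceFree (f + g : VectorL3) := by
  rw [isDivergenceFree_iff_gradPairing] at *
  intro φ hφ hc
  rw [map_add, hf, hg, add_zero]

lemma isDivergenceFree_Lp_sub {f g : VectorL3} (hf : IsDivergenceFree f) (hg : IsDivergenceFree g) :
    IsDivergenceFree (f - g : VectorL3) := by
  rw [isDivergenceFree_iff_gradPairing] at *
  intro φ hφ hc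
  rw [map_sub, hf, hg, sub_zero]

/-- The gradient pairing passes inside the integral, and for almost every s the integrand is a
convolution with a kernel of zero divergence. -/
lemma isDivergenceFree_duhamel {V : Type*} [NormedAddCommGroup V] [NormedSpace ℝ V]
    {a N α β M t : ℝ} {K : ℝ → E3 → V →L[ℝ] E3} {r r' q : ℝ≥0∞} [Fact (1 ≤ r)] [Fact (1 ≤ q)]
    [r'.HolderConjugate q] (hK : KernelFamily a N K) (hY : YoungTriple r q 3)
    (hr : DecayExponent N r) (hα : α = a - 3 / (2 * r.toReal)) (hα1 : α < 1)
    (hr' : DecayExponent N r')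
    (hdiv : ∀ τ : ℝ, 0 < τ → ∀ φ : E3 → ℝ, ContDiff ℝ (⊤ : ℕ∞) φ → HasCompactSupport φ → ∀ v,
      ∫ x, fderiv ℝ φ x (K τ x v) = 0)
    {F : ℝ → Lp V q (volume : Measure E3)} (hβ : β < 1) (ht : 0 < t)
    (hF : ContinuousOn F (Ioo 0 t)) (hM : ∀ s ∈ Ioo 0 t, ‖F s‖ ≤ M * s ^ (-β)) :
    IsDivergenceFree (duhamel (convOp K hY) F t : VectorL3) := by
  rw [isDivergenceFree_iff_gradPairing]
  intro φ hφ hc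
  rw [duhamel, ← ContinuousLinearMap.intervalIntegral_comp_comm _
    ((hK.singularFamily hr hY hα hα1).intervalIntegrable hβ ht hF hM)]
  refine intervalIntegral.integral_zero_ae ?_
  have : ∀ᵐ s : ℝ, s ≠ t := by simp [ae_iff]
  filter_upwards [this] with s h1 h2
  rw [uIoc_of_le ht.le] at h2
  have hτ : 0 < t - s := sub_pos.2 (lt_of_le_of_ne h2.2 h1)
  exact isDivergenceFree_iff_gradPairing.1 (isDivergenceFree_congr
    (hK.convOp_ae_eq hr hY hτ (F s)).symm (isDivergenceFree_kconv (hK.memLp hr' hτ) (Lp.memLp (F s))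
      (hdiv _ hτ))) φ hφ hc

end Divergence

/-! ### Vanishing at t = 0 and membership in X and Y -/

section Solution

variable {T A B : ℝ} {u₀ : VectorL3} {θ₀ : ScalarL1} {u : ℝ → VelocityL4} {θ : ℝ → TemperatureL43}

namespace KatoSolution

lemma isDivergenceFree_velocityThree (h : KatoSolution T u₀ θ₀ u θ) (hu₀ : IsDivergenceFree u₀)
    {t : ℝ} (ht : t ∈ Icc 0 T) : IsDivergenceFree (velocityThree u₀ u θ t) := by
  rcases eq_or_lt_of_le ht.1 with rfl | ht0
  · rwa [show velocityThree u₀ u θ 0 = u₀ from if_pos rfl]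
  obtain ⟨m, n, -, -, hb⟩ := h.exists_katoBound
  have hb := hb t ⟨ht0, ht.2⟩
  rw [velocityThree, if_neg ht0.ne']
  refine isDivergenceFree_Lp_add (isDivergenceFree_Lp_sub ?_ ?_) ?_
  · exact isDivergenceFree_congr ((kernelFamily_heat E3 4).convOp_ae_eq
      (decayExponent_of_one_le Fact.out) _ ht0 u₀).symm
      (isDivergenceFree_kconv_scalar (r := 3 / 2) (memLp_heatKernel (r := 3 / 2) Fact.out ht0)
        (Lp.memLp u₀) hu₀)
  · exact isDivergenceFree_duhamel (r' := 2) kernelFamily_lerayDiv _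
      (decayExponent_of_toReal Fact.out (by norm_num)) rfl (by norm_num)
      (decayExponent_of_toReal Fact.out (by norm_num))
      (fun τ hτ φ hφ hc v => integral_fderiv_lerayDivKernel hτ hφ hc v) (by norm_num) ht0
      hb.continuousOn_tensor hb.norm_tensor_le
  · exact isDivergenceFree_duhamel (r' := 4) kernelFamily_buoyancy _
      (decayExponent_of_toReal Fact.out (by norm_num)) rfl (by norm_num)
      (decayExponent_of_toReal Fact.out (by norm_num))
      (fun τ hτ φ hφ hc v => integral_fderiv_buoyancyKernel hτ hφ hc v) (by norm_num) ht0
      hb.continuousOn_temperature hb.norm_temperature_le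

/-- In the propagation estimate A and B stay fixed while the Kato constants on (0, t) may be
replaced by any ε > 0. Each nonlinear or buoyancy contribution contains a positive power of ε, and
the heat evolution of the data vanishes by itself. -/
lemma tendsto_top (h : KatoSolution T u₀ θ₀ u θ) (hT : 0 < T) (htop : TopBound T A B u θ) :
    Tendsto (fun t : ℝ => ENNReal.ofReal (t ^ (1 / 2 : ℝ)) * eLpNorm (u t) ⊤ volume)
      (𝓝[>] 0) (𝓝 0) ∧
    Tendsto (fun t : ℝ => ENNReal.ofReal (t ^ (3 / 2 : ℝ)) * eLpNorm (θ t) ⊤ volume)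
      (𝓝[>] 0) (𝓝 0) := by
  obtain ⟨c, hc, hb⟩ := exists_top_bound
  have htop' : ∀ t ≤ T, TopBound t A B u θ := fun t ht =>
    ⟨htop.1, htop.2, fun s hs => htop.3 s ⟨hs.1, hs.2.trans_le ht⟩,
      fun s hs => htop.4 s ⟨hs.1, hs.2.trans_le ht⟩⟩
  have key : ∀ ε > 0, ∃ η > 0, ∀ t ∈ Ioo 0 η,
      eLpNorm (u t) ⊤ volume ≤ eLpNorm (heatVelocity u₀ t) ⊤ volume + ENNReal.ofReal
        (c * (A * ε + B ^ (1 / 3 : ℝ) * ε ^ (2 / 3 : ℝ)) * t ^ (-(1 / 2 : ℝ))) ∧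
      eLpNorm (θ t) ⊤ volume ≤ eLpNorm (heatTemperature θ₀ t) ⊤ volume +
        ENNReal.ofReal (c * (ε * (ε + B)) * t ^ (-(3 / 2 : ℝ))) := by
    intro ε hε
    obtain ⟨η, hη, hkb⟩ := h.exists_small_katoBound hT hε
    refine ⟨min η T, lt_min hη hT, fun t ht => ?_⟩
    have ht' := lt_min_iff.1 ht.2
    have h1 := hb (heatVelocity u₀) (heatTemperature θ₀) (hkb t ⟨ht.1, ht'.1⟩) (le_of_lt hε)
      (le_of_lt hε) (htop' t ht'.2.le)
    rwa [← h.velocity_eq t ⟨ht.1, ht'.2.le⟩, ← h.temperature_eq t ⟨ht.1, ht'.2.le⟩] at h1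
  constructor
  · refine tendsto_zero_of_le_add (tendsto_top_heatVelocity u₀)
      (φ := fun ε => c * (A * ε + B ^ (1 / 3 : ℝ) * ε ^ (2 / 3 : ℝ))) ?_ fun ε hε => ?_
    · have h1 : Tendsto (fun ε : ℝ => ε) (𝓝[>] 0) (𝓝 0) := tendsto_id.mono_left nhdsWithin_le_nhds
      have h2 := ((h1.const_mul A).add ((tendsto_rpow_zero (e := 2 / 3) (by norm_num)).const_mul
        (B ^ (1 / 3 : ℝ)))).const_mul c
      simpa using h2
    · obtain ⟨η, hη, hk⟩ := key ε hε
      exact ⟨η, hη, fun t ht => ofReal_rpow_mul_le ht.1 (hk t ht).1⟩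
  · refine tendsto_zero_of_le_add (tendsto_top_heatTemperature θ₀)
      (φ := fun ε => c * (ε * (ε + B))) ?_ fun ε hε => ?_
    · have : Continuous fun ε : ℝ => c * (ε * (ε + B)) := by fun_prop
      simpa using (this.tendsto 0).mono_left (nhdsWithin_le_nhds (s := Ioi 0))
    · obtain ⟨η, hη, hk⟩ := key ε hε
      exact ⟨η, hη, fun t ht => ofReal_rpow_mul_le ht.1 (hk t ht).2⟩

end KatoSolution

lemma iSup_eLpNorm_lt_top {V : Type*} [NormedAddCommGroup V] {p : ℝ≥0∞} [Fact (1 ≤ p)]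
    {z : ℝ → Lp V p (volume : Measure E3)} (hz : ContinuousOn z (Icc 0 T)) :
    ⨆ t ∈ Icc 0 T, eLpNorm (z t) p volume < ⊤ := by
  obtain ⟨M, hM⟩ := isCompact_Icc.bddAbove_image hz.norm
  exact (iSup₂_le fun t ht => Lp.eLpNorm_le_ofReal (hM ⟨t, ht, rfl⟩)).trans_lt
    (ENNReal.ofReal_lt_top (r := M))

lemma iSup_weighted_lt_top {V : Type*} [NormedAddCommGroup V] {z : ℝ → E3 → V} {e K : ℝ}
    (h : ∀ t ∈ Ioc 0 T, eLpNorm (z t) ⊤ volume ≤ ENNReal.ofReal (K * t ^ (-e))) :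
    ⨆ t ∈ Ioc 0 T, ENNReal.ofReal (t ^ e) * eLpNorm (z t) ⊤ volume < ⊤ := by
  refine (iSup₂_le fun t ht => ?_).trans_lt (ENNReal.ofReal_lt_top (r := K))
  simpa using ofReal_rpow_mul_le (b := 0) ht.1 (by simpa using h t ht)

namespace KatoSolution

lemma memX (h : KatoSolution T u₀ θ₀ u θ) (hT : 0 < T) (hu₀ : IsDivergenceFree u₀)
    (htop : TopBound T A B u θ)
    (hu : ∀ s ∈ Ioc 0 T, eLpNorm (u s) ⊤ volume ≤ ENNReal.ofReal (A * s ^ (-(1 / 2 : ℝ)))) :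
    MemX T (velocityThree u₀ u θ) where
  continuousOn := h.continuousOn_velocityThree hT
  divergenceFree := fun t ht => h.isDivergenceFree_velocityThree hu₀ ht
  norm_lt_top := by
    refine ENNReal.add_lt_top.2 ⟨iSup_eLpNorm_lt_top (h.continuousOn_velocityThree hT), ?_⟩
    simp only [Real.sqrt_eq_rpow]
    exact iSup_weighted_lt_top (K := A) fun t ht => by
      rw [eLpNorm_congr_ae (h.velocityThree_ae_eq ht)]; exact hu t ht
  tendsto_zero := by
    refine (h.tendsto_top hT htop).1.congr' ?_
    filter_upwards [Ioo_mem_nhdsGT hT] with t ht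
    rw [eLpNorm_congr_ae (h.velocityThree_ae_eq ⟨ht.1, ht.2.le⟩), Real.sqrt_eq_rpow]

lemma memY (h : KatoSolution T u₀ θ₀ u θ) (hT : 0 < T) (htop : TopBound T A B u θ)
    (hθ : ∀ s ∈ Ioc 0 T, eLpNorm (θ s) ⊤ volume ≤ ENNReal.ofReal (B * s ^ (-(3 / 2 : ℝ)))) :
    MemY T (temperatureOne θ₀ u θ) where
  continuousOn := h.continuousOn_temperatureOne hT
  norm_lt_top := by
    refine ENNReal.add_lt_top.2 ⟨iSup_eLpNorm_lt_top (h.continuousOn_temperatureOne hT), ?_⟩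
    exact iSup_weighted_lt_top (K := B) fun t ht => by
      rw [eLpNorm_congr_ae (h.temperatureOne_ae_eq ht)]; exact hθ t ht
  tendsto_zero := by
    refine (h.tendsto_top hT htop).2.congr' ?_
    filter_upwards [Ioo_mem_nhdsGT hT] with t ht
    rw [eLpNorm_congr_ae (h.temperatureOne_ae_eq ⟨ht.1, ht.2.le⟩)]

end KatoSolution

end Solution

/-! ### Mild solutions and solutions in the weighted class -/

section Multipliers

variable {τ : ℝ} {u : VelocityL4} {θ : TemperatureL43} {v : E3 → E3} {η : E3 → ℝ}

lemma flux_ae_eq (hv : v =ᵐ[volume] u) (hη : η =ᵐ[volume] θ) :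
    (fun y => η y • v y) =ᵐ[volume] fluxLp θ u := by
  filter_upwards [hv, hη, fluxLp_ae_eq θ u] with y h1 h2 h3
  rw [h3, h1, h2]

lemma tensor_ae_eq (hv : v =ᵐ[volume] u) :
    (fun y => tensorL (v y) (v y)) =ᵐ[volume] tensorLp u u := by
  filter_upwards [hv, tensorLp_ae_eq u u] with y h1 h2
  rw [h2, h1]

/-- The product lies in L¹ and the kernel is bounded, so convergence holds at every point x. The two
following statements pair L² with L² and L^{4/3} with L⁴ in the same way. -/
lemma multiplierConverges_heatDiv (hτ : 0 < τ) (hv : v =ᵐ[volume] u) (hη : η =ᵐ[volume] θ)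
    (l : Fin 3) (x : E3) :
    MultiplierConverges (heatDivSymbol τ l) (fun y => η y * v y l) x := by
  refine (scalarFamily_heatDiv l).multiplierConverges (r := ⊤) (q := 1) hτ decayExponent_top ?_ x
  refine (memLp_congr_ae ?_).1 ((coord l).comp_memLp' (Lp.memLp (fluxLp θ u)))
  filter_upwards [flux_ae_eq hv hη] with y hy
  rw [Function.comp_apply, ← hy]
  rfl

lemma multiplierConverges_heatLerayDiv (hτ : 0 < τ) (hv : v =ᵐ[volume] u) (k j l : Fin 3) (x : E3) :
    MultiplierConverges (heatLerayDivSymbol τ k j l) (fun y => v y l * v y j) x := by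
  refine (scalarFamily_heatLerayDiv k j l).multiplierConverges (r := 2) (q := 2) hτ
    (decayExponent_of_toReal Fact.out (by norm_num)) ?_ x
  refine (memLp_congr_ae ?_).1 (((ContinuousLinearMap.proj (R := ℝ) (φ := fun _ : Fin 3 => ℝ) j).comp
    (ContinuousLinearMap.proj (R := ℝ) (φ := fun _ : Fin 3 => Fin 3 → ℝ) l)).comp_memLp'
      (Lp.memLp (tensorLp u u)))
  filter_upwards [tensor_ae_eq hv] with y hy
  rw [Function.comp_apply, ← hy]
  rfl

lemma multiplierConverges_heatLeray (hτ : 0 < τ) (hη : η =ᵐ[volume] θ) (k j : Fin 3) (x : E3) :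
    MultiplierConverges (heatLeraySymbol τ k j) η x :=
  (scalarFamily_heatLeray k j).multiplierConverges (r := 4) (q := 4 / 3) hτ
    (decayExponent_of_toReal Fact.out (by norm_num)) ((memLp_congr_ae hη).2 (Lp.memLp θ)) x

lemma heatDiv_flux (hτ : 0 < τ) (hv : v =ᵐ[volume] u) (hη : η =ᵐ[volume] θ) (x : E3) :
    heatDiv τ (fun y => η y • v y) x = kconv (divKernel τ) (fluxLp θ u) x := by
  rw [heatDiv_eq_kconv fun l => multiplierConverges_heatDiv hτ hv hη l x,
    kconv_congr EventuallyEq.rfl (flux_ae_eq hv hη)]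

lemma heatLerayDiv_tensor (hτ : 0 < τ) (hv : v =ᵐ[volume] u) (x : E3) :
    heatLerayDiv τ (tensor v v) x = kconv (lerayDivKernel τ) (tensorLp u u) x := by
  rw [heatLerayDiv_eq_kconv fun k j l => multiplierConverges_heatLerayDiv hτ hv k j l x,
    kconv_congr EventuallyEq.rfl (tensor_ae_eq hv)]

lemma heatLeray_buoyancy (hτ : 0 < τ) (hη : η =ᵐ[volume] θ) (x : E3) :
    heatLeray τ (fun y => η y • e3) x = kconv (buoyancyKernel τ) θ x := by
  rw [heatLeray_eq_kconv fun k => multiplierConverges_heatLeray hτ hη k 2 x,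
    kconv_congr EventuallyEq.rfl hη]

end Multipliers

lemma intervalIntegrable_congr_Ioo {W : Type*} [NormedAddCommGroup W] {t : ℝ} {f g : ℝ → W}
    (ht : 0 ≤ t) (h : EqOn f g (Ioo 0 t)) (hg : IntervalIntegrable g volume 0 t) :
    IntervalIntegrable f volume 0 t := by
  rw [intervalIntegrable_iff_integrableOn_Ioo_of_le ht] at hg ⊢
  exact hg.congr_fun h.symm measurableSet_Ioo

lemma integral_congr_Ioo {W : Type*} [NormedAddCommGroup W] [NormedSpace ℝ W] {t : ℝ} {f g : ℝ → W}
    (ht : 0 ≤ t) (h : EqOn f g (Ioo 0 t)) : ∫ s in (0 : ℝ)..t, f s = ∫ s in (0 : ℝ)..t, g s := by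
  rw [intervalIntegral.integral_of_le ht, intervalIntegral.integral_of_le ht,
    integral_Ioc_eq_integral_Ioo, integral_Ioc_eq_integral_Ioo]
  exact setIntegral_congr_fun measurableSet_Ioo h

namespace KatoBound

variable {u : ℝ → VelocityL4} {θ : ℝ → TemperatureL43} {t m n : ℝ} {v : ℝ → VectorL3}
  {η : ℝ → ScalarL1}

lemma intervalIntegrable (h : KatoBound t m n u θ) (hv : ∀ s ∈ Ioo 0 t, v s =ᵐ[volume] u s)
    (hη : ∀ s ∈ Ioo 0 t, η s =ᵐ[volume] θ s) : ∀ᵐ x : E3,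
    IntervalIntegrable (fun s => heatDiv (t - s) (fun y => η s y • v s y) x) volume 0 t ∧
    IntervalIntegrable (fun s => heatLerayDiv (t - s) (tensor (v s) (v s)) x) volume 0 t ∧
    IntervalIntegrable (fun s => heatLeray (t - s) (fun y => η s y • e3) x) volume 0 t := by
  have h0 := h.time_pos.le
  filter_upwards [h.transport_ae_eq youngTriple_transport
      (decayExponent_of_toReal Fact.out (by norm_num)) (by norm_num),
    h.inertia_ae_eq youngTriple_inertia
      (decayExponent_of_toReal Fact.out (by norm_num)) (by norm_num),
    h.buoyancy_ae_eq youngTriple_buoyancy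
      (decayExponent_of_toReal Fact.out (by norm_num)) (by norm_num)] with x h1 h2 h3
  exact ⟨intervalIntegrable_congr_Ioo h0
      (fun s hs => heatDiv_flux (sub_pos.2 hs.2) (hv s hs) (hη s hs) x) h1.1,
    intervalIntegrable_congr_Ioo h0
      (fun s hs => heatLerayDiv_tensor (sub_pos.2 hs.2) (hv s hs) x) h2.1,
    intervalIntegrable_congr_Ioo h0
      (fun s hs => heatLeray_buoyancy (sub_pos.2 hs.2) (hη s hs) x) h3.1⟩

lemma velocityRHS_ae_eq_heat {u₀ : VectorL3} (h : KatoBound t m n u θ)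
    (hv : ∀ s ∈ Ioo 0 t, v s =ᵐ[volume] u s) (hη : ∀ s ∈ Ioo 0 t, η s =ᵐ[volume] θ s) :
    ∀ᵐ x : E3, system.velocityRHS (heatVelocity u₀) u θ t x =
      heat t u₀ x - (∫ s in (0 : ℝ)..t, heatLerayDiv (t - s) (tensor (v s) (v s)) x)
      + ∫ s in (0 : ℝ)..t, heatLeray (t - s) (fun y => η s y • e3) x := by
  filter_upwards [h.velocityRHS_ae_eq (u₀ := u₀)] with x hx
  rw [hx, heat_eq_kconv,
    integral_congr_Ioo h.time_pos.le fun s hs => heatLerayDiv_tensor (sub_pos.2 hs.2) (hv s hs) x,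
    integral_congr_Ioo h.time_pos.le fun s hs => heatLeray_buoyancy (sub_pos.2 hs.2) (hη s hs) x]

lemma temperatureRHS_ae_eq_heat {θ₀ : ScalarL1} (h : KatoBound t m n u θ)
    (hv : ∀ s ∈ Ioo 0 t, v s =ᵐ[volume] u s) (hη : ∀ s ∈ Ioo 0 t, η s =ᵐ[volume] θ s) :
    ∀ᵐ x : E3, system.temperatureRHS (heatTemperature θ₀) u θ t x =
      heat t θ₀ x - ∫ s in (0 : ℝ)..t, heatDiv (t - s) (fun y => η s y • v s y) x := by
  filter_upwards [h.temperatureRHS_ae_eq (θ₀ := θ₀)] with x hx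
  rw [hx, heat_eq_kconv,
    integral_congr_Ioo h.time_pos.le fun s hs =>
      heatDiv_flux (sub_pos.2 hs.2) (hv s hs) (hη s hs) x]

end KatoBound

section Mild

variable {T : ℝ} {u₀ : VectorL3} {θ₀ : ScalarL1} {u : ℝ → VelocityL4} {θ : ℝ → TemperatureL43}

lemma KatoSolution.isMildSolution (h : KatoSolution T u₀ θ₀ u θ) :
    IsMildSolution T u₀ θ₀ (velocityThree u₀ u θ) (temperatureOne θ₀ u θ) := by
  obtain ⟨m, n, -, -, hb⟩ := h.exists_katoBound
  have hsub : ∀ t ∈ Ioc 0 T, Ioo 0 t ⊆ Ioc 0 T := fun t ht s hs => ⟨hs.1, hs.2.le.trans ht.2⟩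
  have hv : ∀ t ∈ Ioc 0 T, ∀ s ∈ Ioo 0 t, velocityThree u₀ u θ s =ᵐ[volume] u s :=
    fun t ht s hs => h.velocityThree_ae_eq (hsub t ht hs)
  have hη : ∀ t ∈ Ioc 0 T, ∀ s ∈ Ioo 0 t, temperatureOne θ₀ u θ s =ᵐ[volume] θ s :=
    fun t ht s hs => h.temperatureOne_ae_eq (hsub t ht hs)
  refine ⟨if_pos rfl, if_pos rfl, fun t ht => ?_, fun t ht => ?_, fun t ht => ?_, fun t ht => ?_⟩
  · refine Eventually.of_forall fun x => Eventually.of_forall fun s hs => ?_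
    have hτ : 0 < t - s := sub_pos.2 hs.2
    refine ⟨fun l => multiplierConverges_heatDiv hτ (hv t ht s hs) (hη t ht s hs) l x,
      fun k j l => multiplierConverges_heatLerayDiv hτ (hv t ht s hs) k j l x, fun k j => ?_⟩
    have := (multiplierConverges_heatLeray hτ (hη t ht s hs) k j x).mul_const (e3 j)
    simpa only [MultiplierConverges, mul_assoc] using this
  · exact (hb t ht).intervalIntegrable (hv t ht) (hη t ht)
  · have h1 := h.temperatureOne_ae_eq ht
    have h2 := (hb t ht).temperatureRHS_ae_eq_heat (θ₀ := θ₀) (hv t ht) (hη t ht)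
    rw [← h.temperature_eq t ht] at h2
    filter_upwards [h1, h2] with x hx1 hx2
    exact hx1.trans hx2
  · have h1 := h.velocityThree_ae_eq ht
    have h2 := (hb t ht).velocityRHS_ae_eq_heat (u₀ := u₀) (hv t ht) (hη t ht)
    rw [← h.velocity_eq t ht] at h2
    filter_upwards [h1, h2] with x hx1 hx2
    exact hx1.trans hx2

/-- On a Kato path the pointwise integrals of the mild formulation are the values of the Bochner
integrals, so the pointwise equations become equations in L⁴ and L^{4/3}. -/
lemma IsMildSolution.katoSolution {v : ℝ → VectorL3} {η : ℝ → ScalarL1}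
    (h : IsMildSolution T u₀ θ₀ v η) (hp : KatoPath T u θ)
    (hv : ∀ s ∈ Ioc 0 T, v s =ᵐ[volume] u s) (hη : ∀ s ∈ Ioc 0 T, η s =ᵐ[volume] θ s) :
    KatoSolution T u₀ θ₀ u θ := by
  obtain ⟨m, n, -, -, hb⟩ := hp.exists_katoBound
  have hsub : ∀ t ∈ Ioc 0 T, Ioo 0 t ⊆ Ioc 0 T := fun t ht s hs => ⟨hs.1, hs.2.le.trans ht.2⟩
  refine ⟨hp, fun t ht => Lp.ext ?_, fun t ht => Lp.ext ?_⟩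
  · filter_upwards [hv t ht, h.velocity t ht, (hb t ht).velocityRHS_ae_eq_heat (u₀ := u₀)
      (fun s hs => hv s (hsub t ht hs)) (fun s hs => hη s (hsub t ht hs))] with x h1 h2 h3
    rw [h3, ← h1, h2]
  · filter_upwards [hη t ht, h.temperature t ht, (hb t ht).temperatureRHS_ae_eq_heat (θ₀ := θ₀)
      (fun s hs => hv s (hsub t ht hs)) (fun s hs => hη s (hsub t ht hs))] with x h1 h2 h3
    rw [h3, ← h1, h2]

end Mild

/-! ### Interpolation of paths -/

section Paths

variable {V : Type*} [NormedAddCommGroup V] {p q : ℝ≥0∞}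

/-- A path in `L^p`, regarded as a path in `L^q` where it takes values there. -/
def changeExponent (q : ℝ≥0∞) (z : ℝ → Lp V p (volume : Measure E3)) (t : ℝ) :
    Lp V q (volume : Measure E3) :=
  open Classical in if h : MemLp (z t) q volume then h.toLp else 0

lemma changeExponent_ae_eq {z : ℝ → Lp V p (volume : Measure E3)} {t : ℝ}
    (h : MemLp (z t) q volume) : changeExponent q z t =ᵐ[volume] z t := by
  rw [changeExponent, dif_pos h]
  exact h.coeFn_toLp

variable [Fact (1 ≤ p)] {η T e A : ℝ} {z : ℝ → Lp V p (volume : Measure E3)}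

lemma memLp_of_top {f : Lp V p (volume : Measure E3)} (hpq : p ≤ q) (hq : q ≠ ⊤)
    (h : eLpNorm f ⊤ volume ≤ ENNReal.ofReal A) : MemLp f q volume := by
  refine ⟨(Lp.memLp f).1, (eLpNorm_le_of_interpolation (x := max A 0) (y := ‖f‖) Fact.out hpq hq
    (Lp.memLp f).1 (le_max_right _ _) (norm_nonneg f) rfl ?_
    (Lp.eLpNorm_le_ofReal le_rfl)).trans_lt ENNReal.ofReal_lt_top⟩
  exact h.trans (ENNReal.ofReal_le_ofReal (le_max_left _ _))

lemma norm_le_of_top {f : Lp V p (volume : Measure E3)} {g : Lp V q (volume : Measure E3)}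
    (hpq : p ≤ q) (hq : q ≠ ⊤) (hη : η = p.toReal / q.toReal) (hA : 0 ≤ A)
    (hfg : g =ᵐ[volume] f) (h : eLpNorm f ⊤ volume ≤ ENNReal.ofReal A) :
    ‖g‖ ≤ A ^ (1 - η) * ‖f‖ ^ η := by
  have := eLpNorm_le_of_interpolation Fact.out hpq hq (Lp.memLp f).1 hA (norm_nonneg f) hη h
    (Lp.eLpNorm_le_ofReal le_rfl)
  rw [← eLpNorm_congr_ae hfg] at this
  rw [Lp.norm_def]
  exact ENNReal.toReal_le_of_le_ofReal (by positivity) this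

/-- Continuity in L^q follows by interpolating increments: they tend to zero in L^p and remain
bounded in L^∞. Continuity in L^∞ is not needed. -/
lemma continuousOn_changeExponent [Fact (1 ≤ q)] (hpq : p ≤ q) (hq : q ≠ ⊤) (he : 0 ≤ e) (hA : 0 ≤ A)
    (hz : ContinuousOn z (Ioc 0 T))
    (h : ∀ t ∈ Ioc 0 T, eLpNorm (z t) ⊤ volume ≤ ENNReal.ofReal (A * t ^ (-e))) :
    ContinuousOn (changeExponent q z) (Ioc 0 T) := by
  intro t ht
  have hP : 0 < p.toReal := ENNReal.toReal_pos (zero_lt_one.trans_le Fact.out).ne'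
    (ne_top_of_le_ne_top hq hpq)
  have hQ : 0 < q.toReal := ENNReal.toReal_pos (zero_lt_one.trans_le Fact.out).ne' hq
  have hη : 0 < p.toReal / q.toReal := by positivity
  have ht0 : 0 < t / 2 := half_pos ht.1
  set D := A * (t / 2) ^ (-e) with hD
  -- D bounds the L^∞ norm for all times s ≥ t/2, a neighbourhood of t on which the weight is not
  -- singular.
  have hD0 : 0 ≤ D := by positivity
  have hbound : ∀ s ∈ Ioc 0 T, t / 2 ≤ s → eLpNorm (z s) ⊤ volume ≤ ENNReal.ofReal D := by
    intro s hs hts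
    refine (h s hs).trans (ENNReal.ofReal_le_ofReal (mul_le_mul_of_nonneg_left ?_ hA))
    exact Real.rpow_le_rpow_of_nonpos ht0 hts (by linarith)
  rw [ContinuousWithinAt, tendsto_iff_norm_sub_tendsto_zero]
  have hlim : Tendsto (fun s => (D + D) ^ (1 - p.toReal / q.toReal) *
      ‖z s - z t‖ ^ (p.toReal / q.toReal)) (𝓝[Ioc 0 T] t) (𝓝 0) := by
    have h1 := (tendsto_iff_norm_sub_tendsto_zero.1 (hz t ht)).rpow_const
      (p := p.toReal / q.toReal) (Or.inr hη.le)
    rw [Real.zero_rpow hη.ne'] at h1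
    simpa using h1.const_mul ((D + D) ^ (1 - p.toReal / q.toReal))
  refine squeeze_zero' (Eventually.of_forall fun s => norm_nonneg _) ?_ hlim
  filter_upwards [self_mem_nhdsWithin, mem_nhdsWithin_of_mem_nhds
    (lt_mem_nhds (half_lt_self ht.1))] with s hs hts
  have hbs := hbound s hs hts.le
  have hbt := hbound t ht (half_le_self ht.1.le)
  refine norm_le_of_top hpq hq rfl (by positivity) ?_ ?_
  · filter_upwards [Lp.coeFn_sub (changeExponent q z s) (changeExponent q z t),
      Lp.coeFn_sub (z s) (z t), changeExponent_ae_eq (memLp_of_top hpq hq hbs),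
      changeExponent_ae_eq (memLp_of_top hpq hq hbt)] with x h1 h2 h3 h4
    rw [h1, h2, Pi.sub_apply, Pi.sub_apply, h3, h4]
  · rw [eLpNorm_congr_ae (Lp.coeFn_sub (z s) (z t)), ENNReal.ofReal_add hD0 hD0]
    exact (eLpNorm_sub_le (Lp.memLp _).1 (Lp.memLp _).1 le_top).trans (add_le_add hbs hbt)

/-- The L^p norm is merely bounded; the vanishing comes from the weighted L^∞ norm, which enters
with the exponent 1 - p/q. This is positive because p < q strictly. -/
lemma tendsto_changeExponent [NormedSpace ℝ V] [Fact (1 ≤ q)] {e' : ℝ}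
    (hpq : p < q) (hq : q ≠ ⊤) (hT : 0 < T)
    (he' : e' = e * (1 - p.toReal / q.toReal)) {M : ℝ}
    (hM : ∀ t ∈ Ioc 0 T, ‖z t‖ ≤ M)
    (h : ∀ t ∈ Ioc 0 T, eLpNorm (z t) ⊤ volume ≤ ENNReal.ofReal (A * t ^ (-e)))
    (h0 : Tendsto (fun t : ℝ => ENNReal.ofReal (t ^ e) * eLpNorm (z t) ⊤ volume) (𝓝[>] 0) (𝓝 0)) :
    Tendsto (fun t : ℝ => t ^ e' • changeExponent q z t) (𝓝[>] 0) (𝓝 0) := by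
  have hP : 0 < p.toReal := ENNReal.toReal_pos (zero_lt_one.trans_le Fact.out).ne' hpq.ne_top
  have hPQ : p.toReal < q.toReal := ENNReal.toReal_strict_mono hq hpq
  have hη1 : 0 < 1 - p.toReal / q.toReal := by
    rw [sub_pos, div_lt_one (hP.trans hPQ)]
    exact hPQ
  have hη0 : 0 ≤ p.toReal / q.toReal := by positivity
  rw [tendsto_zero_iff_enorm_tendsto_zero]
  have hlim : Tendsto (fun t : ℝ => (ENNReal.ofReal (t ^ e) * eLpNorm (z t) ⊤ volume) ^
      (1 - p.toReal / q.toReal) * ENNReal.ofReal M ^ (p.toReal / q.toReal)) (𝓝[>] 0) (𝓝 0) := by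
    have h1 := ENNReal.Tendsto.mul_const (b := ENNReal.ofReal M ^ (p.toReal / q.toReal))
      (((ENNReal.continuous_rpow_const (y := 1 - p.toReal / q.toReal)).tendsto 0).comp h0)
      (Or.inr (ENNReal.rpow_ne_top_of_nonneg hη0 ENNReal.ofReal_ne_top))
    rwa [ENNReal.zero_rpow_of_pos hη1, zero_mul] at h1
  refine tendsto_of_tendsto_of_tendsto_of_le_of_le' tendsto_const_nhds hlim
    (Eventually.of_forall fun t => zero_le) ?_
  filter_upwards [Ioo_mem_nhdsGT hT] with t ht
  have ht' : t ∈ Ioc 0 T := ⟨ht.1, ht.2.le⟩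
  have htp : 0 < t := ht.1
  rw [Lp.enorm_def, eLpNorm_smul_Lp (by positivity),
    eLpNorm_congr_ae (changeExponent_ae_eq (memLp_of_top hpq.le hq (h t ht'))),
    ENNReal.mul_rpow_of_nonneg _ _ hη1.le, ENNReal.ofReal_rpow_of_nonneg (by positivity) hη1.le,
    ← Real.rpow_mul htp.le, ← he', mul_assoc]
  refine mul_le_mul_right ((eLpNorm_le_interpolation Fact.out hpq.le hq (Lp.memLp _).1).trans ?_) _
  gcongr
  exact Lp.eLpNorm_le_ofReal (hM t ht')

end Paths

/-! ### Uniqueness -/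

section Uniqueness

variable {T : ℝ}

lemma exists_bound_of_iSup {V : Type*} [NormedAddCommGroup V] {z : ℝ → E3 → V} {e : ℝ}
    {K : ℝ≥0∞} (hK : K < ⊤)
    (h : ⨆ t ∈ Ioc 0 T, ENNReal.ofReal (t ^ e) * eLpNorm (z t) ⊤ volume ≤ K) :
    ∀ t ∈ Ioc 0 T, eLpNorm (z t) ⊤ volume ≤ ENNReal.ofReal (K.toReal * t ^ (-e)) := by
  intro t ht
  have htp : 0 < t := ht.1
  have h1 := (le_iSup₂ (f := fun t (_ : t ∈ Ioc 0 T) =>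
    ENNReal.ofReal (t ^ e) * eLpNorm (z t) ⊤ volume) t ht).trans h
  calc eLpNorm (z t) ⊤ volume
      = ENNReal.ofReal (t ^ (-e)) * (ENNReal.ofReal (t ^ e) * eLpNorm (z t) ⊤ volume) := by
        rw [← mul_assoc, ← ENNReal.ofReal_mul (by positivity), ← Real.rpow_add htp, neg_add_cancel,
          Real.rpow_zero, ENNReal.ofReal_one, one_mul]
    _ ≤ ENNReal.ofReal (t ^ (-e)) * K := by gcongr
    _ = _ := by
        rw [mul_comm, ENNReal.ofReal_mul ENNReal.toReal_nonneg, ENNReal.ofReal_toReal hK.ne]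

lemma norm_le_of_iSup {V : Type*} [NormedAddCommGroup V] {p : ℝ≥0∞}
    {z : ℝ → Lp V p (volume : Measure E3)} {K : ℝ≥0∞} (hK : K < ⊤)
    (h : ⨆ t ∈ Icc 0 T, eLpNorm (z t) p volume ≤ K) : ∀ t ∈ Icc 0 T, ‖z t‖ ≤ K.toReal := by
  intro t ht
  rw [Lp.norm_def]
  exact ENNReal.toReal_mono hK.ne ((le_iSup₂ (f := fun t (_ : t ∈ Icc 0 T) =>
    eLpNorm (z t) p volume) t ht).trans h)

lemma four_thirds_gt_one : (1 : ℝ≥0∞) < 4 / 3 := by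
  rw [ENNReal.lt_div_iff_mul_lt] <;> norm_num

lemma MemX.top_le {v : ℝ → VectorL3} (h : MemX T v) : ∀ t ∈ Ioc 0 T,
    eLpNorm (v t) ⊤ volume ≤ ENNReal.ofReal ((normX T v).toReal * t ^ (-(1 / 2 : ℝ))) := by
  refine exists_bound_of_iSup h.norm_lt_top ?_
  simp only [← Real.sqrt_eq_rpow]
  exact le_add_self

lemma MemY.top_le {η : ℝ → ScalarL1} (h : MemY T η) : ∀ t ∈ Ioc 0 T,
    eLpNorm (η t) ⊤ volume ≤ ENNReal.ofReal ((normY T η).toReal * t ^ (-(3 / 2 : ℝ))) :=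
  exists_bound_of_iSup h.norm_lt_top le_add_self

/-- Interpolation takes one quarter of the L^∞ norm in both cases, so the weights are 1/8 =
(1/2)(1/4) and 3/8 = (3/2)(1/4). The vanishing conditions at t = 0 in the definitions of X and Y are
what places their elements in the class where uniqueness holds. -/
lemma katoPath_of_mem {v : ℝ → VectorL3} {η : ℝ → ScalarL1} (hT : 0 < T) (hv : MemX T v)
    (hη : MemY T η) : KatoPath T (changeExponent 4 v) (changeExponent (4 / 3) η) where
  continuousOn_velocity := continuousOn_changeExponent (by norm_num) (by norm_num) (by norm_num)
    ENNReal.toReal_nonneg (hv.continuousOn.mono Ioc_subset_Icc_self) hv.top_le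
  continuousOn_temperature := continuousOn_changeExponent Fact.out (by finiteness) (by norm_num)
    ENNReal.toReal_nonneg (hη.continuousOn.mono Ioc_subset_Icc_self) hη.top_le
  tendsto_velocity := tendsto_changeExponent (e := 1 / 2) (by norm_num) (by norm_num) hT
    (by norm_num) (fun t ht => norm_le_of_iSup hv.norm_lt_top le_self_add t
      (Ioc_subset_Icc_self ht)) hv.top_le
    (by simpa only [← Real.sqrt_eq_rpow] using hv.tendsto_zero)
  tendsto_temperature := tendsto_changeExponent (e := 3 / 2) four_thirds_gt_one (by finiteness) hT
    (by norm_num) (fun t ht => norm_le_of_iSup hη.norm_lt_top le_self_add t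
      (Ioc_subset_Icc_self ht)) hη.top_le hη.tendsto_zero

/-- For positive times equality is obtained in L⁴ and L^{4/3} and carried back through almost
everywhere representatives. At t = 0 both paths equal the data. -/
lemma IsMildSolution.eqOn {u₀ : VectorL3} {θ₀ : ScalarL1} {u : ℝ → VelocityL4}
    {θ : ℝ → TemperatureL43} (hT : 0 < T) (h : KatoSolution T u₀ θ₀ u θ)
    (huniq : ∀ v η, KatoSolution T u₀ θ₀ v η → EqOn v u (Ioc 0 T) ∧ EqOn η θ (Ioc 0 T))
    {v : ℝ → VectorL3} {η : ℝ → ScalarL1} (hm : IsMildSolution T u₀ θ₀ v η) (hv : MemX T v)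
    (hη : MemY T η) :
    EqOn v (velocityThree u₀ u θ) (Icc 0 T) ∧ EqOn η (temperatureOne θ₀ u θ) (Icc 0 T) := by
  have h1 : ∀ s ∈ Ioc 0 T, v s =ᵐ[volume] changeExponent 4 v s := fun s hs =>
    (changeExponent_ae_eq (memLp_of_top (by norm_num) (by norm_num) (hv.top_le s hs))).symm
  have h2 : ∀ s ∈ Ioc 0 T, η s =ᵐ[volume] changeExponent (4 / 3) η s := fun s hs =>
    (changeExponent_ae_eq (memLp_of_top Fact.out (by finiteness) (hη.top_le s hs))).symm
  obtain ⟨h3, h4⟩ := huniq _ _ (hm.katoSolution (katoPath_of_mem hT hv hη) h1 h2)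
  constructor
  · intro t ht
    rcases eq_or_lt_of_le ht.1 with rfl | ht0
    · exact hm.initial_velocity.trans (if_pos rfl).symm
    · have ht' : t ∈ Ioc 0 T := ⟨ht0, ht.2⟩
      refine Lp.ext ((h1 t ht').trans ?_)
      rw [h3 ht']
      exact (h.velocityThree_ae_eq ht').symm
  · intro t ht
    rcases eq_or_lt_of_le ht.1 with rfl | ht0
    · exact hm.initial_temperature.trans (if_pos rfl).symm
    · have ht' : t ∈ Ioc 0 T := ⟨ht0, ht.2⟩
      refine Lp.ext ((h2 t ht').trans ?_)
      rw [h4 ht']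
      exact (h.temperatureOne_ae_eq ht').symm

end Uniqueness

end Boussinesq

end

/-! ### Existence and uniqueness in X × Y -/

theorem proposition1p1 (u₀ : Boussinesq.VectorL3) (θ₀ : Boussinesq.ScalarL1)
    (hu₀ : Boussinesq.IsDivergenceFree u₀) :
    ∃ T : ℝ, 0 < T ∧
      ∃ (u : ℝ → Boussinesq.VectorL3) (θ : ℝ → Boussinesq.ScalarL1),
        (Boussinesq.MemX T u ∧ Boussinesq.MemY T θ ∧
          Boussinesq.IsMildSolution T u₀ θ₀ u θ) ∧
        ∀ (v : ℝ → Boussinesq.VectorL3) (η : ℝ → Boussinesq.ScalarL1),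
          Boussinesq.MemX T v → Boussinesq.MemY T η →
          Boussinesq.IsMildSolution T u₀ θ₀ v η →
          EqOn v u (Icc 0 T) ∧ EqOn η θ (Icc 0 T) := by
  obtain ⟨T, hT, u, θ, A, B, h, hA, hB, hu, hθ, huniq⟩ := Boussinesq.exists_katoSolution u₀ θ₀
  have htop : Boussinesq.TopBound T A B u θ :=
    ⟨hA, hB, fun s hs => hu s ⟨hs.1, hs.2.le⟩, fun s hs => hθ s ⟨hs.1, hs.2.le⟩⟩
  exact ⟨T, hT, Boussinesq.velocityThree u₀ u θ, Boussinesq.temperatureOne θ₀ u θ,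
    ⟨h.memX hT hu₀ htop hu, h.memY hT htop hθ, h.isMildSolution⟩,
    fun v η hv hη hm => hm.eqOn hT h huniq hv hη⟩
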